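/- **Conventions.** A skew shape $A=\lambda/\mu$ is the set of boxes of the Young diagram of a partition $\lambda$ that do not lie in that of a partition $\mu$ contained in $\lambda$ (English convention: row $1$ at the top); its size is its number of boxes. Skew shapes are regarded as equal when their diagrams agree after deletion of empty rows and columns (in particular when they are translates of each other). A partition $\lambda$ also denotes the shape $\lambda/\emptyset$; $A^\circ$ is $A$ rotated by $180^\circ$; $A\oplus B$ is the skew shape obtained by placing $A$ immediately below and to the left of $B$ so that they share no rows or columns; $1^\ell$ denotes $\ell$ parts equal to $1$. For a composition $\alpha=(\alpha_1,\dots,\alpha_k)$ of $n$ let $S(\alpha)=\{\alpha_1,\alpha_1+\alpha_2,\dots,\alpha_1+\cdots+\alpha_{k-1}\}\subseteq[n-1]$, let $M_\alpha=\sum_{i_1<\cdots<i_k}x_{i_1}^{\alpha_1}\cdots x_{i_k}^{\alpha_k}$, and let $F_\alpha=\sum_{S(\alpha)\subseteq S(\beta)}M_\beta$, the sum being over compositions $\beta$ of $n$. For a skew shape $A$ of size $n$, the skew Schur function is $s_A=\sum_T F_{\mathrm{comp}(T)}$ over all standard Young tableaux $T$ of shape $A$, where $\mathrm{comp}(T)$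 is the composition of $n$ with $S(\mathrm{comp}(T))=\{i : i+1 \text{ is in a lower row of } T \text{ than } i\}$. A quasisymmetric function is $F$-positive if all its coefficients in the basis $\{F_\alpha\}$ are nonnegative; $\mathrm{supp}_F(A)$ is the set of $\alpha$ such that $F_\alpha$ has positive coefficient in $s_A$; and $A$ is $F$-multiplicity-free if all coefficients of $s_A$ in the basis $\{F_\alpha\}$ are $0$ or $1$. **Theorem.** Let $A$ and $B$ be $F$-multiplicity-free skew shapes of size $n$. Then $s_A=s_B$ if and only if $B\in\{A,A^\circ\}$. Moreover $s_A-s_B$ is $F$-positive if and only if $\mathrm{supp}_F(A)\supseteq\mathrm{supp}_F(B)$. If $B\notin\{A,A^\circ\}$, then $s_A-s_B$ is $F$-positive if and only if one of the following holds after possibly replacing $A$ by $A^\circ$ and/or $B$ by $B^\circ$: (a) $A=(1^\ell)\oplus(n-\ell)$ and $B\in\{(n-\ell,1^\ell),\,(n-\ell+1,1^{\ell-1})\}$ for some $1\le\ell\le n-1$; (b) $n\ge4$, $A=(1^2)\oplus(n-2)$ and $B=(n-2,2)$; (c) $n\ge4$, $A=(1^{n-2})\oplus(2)$ and $B=(2,2,1^{n-4})$.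 -/

import Mathlib

/-- A skew shape `λ/μ`: a pair of Young diagrams with `μ` contained in `λ`.  As in Mathlib, a box is
a pair `(i, j)` with `i` the row (counted downwards from `0`) and `j` the column. -/
structure SkewShape where
  outer : YoungDiagram
  inner : YoungDiagram
  inner_le : inner ≤ outer

namespace SkewShape

/-- The boxes of `λ/μ`. -/
def cells (A : SkewShape) : Finset (ℕ × ℕ) :=
  A.outer.cells \ A.inner.cells

/-- The number of boxes. -/
def size (A : SkewShape) : ℕ :=
  A.cells.card

/-- The set of boxes after deleting all empty rows and all empty columns: the box `(i, j)` moves to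
(number of nonempty rows above row `i`, number of nonempty columns left of column `j`). -/
def reducedCells (A : SkewShape) : Finset (ℕ × ℕ) :=
  A.cells.image fun c =>
    (((A.cells.image Prod.fst).filter (· < c.1)).card,
      ((A.cells.image Prod.snd).filter (· < c.2)).card)

/-- Skew shapes are identified when their diagrams agree after deleting empty rows and columns
(in particular, when their diagrams are translates of each other). -/
instance : Setoid SkewShape where
  r A B := A.reducedCells = B.reducedCells
  iseqv := ⟨fun _ => rfl, fun h => h.symm, fun h h' => h.trans h'⟩

/-- The straight shape `λ/∅`, where `λ` is the partition with the given multiset of parts. -/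
def straight (parts : Multiset ℕ) : SkewShape where
  outer := YoungDiagram.ofRowLens (parts.sort (· ≥ ·)) (parts.pairwise_sort (· ≥ ·)).sortedGE
  inner := ⊥
  inner_le := bot_le

/-- For `μ ≤ ν`, the complement of `μ` in the smallest rectangle containing `ν`, rotated by
180 degrees. -/
def rotCompl (ν μ : YoungDiagram) : YoungDiagram where
  cells := (Finset.range (ν.colLen 0) ×ˢ Finset.range (ν.rowLen 0)).filter fun c =>
    (ν.colLen 0 - 1 - c.1, ν.rowLen 0 - 1 - c.2) ∉ μ
  isLowerSet := by
    rintro ⟨i, j⟩ ⟨i', j'⟩ h hc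
    obtain ⟨h1, h2⟩ := Prod.mk_le_mk.1 h
    simp only [Finset.coe_filter, Finset.mem_product, Finset.mem_range, Set.mem_ofPred_eq] at hc ⊢
    exact ⟨⟨by omega, by omega⟩, fun hm => hc.2 (μ.up_left_mem (by omega) (by omega) hm)⟩

/-- The antipodal rotation `A°`: the boxes of `A` rotated by 180 degrees inside the smallest
rectangle containing `λ`. -/
def rotate (A : SkewShape) : SkewShape where
  outer := rotCompl A.outer A.inner
  inner := rotCompl A.outer A.outer
  inner_le := by
    rw [← YoungDiagram.cells_subset_iff]
    intro c hc
    simp only [rotCompl, Finset.mem_filter] at hc ⊢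
    exact ⟨hc.1, fun h => hc.2 (A.inner_le h)⟩

/-- Place `lo ≤ α` below and to the left of `hi ≤ β`, and fill the rectangle above `α` and to the
left of `β`. -/
def glue (α β lo hi : YoungDiagram) (hlo : lo ≤ α) (hhi : hi ≤ β) : YoungDiagram where
  cells := Finset.range (β.colLen 0) ×ˢ Finset.range (α.rowLen 0) ∪
    hi.cells.image (fun c => (c.1, c.2 + α.rowLen 0)) ∪
    lo.cells.image (fun c => (c.1 + β.colLen 0, c.2))
  isLowerSet := by
    have hrow : ∀ i j, (i, j) ∈ lo → j < α.rowLen 0 := fun i j h =>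
      YoungDiagram.mem_iff_lt_rowLen.1 (α.up_left_mem (Nat.zero_le i) le_rfl (hlo h))
    have hcol : ∀ i j, (i, j) ∈ hi → i < β.colLen 0 := fun i j h =>
      YoungDiagram.mem_iff_lt_colLen.1 (β.up_left_mem le_rfl (Nat.zero_le j) (hhi h))
    rintro ⟨i, j⟩ ⟨i', j'⟩ h hc
    obtain ⟨h1, h2⟩ := Prod.mk_le_mk.1 h
    simp only [Finset.coe_union, Set.mem_union, Finset.mem_coe, Finset.mem_product,
      Finset.mem_range, Finset.mem_image, Prod.mk.injEq, Prod.exists,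
      YoungDiagram.mem_cells] at hc ⊢
    rcases hc with (hc | ⟨a, b, hab, rfl, rfl⟩) | ⟨a, b, hab, rfl, rfl⟩
    · exact Or.inl (Or.inl ⟨by omega, by omega⟩)
    · have ha := hcol a b hab
      by_cases hj : j' < α.rowLen 0
      · exact Or.inl (Or.inl ⟨by omega, hj⟩)
      · exact Or.inl (Or.inr ⟨i', j' - α.rowLen 0,
          hi.up_left_mem h1 (by omega) hab, rfl, by omega⟩)
    · have hb := hrow a b hab
      by_cases hi' : i' < β.colLen 0
      · exact Or.inl (Or.inl ⟨hi', by omega⟩)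
      · exact Or.inr ⟨i' - β.colLen 0, j',
          lo.up_left_mem (by omega) h2 hab, by omega, rfl⟩

/-- `A ⊕ B`: the shape `A` placed immediately below and to the left of `B`, with no rows or columns
in common. -/
def oplus (A B : SkewShape) : SkewShape where
  outer := glue A.outer B.outer A.outer B.outer le_rfl le_rfl
  inner := glue A.outer B.outer A.inner B.inner A.inner_le B.inner_le
  inner_le := by
    rw [← YoungDiagram.cells_subset_iff]
    exact Finset.union_subset_union
      (Finset.union_subset_union le_rfl
        (Finset.image_subset_image (YoungDiagram.cells_subset_iff.2 B.inner_le)))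
      (Finset.image_subset_image (YoungDiagram.cells_subset_iff.2 A.inner_le))

/-- Standard Young tableaux of shape `A` with `n` boxes: bijective fillings increasing from left to
right along rows and downwards along columns.  The value `k : Fin n` stands for the entry `k + 1`. -/
def SYT (A : SkewShape) : Type :=
  {T : A.cells ≃ Fin A.size //
    (∀ c d : A.cells, c.1.1 = d.1.1 → c.1.2 < d.1.2 → T c < T d) ∧
    (∀ c d : A.cells, c.1.2 = d.1.2 → c.1.1 < d.1.1 → T c < T d)}

instance (A : SkewShape) : Fintype (SYT A) :=
  inferInstanceAs (Fintype {T : A.cells ≃ Fin A.size //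
    (∀ c d : A.cells, c.1.1 = d.1.1 → c.1.2 < d.1.2 → T c < T d) ∧
    (∀ c d : A.cells, c.1.2 = d.1.2 → c.1.1 < d.1.1 → T c < T d)})

/-- The descent set of `T`, a subset of `[n - 1]`, where `i : Fin (n - 1)` stands for the number
`i + 1`: it is a descent if the entry `i + 2` appears in a lower row than the entry `i + 1`. -/
def SYT.descentSet {A : SkewShape} (T : SYT A) : Finset (Fin (A.size - 1)) :=
  Finset.univ.filter fun i =>
    (T.1.symm ⟨i, by omega⟩).1.1 < (T.1.symm ⟨i + 1, by omega⟩).1.1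

end SkewShape

namespace QSym

/-- The bijection `α ↦ S(α) = {α₁, α₁ + α₂, …, α₁ + ⋯ + α_{k-1}}` from compositions of `n` to subsets
of `[n - 1]`, where `i : Fin (n - 1)` stands for the number `i + 1`. -/
def setOfComp (n : ℕ) : Composition n ≃ Finset (Fin (n - 1)) :=
  (compositionEquiv n).trans (compositionAsSetEquiv n)

open Classical in
/-- The monomial quasisymmetric function `M_α`, the sum of the distinct monomials
`x_{i_1}^{α_1} ⋯ x_{i_k}^{α_k}` over all `i_1 < ⋯ < i_k`. -/
noncomputable def monomialQ {n : ℕ} (α : Composition n) : MvPowerSeries ℕ ℚ :=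
  fun d => if ∃ i : Fin α.length → ℕ,
    StrictMono i ∧ d = ∑ k, Finsupp.single (i k) (α.blocksFun k) then 1 else 0

/-- The fundamental quasisymmetric function `F_α`, the sum of `M_β` over all compositions `β` of `n`
with `S(α) ⊆ S(β)`. -/
noncomputable def fundamental {n : ℕ} (α : Composition n) : MvPowerSeries ℕ ℚ :=
  ∑ β ∈ (Finset.univ : Finset (Composition n)).filter
    (fun β => setOfComp n α ⊆ setOfComp n β), monomialQ β

/-- `f = ∑ c_α F_α`, the sum being over the compositions `α` of `n`. -/
def IsFExpansion {n : ℕ} (f : MvPowerSeries ℕ ℚ) (c : Composition n → ℚ) : Prop :=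
  f = ∑ α, c α • fundamental α

/-- `f`, homogeneous of degree `n`, is `F`-positive: its coefficients in the `F`-basis are
nonnegative. -/
def FPositive (n : ℕ) (f : MvPowerSeries ℕ ℚ) : Prop :=
  ∃ c : Composition n → ℚ, IsFExpansion f c ∧ ∀ α, 0 ≤ c α

/-- The `F`-support of `f`, homogeneous of degree `n`: the compositions `α` such that `F_α` has
positive coefficient in the expansion of `f` in the `F`-basis. -/
def fSupport (n : ℕ) (f : MvPowerSeries ℕ ℚ) : Set (Composition n) :=
  {α | ∃ c : Composition n → ℚ, IsFExpansion f c ∧ 0 < c α}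

/-- `f`, homogeneous of degree `n`, is `F`-multiplicity-free: its coefficients in the `F`-basis are
all `0` or `1`. -/
def FMultiplicityFree (n : ℕ) (f : MvPowerSeries ℕ ℚ) : Prop :=
  ∃ c : Composition n → ℚ, IsFExpansion f c ∧ ∀ α, c α = 0 ∨ c α = 1

end QSym

/-- The skew Schur function `s_A`, the sum of `F_{comp(T)}` over all standard Young tableaux `T` of
shape `A`, where `comp(T)` is the composition corresponding to the descent set of `T`. -/
noncomputable def SkewShape.schur (A : SkewShape) : MvPowerSeries ℕ ℚ :=
  ∑ T : A.SYT, QSym.fundamental ((QSym.setOfComp A.size).symm T.descentSet)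

/-! Listing the cells of a standard tableau in the order of its entries gives a linear extension of
the diagram for the product order, and the composition of the tableau is encoded by a word with one
letter, descent or not, for each pair of consecutive cells. The F_α are linearly independent: among
the M_β only M_γ contains the monomial x_0^{γ_1} x_1^{γ_2} ⋯, so the coefficients of an expansion
can be recovered by induction on S(γ). Hence an F-multiplicity-free shape is one whose linear
extensions are determined by their words (`MultFree`). For two such shapes, F-positivity of the
difference, containment of supports and containment of the sets `words` are one and the same
condition.

It remains to classify the multiplicity-free diagrams and to compare their words.
Multiplicity-freeness passes to every window of consecutive rows and columns, to the transpose
(which complements words) and to the rotation (which reverses words). A short list of small windows,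
each refuted by two linear extensions with equal words, together with two families containing a long
row or column, then leaves few diagrams (`ColRep.classify`). Up to rotation these are hooks, a
column below and to the left of a row, the partitions (c,2), the 2 × 3 and 2 × 4 rectangles, and
transposes of these.

The words of a hook are all words with prescribed numbers of the two letters. Without the corner the
first letter is lost, so a column placed below a row has all words with one of two neighbouring
numbers of descents. It therefore contains two hooks, and also (c,2) or its transpose when the
numbers of descents fit; special words and descent counts exclude every other containment
(`Kind.words_subset`). All these sets of words are closed under reversal, so rotation does not
affect them. In each proper containment only the larger diagram is disconnected, so equal sets of
words force equal diagrams up to rotation. -/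

/-! ### Linear extensions of sets of cells and their descent words -/

/-- The descent word of a list of cells: for each pair of consecutive cells, whether the second one
lies in a lower row. -/
def desWord : List (ℕ × ℕ) → List Bool
  | [] => []
  | [_] => []
  | a :: b :: l => decide (a.1 < b.1) :: desWord (b :: l)

/-- The list `l` enumerates the cells of `C` compatibly with the product order. -/
def IsLinExt (C : Finset (ℕ × ℕ)) (l : List (ℕ × ℕ)) : Prop :=
  (∀ x, x ∈ l ↔ x ∈ C) ∧ l.Pairwise fun a b => ¬ b ≤ a

/-- Distinct linear extensions of `C` have distinct descent words. -/
def MultFree (C : Finset (ℕ × ℕ)) : Prop :=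
  ∀ l l', IsLinExt C l → IsLinExt C l' → desWord l = desWord l' → l = l'

/-- The set of descent words of linear extensions of `C`. -/
def words (C : Finset (ℕ × ℕ)) : Set (List Bool) :=
  {w | ∃ l, IsLinExt C l ∧ desWord l = w}

/-- Order-convex sets of cells. -/
def CellConvex (C : Finset (ℕ × ℕ)) : Prop :=
  ∀ i j i' j', (i, j) ∈ C → (i', j') ∈ C → ∀ a b, i ≤ a → a ≤ i' → j ≤ b → b ≤ j' → (a, b) ∈ C

@[simp] theorem desWord_nil : desWord [] = [] := rfl
@[simp] theorem desWord_singleton (a : ℕ × ℕ) : desWord [a] = [] := rfl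
@[simp] theorem desWord_cons_cons (a b : ℕ × ℕ) (l : List (ℕ × ℕ)) :
    desWord (a :: b :: l) = decide (a.1 < b.1) :: desWord (b :: l) := rfl

theorem length_desWord : ∀ l, (desWord l).length = l.length - 1
  | [] => rfl
  | [_] => rfl
  | a :: b :: l => by simp [length_desWord (b :: l)]

theorem desWord_append_cons : ∀ (k : List (ℕ × ℕ)) (a : ℕ × ℕ) (m : List (ℕ × ℕ)),
    desWord (k ++ a :: m) = desWord (k ++ [a]) ++ desWord (a :: m)
  | [], a, m => by simp
  | [b], a, m => by simp
  | b :: c :: k, a, m => by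
    have := desWord_append_cons (c :: k) a m
    simp only [List.cons_append, desWord_cons_cons, List.cons.injEq, true_and] at this ⊢
    exact this

theorem desWord_concat_concat (k : List (ℕ × ℕ)) (a b : ℕ × ℕ) :
    desWord (k ++ [a, b]) = desWord (k ++ [a]) ++ [decide (a.1 < b.1)] := by
  rw [desWord_append_cons]; simp

/-- Appending `k` adds to the word, besides the word of `k`, only the letter at the junction; `hb`
says that this letter agrees. -/
theorem desWord_append_congr {l l' k : List (ℕ × ℕ)} (hlen : l.length = l'.length)
    (h : desWord l = desWord l')
    (hb : ∀ a ∈ l.getLast?, ∀ a' ∈ l'.getLast?, ∀ b ∈ k.head?, (a.1 < b.1 ↔ a'.1 < b.1)) :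
    desWord (l ++ k) = desWord (l' ++ k) := by
  cases k with
  | nil => simpa using h
  | cons b k =>
    rcases List.eq_nil_or_concat l with rfl | ⟨l, a, rfl⟩
    · have : l' = [] := by simpa using hlen.symm
      subst this; rfl
    · rcases List.eq_nil_or_concat l' with rfl | ⟨l', a', rfl⟩
      · simp at hlen
      · have := hb a (by simp) a' (by simp) b (by simp)
        simp only [List.concat_eq_append, List.append_assoc, List.cons_append,
          List.nil_append] at h ⊢
        rw [desWord_append_cons l, desWord_append_cons l', h]
        simp [this]

theorem desWord_append_congr_right {k l l' : List (ℕ × ℕ)} (hlen : l.length = l'.length)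
    (h : desWord l = desWord l')
    (hb : ∀ a ∈ k.getLast?, ∀ b ∈ l.head?, ∀ b' ∈ l'.head?, (a.1 < b.1 ↔ a.1 < b'.1)) :
    desWord (k ++ l) = desWord (k ++ l') := by
  cases l with
  | nil =>
    have : l' = [] := by simpa using hlen.symm
    subst this; rfl
  | cons b l =>
    cases l' with
    | nil => simp at hlen
    | cons b' l' =>
      rcases List.eq_nil_or_concat k with rfl | ⟨k, a, rfl⟩
      · simpa using h
      · have := hb a (by simp) b (by simp) b' (by simp)
        simp only [List.concat_eq_append, List.append_assoc, List.cons_append,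
          List.nil_append] at h ⊢
        rw [desWord_append_cons k a, desWord_append_cons k a (b' :: l')]
        simp [this, h]

/-- Reflexivity of `≤` makes the pairwise condition exclude repetitions. -/
theorem IsLinExt.nodup {C l} (h : IsLinExt C l) : l.Nodup :=
  h.2.imp fun {a b} hab (hEq : a = b) => hab hEq.ge

theorem IsLinExt.toFinset_eq {C l} (h : IsLinExt C l) : l.toFinset = C := by
  ext x; simp [h.1]

theorem IsLinExt.length_eq {C l} (h : IsLinExt C l) : l.length = C.card := by
  rw [← h.toFinset_eq, List.toFinset_card_of_nodup h.nodup]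

/-- The lexicographic order extends the product order, so reading row by row works. -/
theorem exists_isLinExt (C : Finset (ℕ × ℕ)) : ∃ l, IsLinExt C l := by
  refine ⟨((C.map toLex.toEmbedding).sort (· ≤ ·)).map ofLex, ?_, ?_⟩
  · intro x; simp
  · rw [List.pairwise_map]
    have h := Finset.pairwise_sort (C.map toLex.toEmbedding) (· ≤ ·)
    have h2 := Finset.sort_nodup (C.map toLex.toEmbedding) (· ≤ ·)
    refine (h.and h2).imp ?_
    rintro a b ⟨hab, hne⟩ hba
    exact hne (le_antisymm hab (Prod.Lex.toLex_mono hba))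

theorem words_length {C w} (h : w ∈ words C) : w.length = C.card - 1 := by
  obtain ⟨l, hl, rfl⟩ := h
  rw [length_desWord, hl.length_eq]

theorem IsLinExt.not_le {C l m} (h : IsLinExt C (l ++ m)) {a b} (ha : a ∈ l) (hb : b ∈ m) :
    ¬ b ≤ a :=
  (List.pairwise_append.1 h.2).2.2 a ha b hb

theorem IsLinExt.append {C C₁ C₂ : Finset (ℕ × ℕ)} {l m} (hl : IsLinExt C₁ l) (hm : IsLinExt C₂ m)
    (hC : ∀ x, x ∈ C ↔ x ∈ C₁ ∨ x ∈ C₂) (h : ∀ a ∈ C₁, ∀ b ∈ C₂, ¬ b ≤ a) :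
    IsLinExt C (l ++ m) := by
  refine ⟨fun x => by simp [hl.1, hm.1, hC], List.pairwise_append.2 ⟨hl.2, hm.2, ?_⟩⟩
  intro a ha b hb
  exact h a ((hl.1 a).1 ha) b ((hm.1 b).1 hb)

/-! ### Cutting along rows and columns -/

/-- Two linear extensions of one part with equal words can be completed by the same linear extension
of the other part. The junction letter is always a descent, so the completed words agree as well. -/
theorem MultFree.of_rows {C C₁ C₂ : Finset (ℕ × ℕ)} (h : MultFree C)
    (hC : ∀ x, x ∈ C ↔ x ∈ C₁ ∨ x ∈ C₂) (hr : ∀ a ∈ C₁, ∀ b ∈ C₂, a.1 < b.1) :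
    MultFree C₁ ∧ MultFree C₂ := by
  have hnle : ∀ a ∈ C₁, ∀ b ∈ C₂, ¬ b ≤ a := fun a ha b hb hba =>
    absurd (hr a ha b hb) (not_lt.2 hba.1)
  constructor
  · intro l l' hl hl' hw
    obtain ⟨k, hk⟩ := exists_isLinExt C₂
    refine List.append_cancel_right
      (h (l ++ k) (l' ++ k) (hl.append hk hC hnle) (hl'.append hk hC hnle)
      (desWord_append_congr (by rw [hl.length_eq, hl'.length_eq]) hw ?_))
    intro a ha a' ha' b hb
    have hb := (hk.1 b).1 (List.mem_of_mem_head? hb)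
    have ha := (hl.1 a).1 (List.mem_of_getLast? ha)
    have ha' := (hl'.1 a').1 (List.mem_of_getLast? ha')
    exact iff_of_true (hr a ha b hb) (hr a' ha' b hb)
  · intro l l' hl hl' hw
    obtain ⟨k, hk⟩ := exists_isLinExt C₁
    refine List.append_cancel_left
      (h (k ++ l) (k ++ l') (hk.append hl hC hnle) (hk.append hl' hC hnle)
      (desWord_append_congr_right (by rw [hl.length_eq, hl'.length_eq]) hw ?_))
    intro a ha b hb b' hb'
    have ha := (hk.1 a).1 (List.mem_of_getLast? ha)
    have hb := (hl.1 b).1 (List.mem_of_mem_head? hb)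
    have hb' := (hl'.1 b').1 (List.mem_of_mem_head? hb')
    exact iff_of_true (hr a ha b hb) (hr a ha b' hb')

theorem MultFree.filter_row_lt {C : Finset (ℕ × ℕ)} (h : MultFree C) (r : ℕ) :
    MultFree (C.filter fun x => x.1 < r) :=
  (h.of_rows (C₂ := C.filter fun x => r ≤ x.1)
    (fun x => by have := lt_or_ge x.1 r; simp only [Finset.mem_filter]; tauto)
    (fun a ha b hb => by simp only [Finset.mem_filter] at ha hb; omega)).1

theorem MultFree.filter_row_ge {C : Finset (ℕ × ℕ)} (h : MultFree C) (r : ℕ) :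
    MultFree (C.filter fun x => r ≤ x.1) :=
  (h.of_rows (C₁ := C.filter fun x => x.1 < r)
    (fun x => by have := lt_or_ge x.1 r; simp only [Finset.mem_filter]; tauto)
    (fun a ha b hb => by simp only [Finset.mem_filter] at ha hb; omega)).2

/-! ### Relabelling rows and columns -/

theorem desWord_map {f : ℕ × ℕ → ℕ × ℕ} : ∀ {l : List (ℕ × ℕ)},
    (∀ a ∈ l, ∀ b ∈ l, ((f a).1 < (f b).1 ↔ a.1 < b.1)) → desWord (l.map f) = desWord l
  | [], _ => rfl
  | [_], _ => rfl
  | a :: b :: l, h => by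
    have ih := desWord_map (f := f) (l := b :: l)
      fun x hx y hy => h x (List.mem_cons_of_mem _ hx) y (List.mem_cons_of_mem _ hy)
    simp only [List.map_cons, desWord_cons_cons] at ih ⊢
    rw [ih]
    simp [h a (by simp) b (by simp)]

theorem eq_of_map_eq_of_injOn {α β : Type*} {f : α → β} {s : Set α} (hf : Set.InjOn f s) :
    ∀ {l l' : List α}, (∀ x ∈ l, x ∈ s) → (∀ x ∈ l', x ∈ s) → l.map f = l'.map f → l = l'
  | [], [], _, _, _ => rfl
  | [], _ :: _, _, _, h => by simp at h
  | _ :: _, [], _, _, h => by simp at h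
  | a :: l, b :: l', h1, h2, h => by
    simp only [List.map_cons, List.cons.injEq, List.forall_mem_cons] at h h1 h2
    rw [hf h1.1 h2.1 h.1, eq_of_map_eq_of_injOn hf h1.2 h2.2 h.2]

theorem IsLinExt.map {C l} {f : ℕ × ℕ → ℕ × ℕ} (hl : IsLinExt C l)
    (hf : ∀ a ∈ C, ∀ b ∈ C, f a ≤ f b → a ≤ b) : IsLinExt (C.image f) (l.map f) := by
  refine ⟨fun x => by simp [hl.1], List.pairwise_map.2 ?_⟩
  refine hl.2.imp_of_mem ?_
  intro a b ha hb hab hba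
  exact hab (hf b ((hl.1 b).1 hb) a ((hl.1 a).1 ha) hba)

theorem IsLinExt.exists_of_image {C l'} {f : ℕ × ℕ → ℕ × ℕ} (hl : IsLinExt (C.image f) l')
    (hf : ∀ a ∈ C, ∀ b ∈ C, f a ≤ f b ↔ a ≤ b) : ∃ l, IsLinExt C l ∧ l.map f = l' := by
  have hinj : Set.InjOn f C := fun a ha b hb hab =>
    le_antisymm ((hf a ha b hb).1 hab.le) ((hf b hb a ha).1 hab.ge)
  have hinv : ∀ x ∈ C.image f, f (Function.invFunOn f C x) = x := fun x hx =>
    Function.invFunOn_eq (by simpa using hx)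
  have hinv' : ∀ x ∈ C.image f, Function.invFunOn f C x ∈ C := fun x hx => by
    simpa using Function.invFunOn_mem (s := (C : Set (ℕ × ℕ))) (f := f) (b := x) (by simpa using hx)
  refine ⟨l'.map (Function.invFunOn f C), ?_, ?_⟩
  · have := hl.map (f := Function.invFunOn f C) (fun a ha b hb hab => by
      have := (hf _ (hinv' a ha) _ (hinv' b hb)).2 hab
      rwa [hinv a ha, hinv b hb] at this)
    convert this
    ext x
    simp only [Finset.mem_image]
    constructor
    · intro hx
      exact ⟨f x, ⟨x, hx, rfl⟩, hinj (hinv' _ (Finset.mem_image_of_mem _ hx)) hx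
        (hinv _ (Finset.mem_image_of_mem _ hx))⟩
    · rintro ⟨y, hy, rfl⟩
      exact hinv' y (by simpa using hy)
  · rw [List.map_map]
    conv_rhs => rw [← List.map_id l']
    exact List.map_congr_left fun x hx => hinv x ((hl.1 x).1 hx)

theorem words_image {C : Finset (ℕ × ℕ)} {f : ℕ × ℕ → ℕ × ℕ}
    (hf : ∀ a ∈ C, ∀ b ∈ C, f a ≤ f b ↔ a ≤ b)
    (hr : ∀ a ∈ C, ∀ b ∈ C, ((f a).1 < (f b).1 ↔ a.1 < b.1)) :
    words (C.image f) = words C := by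
  have hd : ∀ l, IsLinExt C l → desWord (l.map f) = desWord l := fun l hl =>
    desWord_map fun a ha b hb => hr a ((hl.1 a).1 ha) b ((hl.1 b).1 hb)
  ext w
  constructor
  · rintro ⟨l', hl', rfl⟩
    obtain ⟨l, hl, rfl⟩ := hl'.exists_of_image hf
    exact ⟨l, hl, (hd l hl).symm⟩
  · rintro ⟨l, hl, rfl⟩
    exact ⟨l.map f, hl.map fun a ha b hb => (hf a ha b hb).1, hd l hl⟩

theorem multFree_image {C : Finset (ℕ × ℕ)} {f : ℕ × ℕ → ℕ × ℕ}
    (hf : ∀ a ∈ C, ∀ b ∈ C, f a ≤ f b ↔ a ≤ b)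
    (hr : ∀ a ∈ C, ∀ b ∈ C, ((f a).1 < (f b).1 ↔ a.1 < b.1)) :
    MultFree (C.image f) ↔ MultFree C := by
  have hd : ∀ l, IsLinExt C l → desWord (l.map f) = desWord l := fun l hl =>
    desWord_map fun a ha b hb => hr a ((hl.1 a).1 ha) b ((hl.1 b).1 hb)
  have hinj : Set.InjOn f C := fun a ha b hb hab =>
    le_antisymm ((hf a ha b hb).1 hab.le) ((hf b hb a ha).1 hab.ge)
  constructor
  · intro h l l' hl hl' hw
    have := h _ _ (hl.map fun a ha b hb => (hf a ha b hb).1)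
      (hl'.map fun a ha b hb => (hf a ha b hb).1) (by rw [hd l hl, hd l' hl', hw])
    exact eq_of_map_eq_of_injOn hinj (fun x hx => (hl.1 x).1 hx) (fun x hx => (hl'.1 x).1 hx) this
  · intro h l l' hl hl' hw
    obtain ⟨l, hm, rfl⟩ := hl.exists_of_image hf
    obtain ⟨l', hm', rfl⟩ := hl'.exists_of_image hf
    rw [hd l hm, hd l' hm'] at hw
    rw [h l l' hm hm' hw]

/-! ### Transposition -/

/-- Moving strictly right and strictly down in one step is impossible: by convexity the corner
`(a.1, b.2)` lies in `C`, and it would have to be listed between `a` and `b`. So a non-descent is a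
descent of the transpose. -/
theorem IsLinExt.adjacent {C} (hC : CellConvex C) {k a b m} (h : IsLinExt C (k ++ a :: b :: m)) :
    a.2 < b.2 ↔ ¬ a.1 < b.1 := by
  obtain ⟨a1, a2⟩ := a
  obtain ⟨b1, b2⟩ := b
  have hab : ¬ ((b1, b2) : ℕ × ℕ) ≤ (a1, a2) := by
    have := (List.pairwise_append.1 h.2).2.1
    simp only [List.pairwise_cons] at this
    exact this.1 _ (by simp)
  rw [Prod.mk_le_mk] at hab
  simp only
  constructor
  · intro h2 h1
    have hc : (a1, b2) ∈ C := hC a1 a2 b1 b2 ((h.1 _).1 (by simp)) ((h.1 _).1 (by simp)) _ _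
      le_rfl h1.le h2.le le_rfl
    have hc := (h.1 _).2 hc
    simp only [List.mem_append, List.mem_cons] at hc
    rcases hc with hc | hc | hc | hc
    · exact h.not_le hc (b := (a1, a2)) (by simp) (Prod.mk_le_mk.2 ⟨le_rfl, h2.le⟩)
    · simp only [Prod.mk.injEq] at hc; omega
    · simp only [Prod.mk.injEq] at hc; omega
    · have := (List.pairwise_append.1 h.2).2.1
      simp only [List.pairwise_cons] at this
      exact this.2.1 _ hc (Prod.mk_le_mk.2 ⟨h1.le, le_rfl⟩)
  · omega

theorem IsLinExt.desWord_swap {C} (hC : CellConvex C) : ∀ {k m}, IsLinExt C (k ++ m) →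
    desWord (m.map Prod.swap) = (desWord m).map not
  | _, [], _ => rfl
  | _, [_], _ => rfl
  | k, a :: b :: m, h => by
    have ih := IsLinExt.desWord_swap hC (k := k ++ [a]) (m := b :: m) (by simpa using h)
    have := h.adjacent hC
    simp only [List.map_cons, desWord_cons_cons, Prod.fst_swap, this] at ih ⊢
    rw [ih]
    simp only [decide_not]

theorem words_swap {C} (hC : CellConvex C) :
    words (C.image Prod.swap) = (List.map not) '' words C := by
  have hf : ∀ a ∈ C, ∀ b ∈ C, a.swap ≤ b.swap ↔ a ≤ b := fun a _ b _ => Prod.swap_le_swap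
  ext w
  constructor
  · rintro ⟨l', hl', rfl⟩
    obtain ⟨l, hl, rfl⟩ := hl'.exists_of_image hf
    exact ⟨_, ⟨l, hl, rfl⟩, (IsLinExt.desWord_swap hC (k := []) hl).symm⟩
  · rintro ⟨_, ⟨l, hl, rfl⟩, rfl⟩
    exact ⟨_, hl.map fun a ha b hb => (hf a ha b hb).1, IsLinExt.desWord_swap hC (k := []) hl⟩

theorem map_not_injective : Function.Injective (List.map not) :=
  List.map_injective_iff.2 Bool.not_injective

theorem MultFree.swap {C} (hC : CellConvex C) (h : MultFree C) : MultFree (C.image Prod.swap) := by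
  have hf : ∀ a ∈ C, ∀ b ∈ C, a.swap ≤ b.swap ↔ a ≤ b := fun a _ b _ => Prod.swap_le_swap
  intro l l' hl hl' hw
  obtain ⟨l, hm, rfl⟩ := hl.exists_of_image hf
  obtain ⟨l', hm', rfl⟩ := hl'.exists_of_image hf
  rw [IsLinExt.desWord_swap hC (k := []) hm, IsLinExt.desWord_swap hC (k := []) hm'] at hw
  rw [h l l' hm hm' (map_not_injective hw)]

theorem CellConvex.swap {C} (hC : CellConvex C) : CellConvex (C.image Prod.swap) := by
  intro i j i' j' h h' a b h1 h2 h3 h4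
  simp only [Finset.mem_image, Prod.exists, Prod.swap_prod_mk, Prod.mk.injEq,
    ] at h h' ⊢
  obtain ⟨_, _, h, rfl, rfl⟩ := h
  obtain ⟨_, _, h', rfl, rfl⟩ := h'
  exact ⟨b, a, hC _ _ _ _ h h' _ _ h3 h4 h1 h2, rfl, rfl⟩

theorem image_swap_swap (C : Finset (ℕ × ℕ)) : (C.image Prod.swap).image Prod.swap = C := by
  simp [Finset.image_image]

/-! ### Restriction to windows -/

/-- The part of `C` in rows `r₀ ≤ i < r₁` and columns `c₀ ≤ j < c₁`. -/
def cellWindow (C : Finset (ℕ × ℕ)) (r₀ r₁ c₀ c₁ : ℕ) : Finset (ℕ × ℕ) :=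
  C.filter fun x => r₀ ≤ x.1 ∧ x.1 < r₁ ∧ c₀ ≤ x.2 ∧ x.2 < c₁

theorem mem_cellWindow {C r₀ r₁ c₀ c₁ x} : x ∈ cellWindow C r₀ r₁ c₀ c₁ ↔
    x ∈ C ∧ r₀ ≤ x.1 ∧ x.1 < r₁ ∧ c₀ ≤ x.2 ∧ x.2 < c₁ := by
  simp [cellWindow]

theorem MultFree.rowWindow {C} (h : MultFree C) (r₀ r₁ : ℕ) :
    MultFree (C.filter fun x => r₀ ≤ x.1 ∧ x.1 < r₁) := by
  have := (h.filter_row_ge r₀).filter_row_lt r₁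
  rwa [Finset.filter_filter] at this

/-- Columns are cut off as rows of the transpose; this is where convexity is needed. -/
theorem MultFree.window {C} (hC : CellConvex C) (h : MultFree C) (r₀ r₁ c₀ c₁ : ℕ) :
    MultFree (cellWindow C r₀ r₁ c₀ c₁) := by
  have h1 := (h.swap hC).rowWindow c₀ c₁
  have e : (C.image Prod.swap).filter (fun x => c₀ ≤ x.1 ∧ x.1 < c₁) =
      (C.filter fun x => c₀ ≤ x.2 ∧ x.2 < c₁).image Prod.swap := by
    ext ⟨i, j⟩; simp
  rw [e] at h1
  have hC1 : CellConvex (C.filter fun x => c₀ ≤ x.2 ∧ x.2 < c₁) := by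
    intro i j i' j' h h' a b h1 h2 h3 h4
    simp only [Finset.mem_filter] at h h' ⊢
    exact ⟨hC _ _ _ _ h.1 h'.1 _ _ h1 h2 h3 h4, by omega⟩
  have h2 := h1.swap hC1.swap
  rw [image_swap_swap] at h2
  have h3 := h2.rowWindow r₀ r₁
  convert h3 using 1
  ext x
  simp only [mem_cellWindow, Finset.mem_filter]
  tauto

/-! ### Rotation -/

theorem desWord_reverse : ∀ (l : List (ℕ × ℕ)) (f : ℕ × ℕ → ℕ × ℕ),
    (∀ a ∈ l, ∀ b ∈ l, ((f b).1 < (f a).1 ↔ a.1 < b.1)) →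
    desWord (l.reverse.map f) = (desWord l).reverse
  | [], _, _ => rfl
  | [_], _, _ => rfl
  | a :: b :: l, f, h => by
    have ih := desWord_reverse (b :: l) f
      fun x hx y hy => h x (List.mem_cons_of_mem _ hx) y (List.mem_cons_of_mem _ hy)
    have := h a (by simp) b (by simp)
    simp only [List.reverse_cons, List.map_append, List.map_cons, List.map_nil, List.append_assoc,
      List.cons_append, List.nil_append, desWord_cons_cons] at ih ⊢
    rw [desWord_concat_concat, ih]
    simp [this]

theorem IsLinExt.reverse_map {C l} {f : ℕ × ℕ → ℕ × ℕ} (hl : IsLinExt C l)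
    (hf : ∀ a ∈ C, ∀ b ∈ C, f a ≤ f b → b ≤ a) : IsLinExt (C.image f) (l.reverse.map f) := by
  refine ⟨fun x => by simp [hl.1], List.pairwise_map.2 (List.pairwise_reverse.2 ?_)⟩
  refine hl.2.imp_of_mem ?_
  intro a b ha hb hab hba
  exact hab (hf a ((hl.1 a).1 ha) b ((hl.1 b).1 hb) hba)

theorem reverse_mem_words_image {C : Finset (ℕ × ℕ)} {f : ℕ × ℕ → ℕ × ℕ}
    (hf : ∀ a ∈ C, ∀ b ∈ C, f a ≤ f b → b ≤ a)
    (hr : ∀ a ∈ C, ∀ b ∈ C, ((f b).1 < (f a).1 ↔ a.1 < b.1)) {w} (hw : w ∈ words C) :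
    w.reverse ∈ words (C.image f) := by
  obtain ⟨l, hl, rfl⟩ := hw
  exact ⟨_, hl.reverse_map hf, desWord_reverse l f
    fun a ha b hb => hr a ((hl.1 a).1 ha) b ((hl.1 b).1 hb)⟩

theorem MultFree.of_image_reverse {C : Finset (ℕ × ℕ)} {f : ℕ × ℕ → ℕ × ℕ}
    (hf : ∀ a ∈ C, ∀ b ∈ C, f a ≤ f b → b ≤ a)
    (hr : ∀ a ∈ C, ∀ b ∈ C, ((f b).1 < (f a).1 ↔ a.1 < b.1)) (h : MultFree (C.image f)) :
    MultFree C := by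
  have hd : ∀ l, IsLinExt C l → desWord (l.reverse.map f) = (desWord l).reverse := fun l hl =>
    desWord_reverse l f fun a ha b hb => hr a ((hl.1 a).1 ha) b ((hl.1 b).1 hb)
  have hinj : Set.InjOn f C := fun a ha b hb hab =>
    le_antisymm (hf b hb a ha hab.ge) (hf a ha b hb hab.le)
  intro l l' hl hl' hw
  have := h _ _ (hl.reverse_map hf) (hl'.reverse_map hf) (by rw [hd l hl, hd l' hl', hw])
  rw [List.map_reverse, List.map_reverse, List.reverse_inj] at this
  exact eq_of_map_eq_of_injOn hinj (fun x hx => (hl.1 x).1 hx) (fun x hx => (hl'.1 x).1 hx) this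

/-- Rotation by 180 degrees in an `r × c` box. -/
def rotCells (r c : ℕ) (C : Finset (ℕ × ℕ)) : Finset (ℕ × ℕ) :=
  C.image fun x => (r - 1 - x.1, c - 1 - x.2)

/-- `C` lies in the box with `r` rows and `c` columns. -/
def InBox (r c : ℕ) (C : Finset (ℕ × ℕ)) : Prop :=
  ∀ x ∈ C, x.1 < r ∧ x.2 < c

theorem mem_rotCells {r c C} (h : InBox r c C) {i j} :
    (i, j) ∈ rotCells r c C ↔ i < r ∧ j < c ∧ (r - 1 - i, c - 1 - j) ∈ C := by
  simp only [rotCells, Finset.mem_image, Prod.exists, Prod.mk.injEq]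
  constructor
  · rintro ⟨a, b, hab, rfl, rfl⟩
    have := h _ hab
    simp only at this
    refine ⟨by omega, by omega, ?_⟩
    rwa [show r - 1 - (r - 1 - a) = a by omega, show c - 1 - (c - 1 - b) = b by omega]
  · rintro ⟨hi, hj, hm⟩
    exact ⟨_, _, hm, by omega, by omega⟩

theorem InBox.rot {r c C} (h : InBox r c C) : InBox r c (rotCells r c C) := by
  rintro ⟨i, j⟩ hx
  rw [mem_rotCells h] at hx
  exact ⟨hx.1, hx.2.1⟩

theorem rotCells_rotCells {r c C} (h : InBox r c C) : rotCells r c (rotCells r c C) = C := by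
  ext ⟨i, j⟩
  rw [mem_rotCells h.rot, mem_rotCells h]
  constructor
  · rintro ⟨h1, h2, _, _, h3⟩
    rwa [show r - 1 - (r - 1 - i) = i by omega, show c - 1 - (c - 1 - j) = j by omega] at h3
  · intro hm
    have := h _ hm
    simp only at this
    refine ⟨this.1, this.2, by omega, by omega, ?_⟩
    rwa [show r - 1 - (r - 1 - i) = i by omega, show c - 1 - (c - 1 - j) = j by omega]

theorem InBox.rot_le {r c C} (h : InBox r c C) : ∀ a ∈ C, ∀ b ∈ C,
    ((r - 1 - a.1, c - 1 - a.2) : ℕ × ℕ) ≤ (r - 1 - b.1, c - 1 - b.2) → b ≤ a := by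
  intro a ha b hb hab
  have h1 := h a ha
  have h2 := h b hb
  rw [Prod.mk_le_mk] at hab
  exact Prod.le_def.2 (by omega)

theorem InBox.rot_lt {r c C} (h : InBox r c C) : ∀ a ∈ C, ∀ b ∈ C,
    (r - 1 - b.1 < r - 1 - a.1 ↔ a.1 < b.1) := by
  intro a ha b hb
  have h1 := h a ha
  have h2 := h b hb
  omega

theorem words_rotCells {r c C} (h : InBox r c C) :
    words (rotCells r c C) = List.reverse '' words C := by
  ext w
  constructor
  · intro hw
    have := reverse_mem_words_image h.rot.rot_le h.rot.rot_lt hw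
    change _ ∈ words (rotCells r c (rotCells r c C)) at this
    rw [rotCells_rotCells h] at this
    exact ⟨_, this, List.reverse_reverse w⟩
  · rintro ⟨w, hw, rfl⟩
    exact reverse_mem_words_image h.rot_le h.rot_lt hw

theorem MultFree.rot {r c C} (h : InBox r c C) (hC : MultFree C) :
    MultFree (rotCells r c C) := by
  refine MultFree.of_image_reverse h.rot.rot_le h.rot.rot_lt ?_
  change MultFree (rotCells r c (rotCells r c C))
  rwa [rotCells_rotCells h]

/-! ### Sets of cells without multiplicity-free descent words -/

/-- `l` and `l'` are distinct linear extensions, with the same descent word, of the same set of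
cells in a box with `H` rows and `W` columns. -/
def BadPair (H W : ℕ) (l l' : List (ℕ × ℕ)) : Prop :=
  (∀ x ∈ l, x ∈ l') ∧ (∀ x ∈ l', x ∈ l) ∧ (l.Pairwise fun a b => ¬ b ≤ a) ∧
    (l'.Pairwise fun a b => ¬ b ≤ a) ∧ desWord l = desWord l' ∧ l ≠ l' ∧ ∀ x ∈ l, x.1 < H ∧ x.2 < W

/-- Each explicit forbidden window below is verified by evaluating this instance. -/
instance (H W : ℕ) (l l' : List (ℕ × ℕ)) : Decidable (BadPair H W l l') := by
  unfold BadPair; infer_instance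

theorem BadPair.not_multFree {H W l l'} (h : BadPair H W l l') : ¬ MultFree l.toFinset := by
  obtain ⟨h1, h2, h3, h4, h5, h6, _⟩ := h
  intro hm
  exact h6 (hm l l' ⟨by simp, h3⟩ ⟨fun x => by simpa using ⟨h2 x, h1 x⟩, h4⟩ h5)

theorem MultFree.no_window {C} (hC : CellConvex C) (h : MultFree C) (r₀ c₀ H W : ℕ)
    (l l' : List (ℕ × ℕ)) (hb : BadPair H W l l')
    (hw : ∀ i < H, ∀ j < W, ((r₀ + i, c₀ + j) ∈ C ↔ (i, j) ∈ l)) : False := by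
  refine hb.not_multFree ?_
  have hm := h.window hC r₀ (r₀ + H) c₀ (c₀ + W)
  have e : cellWindow C r₀ (r₀ + H) c₀ (c₀ + W) =
      l.toFinset.image fun x => (r₀ + x.1, c₀ + x.2) := by
    ext ⟨i, j⟩
    simp only [mem_cellWindow, Finset.mem_image, List.mem_toFinset, Prod.exists, Prod.mk.injEq]
    constructor
    · rintro ⟨hm, h1, h2, h3, h4⟩
      refine ⟨i - r₀, j - c₀, (hw _ (by omega) _ (by omega)).1 ?_, by omega, by omega⟩
      rwa [Nat.add_sub_cancel' h1, Nat.add_sub_cancel' h3]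
    · rintro ⟨a, b, hab, rfl, rfl⟩
      have := hb.2.2.2.2.2.2 _ hab
      simp only at this
      exact ⟨(hw _ this.1 _ this.2).2 hab, by omega⟩
  rw [e] at hm
  refine (multFree_image ?_ ?_).1 hm
  · intro a _ b _; simp [Prod.le_def]
  · intro a _ b _; simp

/-- A column with at least two cells, a cell `x` to its left, not above its lowest cell, and a cell
`z` to its right, not below its highest cell. -/
theorem not_multFree_column {C : Finset (ℕ × ℕ)} {j a b x1 x2 z1 z2 : ℕ} (hab : a < b)
    (hx1 : b ≤ x1) (hx2 : x2 < j) (hz1 : z1 ≤ a) (hz2 : j < z2)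
    (hC : ∀ i k, (i, k) ∈ C ↔ (k = j ∧ a ≤ i ∧ i ≤ b) ∨ (i = x1 ∧ k = x2) ∨ (i = z1 ∧ k = z2)) :
    ¬ MultFree C := by
  intro hm
  -- Only the two highest cells of the column, `x` and `z` are rearranged; the rest of the column is
  -- listed afterwards.
  obtain ⟨k, hk⟩ := exists_isLinExt (C.filter fun y => y.2 = j ∧ a + 2 ≤ y.1)
  have hk' : ∀ y ∈ k, y.2 = j ∧ a + 2 ≤ y.1 ∧ y.1 ≤ b := by
    rintro ⟨y1, y2⟩ hy
    have := (hk.1 _).1 hy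
    simp only [Finset.mem_filter, hC] at this ⊢
    omega
  have key : ∀ l : List (ℕ × ℕ), (l.Pairwise fun a b => ¬ b ≤ a) →
      (∀ y, y ∈ l ↔ y = (a, j) ∨ y = (a + 1, j) ∨ y = (x1, x2) ∨ y = (z1, z2)) →
      IsLinExt C (l ++ k) := by
    intro l hl hmem
    refine ⟨?_, List.pairwise_append.2 ⟨hl, hk.2, ?_⟩⟩
    · rintro ⟨y1, y2⟩
      simp only [List.mem_append, hmem, hk.1, Finset.mem_filter, hC, Prod.mk.injEq]
      omega
    · rintro ⟨u1, u2⟩ hu ⟨v1, v2⟩ hv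
      have := hk' _ hv
      simp only [hmem, Prod.mk.injEq, Prod.mk_le_mk] at hu this ⊢
      omega
  -- Both beginnings have the word `[false, true, false]`, and both end above the rest of the
  -- column, so the junction letter is `true` in each.
  have := hm ([(a, j), (z1, z2), (x1, x2), (a + 1, j)] ++ k)
    ([(x1, x2), (a, j), (a + 1, j), (z1, z2)] ++ k)
    (key _ (by simp [Prod.mk_le_mk]; omega) (by rintro ⟨y1, y2⟩; simp; omega))
    (key _ (by simp [Prod.mk_le_mk]; omega) (by rintro ⟨y1, y2⟩; simp; omega))
    (desWord_append_congr (by simp) (by simp; omega) (by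
      intro u hu u' hu' v hv
      have := hk' v (List.mem_of_mem_head? hv)
      simp at hu hu'
      subst hu hu'
      simp only
      omega))
  simp only [List.cons_append, List.cons.injEq, Prod.mk.injEq] at this
  omega

/-- A row with at least two cells, a cell `x` above it, not to the left of its last cell, and a cell
`z` below it, not to the right of its first cell. -/
theorem not_multFree_row {C : Finset (ℕ × ℕ)} {i a b x1 x2 z1 z2 : ℕ} (hab : a < b)
    (hx1 : x1 < i) (hx2 : b ≤ x2) (hz1 : i < z1) (hz2 : z2 ≤ a)
    (hC : ∀ y k, (y, k) ∈ C ↔ (y = i ∧ a ≤ k ∧ k ≤ b) ∨ (y = x1 ∧ k = x2) ∨ (y = z1 ∧ k = z2)) :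
    ¬ MultFree C := by
  intro hm
  obtain ⟨k, hk⟩ := exists_isLinExt (C.filter fun y => y.1 = i ∧ a + 2 ≤ y.2)
  have hk' : ∀ y ∈ k, y.1 = i ∧ a + 2 ≤ y.2 ∧ y.2 ≤ b := by
    rintro ⟨y1, y2⟩ hy
    have := (hk.1 _).1 hy
    simp only [Finset.mem_filter, hC] at this ⊢
    omega
  have key : ∀ l : List (ℕ × ℕ), (l.Pairwise fun a b => ¬ b ≤ a) →
      (∀ y, y ∈ l ↔ y = (i, a) ∨ y = (i, a + 1) ∨ y = (x1, x2) ∨ y = (z1, z2)) →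
      IsLinExt C (l ++ k) := by
    intro l hl hmem
    refine ⟨?_, List.pairwise_append.2 ⟨hl, hk.2, ?_⟩⟩
    · rintro ⟨y1, y2⟩
      simp only [List.mem_append, hmem, hk.1, Finset.mem_filter, hC, Prod.mk.injEq]
      omega
    · rintro ⟨u1, u2⟩ hu ⟨v1, v2⟩ hv
      have := hk' _ hv
      simp only [hmem, Prod.mk.injEq, Prod.mk_le_mk] at hu this ⊢
      omega
  -- Both beginnings have the word `[true, false, true]`, and both end in row `i` or below it, so
  -- the junction letter is `false` in each.
  have := hm ([(i, a), (z1, z2), (x1, x2), (i, a + 1)] ++ k)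
    ([(x1, x2), (i, a), (i, a + 1), (z1, z2)] ++ k)
    (key _ (by simp [Prod.mk_le_mk]; omega) (by rintro ⟨y1, y2⟩; simp; omega))
    (key _ (by simp [Prod.mk_le_mk]; omega) (by rintro ⟨y1, y2⟩; simp; omega))
    (desWord_append_congr (by simp) (by simp; omega) (by
      intro u hu u' hu' v hv
      have := hk' v (List.mem_of_mem_head? hv)
      simp at hu hu'
      subst hu hu'
      simp only
      omega))
  simp only [List.cons_append, List.cons.injEq, Prod.mk.injEq] at this
  omega

/-! ### Description of skew diagrams by columns -/

/-- `C` is the skew diagram with `r` nonempty rows and `c` nonempty columns whose column `j` consists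
of the rows `p j ≤ i < q j`. -/
structure ColRep (C : Finset (ℕ × ℕ)) (r c : ℕ) (p q : ℕ → ℕ) : Prop where
  mem : ∀ i j, (i, j) ∈ C ↔ j < c ∧ p j ≤ i ∧ i < q j
  lt : ∀ j < c, p j < q j
  p_succ_le : ∀ j, j + 1 < c → p (j + 1) ≤ p j
  q_succ_le : ∀ j, j + 1 < c → q (j + 1) ≤ q j
  -- No row is skipped between consecutive columns; equality means that the diagram splits there.
  p_le_q_succ : ∀ j, j + 1 < c → p j ≤ q (j + 1)
  pos : 0 < c
  q_zero : q 0 = r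
  p_last : p (c - 1) = 0

namespace ColRep

variable {C : Finset (ℕ × ℕ)} {r c : ℕ} {p q : ℕ → ℕ}

theorem p_anti (h : ColRep C r c p q) {j j' : ℕ} (hj : j ≤ j') (hc : j' < c) : p j' ≤ p j := by
  induction j', hj using Nat.le_induction with
  | base => exact le_rfl
  | succ k _ ih => exact (h.p_succ_le k hc).trans (ih (by omega))

theorem q_anti (h : ColRep C r c p q) {j j' : ℕ} (hj : j ≤ j') (hc : j' < c) : q j' ≤ q j := by
  induction j', hj using Nat.le_induction with
  | base => exact le_rfl
  | succ k _ ih => exact (h.q_succ_le k hc).trans (ih (by omega))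

theorem convex (h : ColRep C r c p q) : CellConvex C := by
  intro i j i' j' h1 h2 a b ha ha' hb hb'
  rw [h.mem] at *
  have := h.p_anti hb (by omega)
  have := h.q_anti hb' (by omega)
  omega

theorem inBox (h : ColRep C r c p q) : InBox r c C := by
  rintro ⟨i, j⟩ hx
  rw [h.mem] at hx
  have := h.q_anti (Nat.zero_le j) hx.1
  have := h.q_zero
  simp only
  omega

theorem rot (h : ColRep C r c p q) : ColRep (rotCells r c C) r c
    (fun j => r - q (c - 1 - j)) (fun j => r - p (c - 1 - j)) := by
  have hc := h.pos
  have hqr : ∀ j < c, q j ≤ r := fun j hj => h.q_zero ▸ h.q_anti (Nat.zero_le j) hj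
  refine ⟨?_, ?_, ?_, ?_, ?_, hc, ?_, ?_⟩
  · intro i j
    rw [mem_rotCells h.inBox, h.mem]
    have := hqr (c - 1 - j) (by omega)
    have := h.lt (c - 1 - j) (by omega)
    omega
  · intro j hj
    have := hqr (c - 1 - j) (by omega)
    have := h.lt (c - 1 - j) (by omega)
    omega
  · intro j hj
    have := h.q_succ_le (c - 1 - (j + 1)) (by omega)
    rw [show c - 1 - (j + 1) + 1 = c - 1 - j by omega] at this
    omega
  · intro j hj
    have := h.p_succ_le (c - 1 - (j + 1)) (by omega)
    rw [show c - 1 - (j + 1) + 1 = c - 1 - j by omega] at this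
    omega
  · intro j hj
    have := h.p_le_q_succ (c - 1 - (j + 1)) (by omega)
    rw [show c - 1 - (j + 1) + 1 = c - 1 - j by omega] at this
    omega
  · simp only [Nat.sub_zero, h.p_last]
  · rw [show c - 1 - (c - 1) = 0 by omega, h.q_zero, Nat.sub_self]

theorem no_pattern (h : ColRep C r c p q) (hm : MultFree C) (r₀ c₀ H W : ℕ)
    (l l' : List (ℕ × ℕ)) (hb : BadPair H W l l')
    (hw : ∀ i < H, ∀ j < W,
      (c₀ + j < c ∧ p (c₀ + j) ≤ r₀ + i ∧ r₀ + i < q (c₀ + j) ↔ (i, j) ∈ l)) : False :=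
  hm.no_window h.convex r₀ c₀ H W l l' hb fun i hi j hj => by rw [h.mem]; exact hw i hi j hj

end ColRep

theorem exists_first_drop {f : ℕ → ℕ} {c : ℕ} (hf : ∀ j < c, f j ≤ f 0) (h : f (c - 1) < f 0) :
    ∃ i, i + 1 < c ∧ f (i + 1) < f 0 ∧ ∀ j ≤ i, f j = f 0 := by
  classical
  have hex : ∃ j, f j < f 0 := ⟨_, h⟩
  have h1 := Nat.find_spec hex
  have h2 : Nat.find hex ≤ c - 1 := Nat.find_min' hex h
  have h0 : Nat.find hex ≠ 0 := fun h0 => by rw [h0] at h1; exact lt_irrefl _ h1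
  refine ⟨Nat.find hex - 1, by omega, ?_, ?_⟩
  · rwa [show Nat.find hex - 1 + 1 = Nat.find hex by omega]
  · intro j hj
    have := Nat.find_min hex (m := j) (by omega)
    have := hf j (by omega)
    omega

theorem exists_last_drop {f : ℕ → ℕ} : ∀ {j₀ : ℕ}, (∀ j < j₀, f (j + 1) ≤ f j) → f j₀ < f 0 →
    ∃ i < j₀, f j₀ < f i ∧ ∀ j, i < j → j ≤ j₀ → f j = f j₀
  | 0, _, h => absurd h (lt_irrefl _)
  | j₀ + 1, hf, h => by
    rcases (hf j₀ (by omega)).lt_or_eq with hlt | heq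
    · exact ⟨j₀, by omega, hlt, fun j h1 h2 => by rw [show j = j₀ + 1 by omega]⟩
    · obtain ⟨i, hi, h1, h2⟩ := exists_last_drop (f := f) (j₀ := j₀)
        (fun j hj => hf j (by omega)) (by omega)
      refine ⟨i, by omega, by omega, fun j h3 h4 => ?_⟩
      rcases Nat.lt_or_ge j (j₀ + 1) with h5 | h5
      · rw [h2 j h3 (by omega), heq]
      · rw [show j = j₀ + 1 by omega]

/-! ### Classification of the multiplicity-free skew diagrams -/

/-- The multiplicity-free skew diagrams, up to rotation: hooks with `r` rows and `c` columns; a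
column of `r - 1` cells below and to the left of a row of `c - 1` cells; the partitions `(c, 2)` and
their transposes; rectangles with two rows and their transposes. -/
inductive Kind
  | hook (r c : ℕ)
  | disc (r c : ℕ)
  | two (c : ℕ)
  | twoT (r : ℕ)
  | rect (c : ℕ)
  | rectT (r : ℕ)

namespace Kind

/-- The number of rows. -/
def rows : Kind → ℕ
  | hook r _ => r
  | disc r _ => r
  | two _ => 2
  | twoT r => r
  | rect _ => 2
  | rectT r => r

/-- The number of columns. -/
def cols : Kind → ℕ
  | hook _ c => c
  | disc _ c => c
  | two c => c
  | twoT _ => 2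
  | rect c => c
  | rectT _ => 2

/-- The parameters are those of a multiplicity-free diagram. -/
def Valid : Kind → Prop
  | hook r c => 1 ≤ r ∧ 1 ≤ c
  | disc r c => 2 ≤ r ∧ 2 ≤ c
  | two c => 2 ≤ c
  | twoT r => 2 ≤ r
  | rect c => c = 3 ∨ c = 4
  | rectT r => r = 3 ∨ r = 4

/-- The cells, as a predicate on the bounding box. -/
def Mem : Kind → ℕ → ℕ → Prop
  | hook _ _, i, j => i = 0 ∨ j = 0
  | disc _ _, i, j => (i = 0 ∧ j ≠ 0) ∨ (i ≠ 0 ∧ j = 0)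
  | two _, i, j => i = 0 ∨ j < 2
  | twoT _, i, j => j = 0 ∨ i < 2
  | rect _, _, _ => True
  | rectT _, _, _ => True

open Classical in
/-- The cells of the diagram. -/
noncomputable def cells (k : Kind) : Finset (ℕ × ℕ) :=
  (Finset.range k.rows ×ˢ Finset.range k.cols).filter fun x => k.Mem x.1 x.2

theorem mem_cells {k : Kind} {i j : ℕ} :
    (i, j) ∈ k.cells ↔ i < k.rows ∧ j < k.cols ∧ k.Mem i j := by
  simp [cells, and_assoc]

theorem inBox (k : Kind) : InBox k.rows k.cols k.cells := by
  rintro ⟨i, j⟩ h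
  rw [mem_cells] at h
  exact ⟨h.1, h.2.1⟩

end Kind

namespace ColRep

variable {C : Finset (ℕ × ℕ)} {r c : ℕ} {p q : ℕ → ℕ}

/-- Outside hooks the cell `(1, 1)` is present. With at least three rows and three columns, each of
the five possible 3 × 3 upper left corners is forbidden. With two rows, the forbidden windows are
the 2 × 5 rectangle and the partition (4,3), which leave (c,2) and the short rectangles; two columns
are treated symmetrically. -/
theorem classify_straight (h : ColRep C r c p q) (hm : MultFree C) (h0 : p 0 = 0) :
    ∃ k : Kind, k.Valid ∧ k.rows = r ∧ k.cols = c ∧ C = k.cells := by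
  have hp : ∀ j < c, p j = 0 := fun j hj => by
    have := h.p_anti (Nat.zero_le j) hj; omega
  have hq : ∀ j < c, 0 < q j := fun j hj => by have := h.lt j hj; omega
  have hqr : ∀ j < c, q j ≤ r := fun j hj => h.q_zero ▸ h.q_anti (Nat.zero_le j) hj
  have hc := h.pos
  have hr : 0 < r := by have := hq 0 hc; have := h.q_zero; omega
  have hq0 := h.q_zero
  have hmem : ∀ i j, (i, j) ∈ C ↔ j < c ∧ i < q j := fun i j => by
    rw [h.mem]
    constructor
    · rintro ⟨h1, h2, h3⟩; exact ⟨h1, h3⟩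
    · rintro ⟨h1, h3⟩; exact ⟨h1, by rw [hp j h1]; omega, h3⟩
  by_cases h11 : 1 < c ∧ 1 < q 1
  · obtain ⟨hc1, hq1⟩ := h11
    have hr1 : 1 < r := by have := hqr 1 hc1; omega
    have hp1 := hp 1 hc1
    by_cases hc2 : c = 2
    · subst hc2
      have key : ∀ k : Kind, k.rows = r → k.cols = 2 →
          (∀ i < r, k.Mem i 0) → (∀ i < r, (k.Mem i 1 ↔ i < q 1)) → C = k.cells := by
        intro k hkr hkc hk0 hk1
        ext ⟨i, j⟩
        rw [hmem, Kind.mem_cells, hkr, hkc]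
        constructor
        · rintro ⟨hj, hi⟩
          have := hqr j hj
          refine ⟨by omega, hj, ?_⟩
          interval_cases j
          · exact hk0 _ (by omega)
          · exact (hk1 _ (by omega)).2 hi
        · rintro ⟨hi, hj, hk⟩
          refine ⟨hj, ?_⟩
          interval_cases j
          · omega
          · exact (hk1 _ hi).1 hk
      by_cases h2 : q 1 = 2
      · exact ⟨Kind.twoT r, hr1, rfl, rfl, key _ rfl rfl (fun i _ => Or.inl rfl)
          (fun i hi => by simp [Kind.Mem, h2])⟩
      · have hqr1 := hqr 1 (by omega)
        by_cases h3 : q 1 < r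
        · exfalso
          refine h.no_pattern hm (q 1 - 3) 0 4 2
            [(0, 0), (1, 0), (0, 1), (1, 1), (2, 0), (2, 1), (3, 0)]
            [(0, 0), (1, 0), (0, 1), (2, 0), (3, 0), (1, 1), (2, 1)] (by decide) ?_
          intro i hi j hj
          interval_cases j <;>
            simp only [List.mem_cons, Prod.mk.injEq, List.not_mem_nil, and_true, or_false, Nat.zero_add] <;> omega
        · by_cases h5 : 5 ≤ r
          · exfalso
            refine h.no_pattern hm 0 0 5 2
              [(0, 0), (1, 0), (0, 1), (1, 1), (2, 0), (2, 1), (3, 0), (4, 0), (3, 1), (4, 1)]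
              [(0, 0), (1, 0), (0, 1), (2, 0), (3, 0), (1, 1), (2, 1), (4, 0), (3, 1), (4, 1)]
              (by decide) ?_
            intro i hi j hj
            interval_cases j <;>
              simp only [List.mem_cons, Prod.mk.injEq, List.not_mem_nil, and_true, or_false, Nat.zero_add] <;> omega
          · refine ⟨Kind.rectT r, ?_, rfl, rfl, key _ rfl rfl (fun i _ => trivial)
              (fun i hi => iff_of_true trivial (by omega))⟩
            change r = 3 ∨ r = 4
            omega
    · have hp2 := hp 2 (by omega)
      have hq2 := hq 2 (by omega)
      have hq21 : q 2 ≤ q 1 := h.q_succ_le 1 (by omega)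
      by_cases hr2 : r = 2
      · subst hr2
        have key : ∀ k : Kind, k.rows = 2 → k.cols = c →
            (∀ j < c, k.Mem 0 j) → (∀ j < c, (k.Mem 1 j ↔ 1 < q j)) → C = k.cells := by
          intro k hkr hkc hk0 hk1
          ext ⟨i, j⟩
          rw [hmem, Kind.mem_cells, hkr, hkc]
          constructor
          · rintro ⟨hj, hi⟩
            have := hqr j hj
            have hi2 : i < 2 := by omega
            refine ⟨hi2, hj, ?_⟩
            interval_cases i
            · exact hk0 _ hj
            · exact (hk1 _ hj).2 hi
          · rintro ⟨hi, hj, hk⟩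
            refine ⟨hj, ?_⟩
            interval_cases i
            · exact hq j hj
            · exact (hk1 _ hj).1 hk
        by_cases hall : q (c - 1) = 2
        · have hq2' : ∀ j < c, q j = 2 := fun j hj => by
            have := h.q_anti (j := j) (j' := c - 1) (by omega) (by omega)
            have := hqr j hj
            omega
          by_cases h5 : 5 ≤ c
          · exfalso
            refine h.no_pattern hm 0 0 2 5
              [(0, 0), (0, 1), (1, 0), (0, 2), (0, 3), (1, 1), (1, 2), (0, 4), (1, 3), (1, 4)]
              [(0, 0), (0, 1), (1, 0), (1, 1), (0, 2), (1, 2), (0, 3), (0, 4), (1, 3), (1, 4)]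
              (by decide) ?_
            intro i hi j hj
            rw [hp (0 + j) (by omega), hq2' (0 + j) (by omega)]
            interval_cases j <;>
              simp only [List.mem_cons, Prod.mk.injEq, List.not_mem_nil, and_true, or_false] <;> omega
          · refine ⟨Kind.rect c, ?_, rfl, rfl, key _ rfl rfl (fun i _ => trivial)
              (fun j hj => iff_of_true trivial (by have := hq2' j hj; omega))⟩
            change c = 3 ∨ c = 4
            omega
        · obtain ⟨d, hd, hd1, hd2⟩ := exists_first_drop (f := q) (c := c)
            (fun j hj => h.q_anti (Nat.zero_le j) hj)
            (by have := hqr (c - 1) (by omega); omega)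
          rw [hq0] at hd1 hd2
          have hd3 := hq (d + 1) hd
          have hd0 : d ≠ 0 := by rintro rfl; simp only [Nat.zero_add] at hd1; omega
          by_cases hd' : d = 1
          · subst hd'
            refine ⟨Kind.two c, by change 2 ≤ c; omega, rfl, rfl, key _ rfl rfl
              (fun i _ => Or.inl rfl) ?_⟩
            intro j hj
            simp only [Kind.Mem, one_ne_zero, false_or]
            constructor
            · intro hj2
              have := hd2 j (by omega); omega
            · intro hqj
              by_contra hj2
              have := h.q_anti (j := 2) (j' := j) (by omega) hj
              simp only [Nat.reduceAdd] at hd1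
              omega
          · exfalso
            -- Column `v + 2` is the last one with two cells; with the two columns before it and the
            -- one after it, it forms the partition (4,3).
            obtain ⟨v, rfl⟩ : ∃ v, d = v + 2 := ⟨d - 2, by omega⟩
            have e0 := hd2 v (by omega)
            have e1 := hd2 (v + 1) (by omega)
            have e2 := hd2 (v + 2) (by omega)
            have f0 := hp v (by omega)
            have f1 := hp (v + 1) (by omega)
            have f2 := hp (v + 2) (by omega)
            have f3 := hp (v + 3) (by omega)
            rw [show v + 2 + 1 = v + 3 by omega] at *
            refine h.no_pattern hm 0 v 2 4
              [(0, 0), (0, 1), (1, 0), (0, 2), (0, 3), (1, 1), (1, 2)]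
              [(0, 0), (0, 1), (1, 0), (1, 1), (0, 2), (1, 2), (0, 3)] (by decide) ?_
            intro i hi j hj
            interval_cases j <;>
              simp only [List.mem_cons, Prod.mk.injEq, List.not_mem_nil, and_true, or_false, Nat.add_zero] <;> omega
      · exfalso
        by_cases h22 : 2 < q 2
        · refine h.no_pattern hm 0 0 3 3
            [(0, 0), (0, 1), (1, 0), (0, 2), (2, 0), (1, 1), (2, 1), (1, 2), (2, 2)]
            [(0, 0), (0, 1), (1, 0), (1, 1), (2, 0), (0, 2), (2, 1), (1, 2), (2, 2)] (by decide) ?_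
          intro i hi j hj
          interval_cases j <;>
            simp only [List.mem_cons, Prod.mk.injEq, List.not_mem_nil, and_true, or_false, Nat.zero_add] <;> omega
        by_cases h12 : 1 < q 2
        · by_cases h21 : 2 < q 1
          · refine h.no_pattern hm 0 0 3 3
              [(0, 0), (0, 1), (1, 0), (0, 2), (1, 1), (1, 2), (2, 0), (2, 1)]
              [(0, 0), (0, 1), (1, 0), (0, 2), (2, 0), (1, 1), (2, 1), (1, 2)] (by decide) ?_
            intro i hi j hj
            interval_cases j <;>
              simp only [List.mem_cons, Prod.mk.injEq, List.not_mem_nil, and_true, or_false, Nat.zero_add] <;> omega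
          · refine h.no_pattern hm 0 0 3 3
              [(0, 0), (0, 1), (1, 0), (0, 2), (1, 1), (1, 2), (2, 0)]
              [(0, 0), (0, 1), (1, 0), (1, 1), (2, 0), (0, 2), (1, 2)] (by decide) ?_
            intro i hi j hj
            interval_cases j <;>
              simp only [List.mem_cons, Prod.mk.injEq, List.not_mem_nil, and_true, or_false, Nat.zero_add] <;> omega
        · by_cases h21 : 2 < q 1
          · refine h.no_pattern hm 0 0 3 3
              [(0, 0), (0, 1), (1, 0), (0, 2), (2, 0), (1, 1), (2, 1)]
              [(0, 0), (0, 1), (1, 0), (1, 1), (2, 0), (0, 2), (2, 1)] (by decide) ?_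
            intro i hi j hj
            interval_cases j <;>
              simp only [List.mem_cons, Prod.mk.injEq, List.not_mem_nil, and_true, or_false, Nat.zero_add] <;> omega
          · refine h.no_pattern hm 0 0 3 3
              [(0, 0), (0, 1), (1, 0), (0, 2), (2, 0), (1, 1)]
              [(0, 0), (0, 1), (1, 0), (1, 1), (2, 0), (0, 2)] (by decide) ?_
            intro i hi j hj
            interval_cases j <;>
              simp only [List.mem_cons, Prod.mk.injEq, List.not_mem_nil, and_true, or_false, Nat.zero_add] <;> omega
  · refine ⟨Kind.hook r c, ⟨hr, hc⟩, rfl, rfl, ?_⟩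
    ext ⟨i, j⟩
    rw [hmem, Kind.mem_cells]
    simp only [Kind.rows, Kind.cols, Kind.Mem]
    constructor
    · rintro ⟨hj, hi⟩
      have := hqr j hj
      refine ⟨by omega, hj, ?_⟩
      by_contra hcon
      have := h.q_anti (j := 1) (j' := j) (by omega) hj
      omega
    · rintro ⟨hi, hj, rfl | rfl⟩
      · exact ⟨hj, hq j hj⟩
      · exact ⟨hj, by omega⟩

/-- Consecutive columns of which neither the tops nor the bottoms agree have no common row. -/
theorem disconnected_of_drop (h : ColRep C r c p q) (hm : MultFree C) {j : ℕ} (hj : j + 1 < c)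
    (h1 : p (j + 1) < p j) (h2 : q (j + 1) < q j) : p j = q (j + 1) := by
  have h3 := h.p_le_q_succ j hj
  by_contra hne
  -- The number of common rows is one, two, or at least three. In the last case the three lowest
  -- common rows and the row below them form the partition (2,2,2,1).
  by_cases k1 : q (j + 1) = p j + 1
  · refine h.no_pattern hm (p j - 1) j 3 2
      [(0, 1), (1, 0), (1, 1), (2, 0)] [(1, 0), (2, 0), (0, 1), (1, 1)] (by decide) ?_
    intro i hi j hj
    interval_cases j <;>
      simp only [List.mem_cons, Prod.mk.injEq, List.not_mem_nil, and_true, or_false, Nat.add_zero] <;> omega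
  by_cases k2 : q (j + 1) = p j + 2
  · refine h.no_pattern hm (p j - 1) j 4 2
      [(1, 0), (0, 1), (1, 1), (2, 0), (2, 1), (3, 0)]
      [(1, 0), (0, 1), (2, 0), (3, 0), (1, 1), (2, 1)] (by decide) ?_
    intro i hi j hj
    interval_cases j <;>
      simp only [List.mem_cons, Prod.mk.injEq, List.not_mem_nil, and_true, or_false, Nat.add_zero] <;> omega
  · refine h.no_pattern hm (q (j + 1) - 3) j 4 2
      [(0, 0), (1, 0), (0, 1), (1, 1), (2, 0), (2, 1), (3, 0)]
      [(0, 0), (1, 0), (0, 1), (2, 0), (3, 0), (1, 1), (2, 1)] (by decide) ?_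
    intro i hi j hj
    interval_cases j <;>
      simp only [List.mem_cons, Prod.mk.injEq, List.not_mem_nil, and_true, or_false, Nat.add_zero] <;> omega

/-- In a disconnected diagram, the part on the lower left is a single column or a single row. -/
theorem lower_part (h : ColRep C r c p q) (hm : MultFree C) {j : ℕ} (hj : j + 1 < c)
    (hd : p j = q (j + 1)) : j = 0 ∨ (r = p j + 1 ∧ ∀ k ≤ j, p k = p j ∧ q k = p j + 1) := by
  have hlt := h.lt j (by omega)
  have hlt1 := h.lt (j + 1) hj
  rcases j with _ | u
  · exact Or.inl rfl
  right
  change p (u + 2) < q (u + 2) at hlt1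
  change p (u + 1) = q (u + 2) at hd
  change u + 2 < c at hj
  have hpu := h.p_succ_le u (by omega)
  have hqu := h.q_succ_le u (by omega)
  have hltu := h.lt u (by omega)
  have hpq := h.p_le_q_succ u (by omega)
  set s := p (u + 1) with hs
  -- If column `u` started lower, its top cell, column `u + 1` and the cell above and to the right
  -- would form the pattern of `not_multFree_column`, provided that column `u + 1` has two cells.
  -- With a single cell there, three antidiagonal cells appear.
  have hu : p u = s := by
    by_contra hne
    by_cases hv : q (u + 1) = s + 1
    · refine h.no_pattern hm (s - 1) u 3 3
        [(0, 2), (2, 0), (1, 1)] [(1, 1), (2, 0), (0, 2)] (by decide) ?_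
      intro i hi j hj
      interval_cases j <;>
        simp only [List.mem_cons, Prod.mk.injEq, List.not_mem_nil, and_true, or_false, Nat.add_zero] <;> omega
    · refine not_multFree_column (C := cellWindow C (s - 1) (p u + 1) u (u + 3)) (j := u + 1)
        (a := s) (b := min (p u) (q (u + 1) - 1)) (x1 := p u) (x2 := u) (z1 := s - 1) (z2 := u + 2)
        (by omega) (by omega) (by omega) (by omega) (by omega) ?_ (hm.window h.convex _ _ _ _)
      intro i k
      simp only [mem_cellWindow, h.mem]
      rcases (by omega : k = u ∨ k = u + 1 ∨ k = u + 2 ∨ k < u ∨ u + 3 ≤ k)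
        with rfl | rfl | rfl | hk | hk
      · omega
      · omega
      · omega
      · omega
      · omega
  -- Otherwise a 2 × 2 square with a lone cell above and to the right of it appears.
  have hv : q (u + 1) = s + 1 := by
    by_contra hne
    refine h.no_pattern hm (s - 1) u 3 3
      [(1, 0), (0, 2), (2, 0), (1, 1), (2, 1)] [(1, 0), (1, 1), (2, 0), (0, 2), (2, 1)]
      (by decide) ?_
    intro i hi j hj
    interval_cases j <;>
      simp only [List.mem_cons, Prod.mk.injEq, List.not_mem_nil, and_true, or_false, Nat.add_zero] <;> omega
  have hpk : ∀ k ≤ u + 1, s ≤ p k := fun k hk => h.p_anti hk (by omega)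
  -- Otherwise some column reaches below row `s`. After the last such column `v` only single cells
  -- in row `s` follow, up to column `u + 1`. This stretch of row `s`, the cell `(s + 1, v)` and the
  -- cell `(s - 1, u + 2)` form the pattern of `not_multFree_row`.
  have hr : r = s + 1 := by
    by_contra hne
    have hr' : q (u + 1) ≤ q 0 := h.q_anti (Nat.zero_le _) (by omega)
    obtain ⟨v, hv1, hv2, hv3⟩ := exists_last_drop (f := q) (j₀ := u + 1)
      (fun j hj => h.q_succ_le j (by omega)) (by rw [h.q_zero] at *; omega)
    have hpv : ∀ k, v < k → k ≤ u + 1 → p k = s := fun k h1 h2 => by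
      have := hv3 k h1 h2
      have := hpk k h2
      have := h.lt k (by omega)
      omega
    have hpqv := h.p_le_q_succ v (by omega)
    have := hv3 (v + 1) (by omega) (by omega)
    have hpkv := hpk v (by omega)
    have huv : v = u → p v = s := by rintro rfl; exact hu
    -- Column `v` itself meets row `s` only if its top is `s`, which decides where the stretch
    -- begins.
    refine not_multFree_row (C := cellWindow C (s - 1) (s + 2) v (u + 3)) (i := s)
      (a := if p v = s then v else v + 1) (b := u + 1) (x1 := s - 1) (x2 := u + 2)
      (z1 := s + 1) (z2 := v) (by split_ifs <;> omega) (by omega) (by omega) (by omega)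
      (by split_ifs <;> omega) ?_ (hm.window h.convex _ _ _ _)
    intro i k
    simp only [mem_cellWindow, h.mem]
    rcases (by omega : k = v ∨ (v < k ∧ k ≤ u + 1) ∨ k = u + 2 ∨ k < v ∨ u + 3 ≤ k)
      with rfl | ⟨hk1, hk2⟩ | rfl | hk | hk
    · split_ifs <;> omega
    · have := hv3 k hk1 hk2
      have := hpv k hk1 hk2
      split_ifs <;> omega
    · split_ifs <;> omega
    · split_ifs <;> omega
    · split_ifs <;> omega
  refine ⟨hr, fun k hk => ?_⟩
  have := hpk k hk
  have := h.lt k (by omega)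
  have := h.q_anti (Nat.zero_le k) (by omega)
  have := h.q_zero
  omega

/-- Two columns whose tops drop to the right, followed by columns whose bottoms rise. -/
theorem not_multFree_of_top_drop_first (h : ColRep C r c p q) {u v s t : ℕ} (huv : u < v)
    (hv : v + 1 < c) (hu : s < p u) (hp : ∀ k, u < k → k ≤ v + 1 → p k = s)
    (hq : ∀ k, u ≤ k → k ≤ v → q k = t) (ht : q (v + 1) < t) : ¬ MultFree C := by
  intro hm
  have hpu : p u < t := hq u le_rfl huv.le ▸ h.lt u (by omega)
  have hqv : s < q (v + 1) := hp (v + 1) (by omega) le_rfl ▸ h.lt (v + 1) hv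
  have hpv1 := hp (v + 1) (by omega) le_rfl
  have hpv := hp v huv (by omega)
  have hqv' := hq v huv.le le_rfl
  have hqu := hq u le_rfl huv.le
  -- The columns `u + 1, …, v` fill the rows from `s` to `t - 1`, column `u` lacks its upper part
  -- and column `v + 1` its lower part. The forbidden window depends on whether columns `u` and `v +
  -- 1` have a row in common.
  rcases Nat.lt_or_ge (p u) (q (v + 1)) with hlt | hge
  · by_cases hm1 : v = u + 1 ∧ q (v + 1) = p u + 1
    · obtain ⟨rfl, h1⟩ := hm1
      change q (u + 2) = p u + 1 at h1
      change p (u + 2) = s at hpv1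
      change q (u + 2) < t at ht
      refine h.no_pattern hm (p u - 1) u 3 3
        [(0, 1), (1, 0), (0, 2), (1, 1), (1, 2), (2, 0), (2, 1)]
        [(0, 1), (1, 0), (0, 2), (2, 0), (1, 1), (2, 1), (1, 2)] (by decide) ?_
      intro i hi j hj
      interval_cases j <;>
        simp only [List.mem_cons, Prod.mk.injEq, List.not_mem_nil, and_true, or_false,
          Nat.add_zero] <;> omega
    -- The last two rows of column `v + 1` and the row below, in columns `v - 1`, `v`, `v + 1`: the
    -- 3 × 3 square without its last cell.
    · obtain ⟨x, rfl⟩ : ∃ x, v = x + 1 := ⟨v - 1, by omega⟩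
      have hpx : p x ≤ q (x + 1 + 1) - 2 := by
        rcases Nat.lt_or_ge u x with hx | hx
        · have := hp x hx (by omega); omega
        · have : x = u := by omega
          subst this
          omega
      have hqx := hq x (by omega) (by omega)
      change p x ≤ q (x + 2) - 2 at hpx
      change q (x + 2) < t at ht
      change p (x + 2) = s at hpv1
      change s < q (x + 2) at hqv
      change p u < q (x + 2) at hlt
      change x + 2 < c at hv
      refine h.no_pattern hm (q (x + 2) - 2) x 3 3
        [(0, 0), (0, 1), (1, 0), (0, 2), (1, 1), (1, 2), (2, 0), (2, 1)]
        [(0, 0), (0, 1), (1, 0), (0, 2), (2, 0), (1, 1), (2, 1), (1, 2)] (by decide) ?_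
      intro i hi j hj
      interval_cases j <;>
        simp only [List.mem_cons, Prod.mk.injEq, List.not_mem_nil, and_true, or_false,
          Nat.add_zero] <;> omega
  · by_cases hm1 : v = u + 1
    · subst hm1
      change q (u + 2) ≤ p u at hge
      change p (u + 2) = s at hpv1
      change s < q (u + 2) at hqv
      refine not_multFree_column (C := cellWindow C (q (u + 2) - 1) (p u + 1) u (u + 3))
        (j := u + 1) (a := q (u + 2) - 1) (b := p u) (x1 := p u) (x2 := u)
        (z1 := q (u + 2) - 1) (z2 := u + 2)
        (by omega) (by omega) (by omega) (by omega) (by omega) ?_ (hm.window h.convex _ _ _ _)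
      intro i k
      simp only [mem_cellWindow, h.mem]
      rcases (by omega : k = u ∨ k = u + 1 ∨ k = u + 2 ∨ k < u ∨ u + 3 ≤ k)
        with rfl | rfl | rfl | hk | hk <;> omega
    · obtain ⟨x, rfl⟩ : ∃ x, v = x + 1 := ⟨v - 1, by omega⟩
      have hpx := hp x (by omega) (by omega)
      have hqx := hq x (by omega) (by omega)
      change q (x + 2) ≤ p u at hge
      change q (x + 2) < t at ht
      change p (x + 2) = s at hpv1
      change s < q (x + 2) at hqv
      change x + 2 < c at hv
      -- The window starts at the last row of column `x + 2`. Strict inequality guarantees two more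
      -- rows in the full columns; otherwise a window of two rows and four columns is used.
      by_cases hh : q (x + 2) < p u
      · refine h.no_pattern hm (q (x + 2) - 1) x 3 3
          [(0, 0), (0, 1), (1, 0), (0, 2), (2, 0), (1, 1), (2, 1)]
          [(0, 0), (0, 1), (1, 0), (1, 1), (2, 0), (0, 2), (2, 1)] (by decide) ?_
        intro i hi j hj
        interval_cases j <;>
          simp only [List.mem_cons, Prod.mk.injEq, List.not_mem_nil, and_true, or_false,
            Nat.add_zero] <;> omega
      · by_cases hx : x = u + 1
        · subst hx
          change q (u + 3) ≤ p u at hge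
          change ¬ q (u + 3) < p u at hh
          change q (u + 3) < t at ht
          change p (u + 3) = s at hpv1
          change s < q (u + 3) at hqv
          change p (u + 2) = s at hpv
          change q (u + 2) = t at hqv'
          refine h.no_pattern hm (q (u + 3) - 1) u 2 4
            [(0, 1), (1, 0), (0, 2), (0, 3), (1, 1), (1, 2)]
            [(0, 1), (1, 0), (1, 1), (0, 2), (1, 2), (0, 3)] (by decide) ?_
          intro i hi j hj
          interval_cases j <;>
            simp only [List.mem_cons, Prod.mk.injEq, List.not_mem_nil, and_true, or_false,
              Nat.add_zero] <;> omega
        · obtain ⟨y, rfl⟩ : ∃ y, x = y + 1 := ⟨x - 1, by omega⟩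
          have hpy := hp y (by omega) (by omega)
          have hqy := hq y (by omega) (by omega)
          change q (y + 3) ≤ p u at hge
          change ¬ q (y + 3) < p u at hh
          change q (y + 3) < t at ht
          change p (y + 3) = s at hpv1
          change s < q (y + 3) at hqv
          change p (y + 2) = s at hpv
          change q (y + 2) = t at hqv'
          refine h.no_pattern hm (q (y + 3) - 1) y 2 4
            [(0, 0), (0, 1), (1, 0), (0, 2), (0, 3), (1, 1), (1, 2)]
            [(0, 0), (0, 1), (1, 0), (1, 1), (0, 2), (1, 2), (0, 3)] (by decide) ?_
          intro i hi j hj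
          interval_cases j <;>
            simp only [List.mem_cons, Prod.mk.injEq, List.not_mem_nil, and_true, or_false,
              Nat.add_zero] <;> omega

/-- Columns whose bottoms rise to the right, followed by columns whose tops rise. -/
theorem not_multFree_of_bottom_drop_first (h : ColRep C r c p q) {u v s t : ℕ} (huv : u < v)
    (hv : v + 1 < c) (hu : t < q u) (hq : ∀ k, u < k → k ≤ v + 1 → q k = t)
    (hp : ∀ k, u ≤ k → k ≤ v → p k = s) (hs : p (v + 1) < s) : ¬ MultFree C := by
  intro hm
  have hst : s < t := by
    have := h.lt v (by omega)
    rwa [hp v huv.le le_rfl, hq v huv (by omega)] at this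
  have hqv1 := hq (v + 1) (by omega) le_rfl
  have hpu := hp u le_rfl huv.le
  -- If the columns between have a single cell, they form a row with one cell below its start and
  -- one above its end. Otherwise the last two rows before `t` and the row below them contain the
  -- partition (3,3,1).
  by_cases hh : t = s + 1
  · refine not_multFree_row (C := cellWindow C (s - 1) (s + 2) u (v + 2)) (i := s)
      (a := u) (b := v + 1) (x1 := s - 1) (x2 := v + 1) (z1 := s + 1) (z2 := u)
      (by omega) (by omega) (by omega) (by omega) (by omega) ?_ (hm.window h.convex _ _ _ _)
    intro i k
    simp only [mem_cellWindow, h.mem]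
    rcases (by omega : k = u ∨ (u < k ∧ k ≤ v) ∨ k = v + 1 ∨ k < u ∨ v + 2 ≤ k)
      with rfl | ⟨hk1, hk2⟩ | rfl | hk | hk
    · omega
    · have := hp k hk1.le hk2
      have := hq k hk1 (by omega)
      omega
    · omega
    · omega
    · omega
  · have hp1 := hp (u + 1) (by omega) (by omega)
    have hq1 := hq (u + 1) (by omega) (by omega)
    have hp2 : p (u + 2) ≤ s := by
      rw [← hp1]; exact h.p_succ_le (u + 1) (by omega)
    have hq2 := hq (u + 2) (by omega) (by omega)
    refine h.no_pattern hm (t - 2) u 3 3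
      [(0, 0), (0, 1), (1, 0), (0, 2), (1, 1), (1, 2), (2, 0)]
      [(0, 0), (0, 1), (1, 0), (1, 1), (2, 0), (0, 2), (1, 2)] (by decide) ?_
    intro i hi j hj
    interval_cases j <;>
      simp only [List.mem_cons, Prod.mk.injEq, List.not_mem_nil, and_true, or_false,
        Nat.add_zero] <;> omega

/-- By `lower_part` and its rotation each of the two pieces is a single column or a single row. A
column below a row is a `disc` and a row below a column is a rotated one. Two columns, or two rows,
are possible only if one of them is a single cell, which counts as either. -/
theorem classify_disconnected (h : ColRep C r c p q) (hm : MultFree C) {j : ℕ} (hj : j + 1 < c)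
    (hd : p j = q (j + 1)) :
    ∃ k : Kind, k.Valid ∧ k.rows = r ∧ k.cols = c ∧ (C = k.cells ∨ C = rotCells r c k.cells) := by
  have hlt := h.lt j (by omega)
  have hlt1 := h.lt (j + 1) hj
  have hq0 := h.q_zero
  have hqr : ∀ k < c, q k ≤ r := fun k hk => hq0 ▸ h.q_anti (Nat.zero_le k) hk
  have hqj := hqr j (by omega)
  have hlow := h.lower_part hm hj hd
  have hupp : j + 2 = c ∨ (p j = 1 ∧ ∀ k, j < k → k < c → q k = p j) := by
    have := h.rot.lower_part (hm.rot h.inBox) (j := c - 2 - j) (by omega) (by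
      rw [show c - 1 - (c - 2 - j) = j + 1 by omega, show c - 1 - (c - 2 - j + 1) = j by omega,
        hd])
    rw [show c - 1 - (c - 2 - j) = j + 1 by omega] at this
    rcases this with h1 | ⟨h1, h2⟩
    · left; omega
    · right
      refine ⟨by omega, fun k hk1 hk2 => ?_⟩
      have := (h2 (c - 1 - k) (by omega)).1
      rw [show c - 1 - (c - 1 - k) = k by omega] at this
      have := hqr k hk2
      omega
  have hleft : ∀ k ≤ j, p j ≤ p k := fun k hk => h.p_anti hk (by omega)
  have hright : ∀ k, j < k → k < c → q k ≤ p j := fun k hk hk' => hd ▸ h.q_anti hk hk'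
  have hplast := h.p_last
  have lower : p j = 1 → j = 0 → (∀ k, j < k → k < c → q k = p j) →
      ∃ k : Kind, k.Valid ∧ k.rows = r ∧ k.cols = c ∧
        (C = k.cells ∨ C = rotCells r c k.cells) := by
    intro h1 h2 h3
    subst h2
    refine ⟨Kind.disc r c, ⟨by omega, by omega⟩, rfl, rfl, Or.inl ?_⟩
    ext ⟨a, b⟩
    rw [h.mem, Kind.mem_cells]
    simp only [Kind.rows, Kind.cols, Kind.Mem]
    rcases Nat.eq_zero_or_pos b with rfl | hb
    · omega
    · rcases Nat.lt_or_ge b c with hbc | hbc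
      · have := h3 b hb hbc
        have := h.lt b hbc
        omega
      · omega
  have upper : r = p j + 1 → j + 2 = c → (∀ k ≤ j, p k = p j ∧ q k = p j + 1) →
      ∃ k : Kind, k.Valid ∧ k.rows = r ∧ k.cols = c ∧
        (C = k.cells ∨ C = rotCells r c k.cells) := by
    intro h1 h2 h3
    refine ⟨Kind.disc r c, ⟨by omega, by omega⟩, rfl, rfl, Or.inr ?_⟩
    ext ⟨a, b⟩
    rw [h.mem, mem_rotCells (r := r) (c := c) (Kind.inBox (Kind.disc r c)), Kind.mem_cells]
    simp only [Kind.rows, Kind.cols, Kind.Mem]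
    rw [show c - 1 = j + 1 by omega] at hplast
    rcases Nat.lt_or_ge j b with hb | hb
    · rcases Nat.lt_or_ge b c with hbc | hbc
      · have : b = j + 1 := by omega
        subst this
        omega
      · omega
    · have := h3 b hb
      omega
  rcases hlow with h1 | ⟨h1, h1'⟩
  · rcases hupp with h2 | ⟨h2, h2'⟩
    · subst h1
      have hp1 : p 1 = 0 := by rwa [show c - 1 = 1 by omega] at hplast
      change p 0 = q 1 at hd
      change p 1 < q 1 at hlt1
      by_cases h3 : p 0 = 1
      · refine lower h3 rfl fun k hk hk' => ?_
        rw [show k = 1 by omega, hd]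
      · by_cases h4 : r = p 0 + 1
        · refine upper h4 h2 fun k hk => ?_
          rw [show k = 0 by omega]; omega
        · exfalso
          refine h.no_pattern hm (p 0 - 2) 0 4 2
            [(0, 1), (2, 0), (1, 1), (3, 0)] [(2, 0), (3, 0), (0, 1), (1, 1)] (by decide) ?_
          intro i hi j hj
          interval_cases j <;>
            simp only [List.mem_cons, Prod.mk.injEq, List.not_mem_nil, and_true, or_false,
              Nat.zero_add] <;> omega
    · exact lower h2 h1 h2'
  · rcases hupp with h2 | ⟨h2, h2'⟩
    · exact upper h1 h2 h1'
    · by_cases h3 : j = 0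
      · exact lower h2 h3 h2'
      · by_cases h4 : j + 2 = c
        · exact upper h1 h4 h1'
        · exfalso
          obtain ⟨u, rfl⟩ : ∃ u, j = u + 1 := ⟨j - 1, by omega⟩
          have e0 := h1' u (by omega)
          have e1 := h1' (u + 1) le_rfl
          have e2 := h2' (u + 2) (by omega) (by omega)
          have e3 := h2' (u + 3) (by omega) (by omega)
          have e4 := h.lt (u + 2) (by omega)
          have e5 := h.lt (u + 3) (by omega)
          refine h.no_pattern hm 0 u 2 4
            [(0, 2), (0, 3), (1, 0), (1, 1)] [(1, 0), (0, 2), (1, 1), (0, 3)] (by decide) ?_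
          intro i hi j hj
          interval_cases j <;>
            simp only [List.mem_cons, Prod.mk.injEq, List.not_mem_nil, and_true, or_false,
              Nat.add_zero] <;> omega

/-- Every multiplicity-free skew diagram is, up to rotation, one of those listed in `Kind`. -/
theorem classify (h : ColRep C r c p q) (hm : MultFree C) :
    ∃ k : Kind, k.Valid ∧ k.rows = r ∧ k.cols = c ∧ (C = k.cells ∨ C = rotCells r c k.cells) := by
  have hc := h.pos
  have hq0 := h.q_zero
  have hqr : ∀ k < c, q k ≤ r := fun k hk => hq0 ▸ h.q_anti (Nat.zero_le k) hk
  by_cases h1 : p 0 = 0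
  · obtain ⟨k, h1, h2, h3, h4⟩ := h.classify_straight hm h1
    exact ⟨k, h1, h2, h3, Or.inl h4⟩
  by_cases h2 : q (c - 1) = r
  · obtain ⟨k, h1, h2, h3, h4⟩ := h.rot.classify_straight (hm.rot h.inBox) (by simp [h2])
    refine ⟨k, h1, h2, h3, Or.inr ?_⟩
    rw [← h4, rotCells_rotCells h.inBox]
  by_cases h3 : ∃ j, j + 1 < c ∧ p (j + 1) < p j ∧ q (j + 1) < q j
  · obtain ⟨j, hj, hpj, hqj⟩ := h3
    exact h.classify_disconnected hm hj (h.disconnected_of_drop hm hj hpj hqj)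
  exfalso
  -- Now tops and bottoms both drop somewhere but never at the same column. Whichever drops first,
  -- its last drop before the first drop of the other yields a forbidden configuration.
  obtain ⟨i, hi, hi1, hi2⟩ := exists_first_drop (f := p) (c := c)
    (fun j hj => h.p_anti (Nat.zero_le j) hj) (by rw [h.p_last]; omega)
  obtain ⟨j, hj, hj1, hj2⟩ := exists_first_drop (f := q) (c := c)
    (fun j hj => h.q_anti (Nat.zero_le j) hj) (by have := hqr (c - 1) (by omega); omega)
  rcases lt_trichotomy i j with hij | rfl | hij
  · have hpj : p (j + 1) = p j := by
      by_contra hne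
      exact h3 ⟨j, hj, lt_of_le_of_ne (h.p_succ_le j hj) hne, by rw [hj2 j le_rfl]; exact hj1⟩
    obtain ⟨u, hu, hu1, hu2⟩ := exists_last_drop (f := p) (j₀ := j)
      (fun k hk => h.p_succ_le k (by omega))
      (lt_of_le_of_lt (h.p_anti (j := i + 1) (j' := j) (by omega) (by omega)) hi1)
    refine h.not_multFree_of_top_drop_first hu hj hu1 (fun k hk1 hk2 => ?_)
      (fun k _ hk => hj2 k hk) hj1 hm
    rcases Nat.lt_or_ge k (j + 1) with hk | hk
    · exact hu2 k hk1 (by omega)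
    · rw [show k = j + 1 by omega, hpj]
  · exact h3 ⟨i, hi, by rw [hi2 i le_rfl]; exact hi1, by rw [hj2 i le_rfl]; exact hj1⟩
  · have hqi : q (i + 1) = q i := by
      by_contra hne
      exact h3 ⟨i, hi, by rw [hi2 i le_rfl]; exact hi1, lt_of_le_of_ne (h.q_succ_le i hi) hne⟩
    obtain ⟨u, hu, hu1, hu2⟩ := exists_last_drop (f := q) (j₀ := i)
      (fun k hk => h.q_succ_le k (by omega))
      (lt_of_le_of_lt (h.q_anti (j := j + 1) (j' := i) (by omega) (by omega)) hj1)
    refine h.not_multFree_of_bottom_drop_first hu hi hu1 (fun k hk1 hk2 => ?_)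
      (fun k _ hk => hi2 k hk) hi1 hm
    rcases Nat.lt_or_ge k (i + 1) with hk | hk
    · exact hu2 k hk1 (by omega)
    · rw [show k = i + 1 by omega, hqi]

end ColRep

/-! ### Descent words of hooks and of their disconnected analogues -/

/-- The list which goes down column `0` from row `i` at each letter `true` and to the right in row
`0` from column `j` at each letter `false`. -/
def hookList : ℕ → ℕ → List Bool → List (ℕ × ℕ)
  | _, _, [] => []
  | i, j, true :: w => (i, 0) :: hookList (i + 1) j w
  | i, j, false :: w => (0, j) :: hookList i (j + 1) w

theorem length_hookList : ∀ i j w, (hookList i j w).length = w.length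
  | _, _, [] => rfl
  | i, j, true :: w => by simp [hookList, length_hookList (i + 1) j w]
  | i, j, false :: w => by simp [hookList, length_hookList i (j + 1) w]

theorem mem_hookList {a b : ℕ} : ∀ {i j : ℕ} {w : List Bool}, 1 ≤ i → 1 ≤ j →
    ((a, b) ∈ hookList i j w ↔ (b = 0 ∧ i ≤ a ∧ a < i + w.count true) ∨
      (a = 0 ∧ j ≤ b ∧ b < j + w.count false))
  | i, j, [], _, _ => by simp [hookList]
  | i, j, true :: w, hi, hj => by
    have := mem_hookList (a := a) (b := b) (i := i + 1) (j := j) (w := w) (by omega) hj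
    simp only [hookList, List.mem_cons, Prod.mk.injEq, this, List.count_cons_self, ne_eq,
      reduceCtorEq, not_false_eq_true, List.count_cons_of_ne]
    omega
  | i, j, false :: w, hi, hj => by
    have := mem_hookList (a := a) (b := b) (i := i) (j := j + 1) (w := w) hi (by omega)
    simp only [hookList, List.mem_cons, Prod.mk.injEq, this, List.count_cons_self, ne_eq,
      reduceCtorEq, not_false_eq_true, List.count_cons_of_ne]
    omega

theorem pairwise_hookList : ∀ {i j : ℕ} {w : List Bool}, 1 ≤ i → 1 ≤ j →
    (hookList i j w).Pairwise fun a b => ¬ b ≤ a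
  | i, j, [], _, _ => List.Pairwise.nil
  | i, j, true :: w, hi, hj => by
    refine List.Pairwise.cons ?_ (pairwise_hookList (by omega) hj)
    rintro ⟨a, b⟩ hab
    rw [mem_hookList (by omega) hj] at hab
    rw [Prod.mk_le_mk]
    omega
  | i, j, false :: w, hi, hj => by
    refine List.Pairwise.cons ?_ (pairwise_hookList hi (by omega))
    rintro ⟨a, b⟩ hab
    rw [mem_hookList hi (by omega)] at hab
    rw [Prod.mk_le_mk]
    omega

/-- A step in column `0` goes below all rows visited so far, and a step in row `0` is never a
descent, so the instructions are read back as letters. -/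
theorem desWord_cons_hookList : ∀ {x : ℕ × ℕ} {i j : ℕ} {w : List Bool}, x.1 < i →
    desWord (x :: hookList i j w) = w
  | x, i, j, [], _ => rfl
  | x, i, j, true :: w, h => by
    simp only [hookList, desWord_cons_cons]
    rw [desWord_cons_hookList (by simp)]
    simp [h]
  | x, i, j, false :: w, h => by
    simp only [hookList, desWord_cons_cons]
    rw [desWord_cons_hookList (by simp; omega)]
    simp

/-- Without a preceding corner cell the first instruction leaves no letter. -/
theorem desWord_hookList {i j : ℕ} {w : List Bool} (hi : 1 ≤ i) :
    desWord (hookList i j w) = w.tail := by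
  rcases w with _ | ⟨b, w⟩
  · rfl
  · cases b
    · exact desWord_cons_hookList (x := (0, j)) (by simp; omega)
    · exact desWord_cons_hookList (x := (i, 0)) (by simp)

/-- Such a list is a shuffle of two chains: its head is the first remaining cell of the column or of
the row, and the choices made are the letters of `w`. -/
theorem exists_eq_hookList : ∀ {l : List (ℕ × ℕ)} {i j m n : ℕ}, 1 ≤ i → 1 ≤ j →
    (l.Pairwise fun a b => ¬ b ≤ a) →
    (∀ a b, (a, b) ∈ l ↔ (b = 0 ∧ i ≤ a ∧ a < i + m) ∨ (a = 0 ∧ j ≤ b ∧ b < j + n)) →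
    ∃ w, l = hookList i j w ∧ w.count true = m ∧ w.count false = n
  | [], i, j, m, n, hi, hj, _, hl => by
    have h1 := hl i 0
    have h2 := hl 0 j
    simp only [List.not_mem_nil, false_iff, true_and] at h1 h2
    refine ⟨[], rfl, ?_, ?_⟩ <;> simp <;> omega
  | (x, y) :: l, i, j, m, n, hi, hj, hp, hl => by
    rw [List.pairwise_cons] at hp
    have hxy := (hl x y).1 (by simp)
    have hnot : ∀ a b, (a, b) ∈ l ↔ (a, b) ∈ (x, y) :: l ∧ ¬ (a = x ∧ b = y) := by
      intro a b
      simp only [List.mem_cons, Prod.mk.injEq]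
      constructor
      · intro h
        refine ⟨Or.inr h, ?_⟩
        rintro ⟨rfl, rfl⟩
        exact hp.1 _ h le_rfl
      · tauto
    rcases hxy with ⟨rfl, h1, h2⟩ | ⟨rfl, h1, h2⟩
    · have hx : x = i := by
        by_contra hne
        have h3 := (hnot i 0).2 ⟨(hl i 0).2 (by omega), by omega⟩
        exact hp.1 _ h3 (Prod.mk_le_mk.2 ⟨h1, le_rfl⟩)
      subst hx
      obtain ⟨w, hw, hw1, hw2⟩ := exists_eq_hookList (l := l) (i := x + 1) (j := j) (m := m - 1)
        (n := n) (by omega) hj hp.2 (fun a b => by rw [hnot, hl]; omega)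
      refine ⟨true :: w, by rw [hookList, ← hw], ?_, ?_⟩
      · simp [hw1]; omega
      · simp [hw2]
    · have hy : y = j := by
        by_contra hne
        have h3 := (hnot 0 j).2 ⟨(hl 0 j).2 (by omega), by omega⟩
        exact hp.1 _ h3 (Prod.mk_le_mk.2 ⟨le_rfl, h1⟩)
      subst hy
      obtain ⟨w, hw, hw1, hw2⟩ := exists_eq_hookList (l := l) (i := i) (j := y + 1) (m := m)
        (n := n - 1) hi (by omega) hp.2 (fun a b => by rw [hnot, hl]; omega)
      refine ⟨false :: w, by rw [hookList, ← hw], ?_, ?_⟩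
      · simp [hw1]
      · simp [hw2]; omega

theorem length_eq_count (w : List Bool) : w.length = w.count true + w.count false :=
  (List.count_true_add_count_false w).symm

namespace Kind

theorem isLinExt_hook {r c : ℕ} (hr : 1 ≤ r) (hc : 1 ≤ c) {w : List Bool}
    (h1 : w.count true + 1 = r) (h2 : w.count false + 1 = c) :
    IsLinExt (hook r c).cells ((0, 0) :: hookList 1 1 w) := by
  refine ⟨?_, List.Pairwise.cons ?_ (pairwise_hookList le_rfl le_rfl)⟩
  · rintro ⟨a, b⟩
    simp only [List.mem_cons, Prod.mk.injEq, mem_hookList le_rfl le_rfl, mem_cells, rows, cols, Mem]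
    omega
  · rintro ⟨a, b⟩ hab
    rw [mem_hookList le_rfl le_rfl] at hab
    rw [Prod.mk_le_mk]
    omega

theorem words_hook {r c : ℕ} (hr : 1 ≤ r) (hc : 1 ≤ c) {w : List Bool} :
    w ∈ words (hook r c).cells ↔ w.count true + 1 = r ∧ w.count false + 1 = c := by
  constructor
  · rintro ⟨l, hl, rfl⟩
    have h00 : (0, 0) ∈ l := (hl.1 _).2 (by simp [mem_cells, rows, cols, Mem]; omega)
    rcases l with _ | ⟨x, l⟩
    · simp at h00
    have hp := List.pairwise_cons.1 hl.2
    obtain rfl : (0, 0) = x := by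
      rcases List.mem_cons.1 h00 with h | h
      · exact h
      · exact absurd (Prod.mk_le_mk.2 ⟨Nat.zero_le _, Nat.zero_le _⟩) (hp.1 _ h)
    obtain ⟨w, rfl, h1, h2⟩ := exists_eq_hookList (l := l) (i := 1) (j := 1) (m := r - 1)
      (n := c - 1) le_rfl le_rfl hp.2 (by
        intro a b
        have h1 := hl.1 (a, b)
        simp only [List.mem_cons, Prod.mk.injEq, mem_cells, rows, cols, Mem] at h1
        constructor
        · intro h
          have : ¬ (a = 0 ∧ b = 0) := by
            rintro ⟨rfl, rfl⟩
            exact hp.1 _ h le_rfl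
          have := h1.1 (Or.inr h)
          omega
        · intro h
          rcases h1.2 (by omega) with h2 | h2
          · omega
          · exact h2)
    rw [desWord_cons_hookList (by simp)]
    omega
  · rintro ⟨h1, h2⟩
    exact ⟨_, isLinExt_hook hr hc h1 h2, desWord_cons_hookList (by simp)⟩

theorem isLinExt_disc {r c : ℕ} {w : List Bool}
    (h1 : w.count true + 1 = r) (h2 : w.count false + 1 = c) :
    IsLinExt (disc r c).cells (hookList 1 1 w) := by
  refine ⟨?_, pairwise_hookList le_rfl le_rfl⟩
  rintro ⟨a, b⟩
  simp only [mem_hookList le_rfl le_rfl, mem_cells, rows, cols, Mem]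
  omega

/-- The two alternatives correspond to the lost first instruction being `false` or `true`. -/
theorem words_disc {r c : ℕ} (hr : 2 ≤ r) (hc : 2 ≤ c) {w : List Bool} :
    w ∈ words (disc r c).cells ↔ (w.count true + 1 = r ∧ w.count false + 2 = c) ∨
      (w.count true + 2 = r ∧ w.count false + 1 = c) := by
  constructor
  · rintro ⟨l, hl, rfl⟩
    obtain ⟨w, rfl, h1, h2⟩ := exists_eq_hookList (l := l) (i := 1) (j := 1) (m := r - 1)
      (n := c - 1) le_rfl le_rfl hl.2 (by
        intro a b
        rw [hl.1, mem_cells]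
        simp only [rows, cols, Mem]
        omega)
    rw [desWord_hookList le_rfl]
    rcases w with _ | ⟨b, w⟩
    · simp at h1; omega
    · cases b <;> simp at h1 h2 ⊢ <;> omega
  · rintro (⟨h1, h2⟩ | ⟨h1, h2⟩)
    · exact ⟨hookList 1 1 (false :: w), isLinExt_disc (by simp; omega) (by simp; omega),
        desWord_hookList le_rfl⟩
    · exact ⟨hookList 1 1 (true :: w), isLinExt_disc (by simp; omega) (by simp; omega),
        desWord_hookList le_rfl⟩

theorem card_hook {r c : ℕ} (hr : 1 ≤ r) (hc : 1 ≤ c) : (hook r c).cells.card + 1 = r + c := by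
  have := (isLinExt_hook hr hc (w := List.replicate (r - 1) true ++ List.replicate (c - 1) false)
    (by simp [List.count_replicate]; omega) (by simp [List.count_replicate]; omega)).length_eq
  simp [length_hookList] at this
  omega

theorem card_disc {r c : ℕ} (hr : 2 ≤ r) (hc : 2 ≤ c) : (disc r c).cells.card + 2 = r + c := by
  have := (isLinExt_disc (r := r) (c := c)
    (w := List.replicate (r - 1) true ++ List.replicate (c - 1) false)
    (by simp [List.count_replicate]; omega) (by simp [List.count_replicate]; omega)).length_eq
  simp [length_hookList] at this
  omega

end Kind

/-! ### Descent words of the partitions `(c, 2)` -/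

theorem desWord_cons_row_zero_append : ∀ {l : List (ℕ × ℕ)} {x y : ℕ × ℕ} {m : List (ℕ × ℕ)},
    x.1 = 0 → (∀ z ∈ l, z.1 = 0) →
    desWord (x :: (l ++ y :: m)) =
      List.replicate l.length false ++ decide (0 < y.1) :: desWord (y :: m)
  | [], x, y, m, hx, _ => by simp [hx]
  | z :: l, x, y, m, hx, hl => by
    have hz : z.1 = 0 := hl z (by simp)
    have := desWord_cons_row_zero_append (l := l) (y := y) (m := m) hz
      fun u hu => hl u (List.mem_cons_of_mem _ hu)
    rw [List.cons_append, desWord_cons_cons, this]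
    simp [hx, hz, List.replicate_succ]

theorem desWord_cons_row_zero : ∀ {l : List (ℕ × ℕ)} {x : ℕ × ℕ}, (∀ z ∈ l, z.1 = 0) →
    desWord (x :: l) = List.replicate l.length false
  | [], x, _ => rfl
  | z :: l, x, hl => by
    have hz : z.1 = 0 := hl z (by simp)
    have := desWord_cons_row_zero (l := l) (x := z) fun u hu => hl u (List.mem_cons_of_mem _ hu)
    rw [desWord_cons_cons, this]
    simp [hz, List.replicate_succ]

/-- Consecutive cells of row `0`. -/
def rowCells (s n : ℕ) : List (ℕ × ℕ) := (List.range' s n).map fun j => (0, j)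

theorem mem_rowCells {s n a b : ℕ} : (a, b) ∈ rowCells s n ↔ a = 0 ∧ s ≤ b ∧ b < s + n := by
  simp only [rowCells, List.mem_map, List.mem_range'_1, Prod.mk.injEq]
  constructor
  · rintro ⟨_, h, rfl, rfl⟩; exact ⟨rfl, h⟩
  · rintro ⟨rfl, h⟩; exact ⟨b, h, rfl, rfl⟩

theorem pairwise_rowCells (s n : ℕ) : (rowCells s n).Pairwise fun a b => ¬ b ≤ a := by
  rw [rowCells, List.pairwise_map]
  refine (List.pairwise_lt_range' (s := s) (n := n)).imp ?_
  intro a b hab h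
  rw [Prod.mk_le_mk] at h
  omega

@[simp] theorem length_rowCells (s n : ℕ) : (rowCells s n).length = n := by simp [rowCells]

theorem rowCells_succ (s n : ℕ) : rowCells s (n + 1) = (0, s) :: rowCells (s + 1) n := by
  simp [rowCells, List.range'_succ]

theorem row_of_mem_rowCells {s n : ℕ} : ∀ z ∈ rowCells s n, z.1 = 0 := by
  rintro ⟨a, b⟩ h
  exact (mem_rowCells.1 h).1

namespace Kind

theorem isLinExt_two {a b d c : ℕ} (hab : 1 ≤ a + b) (hc : a + 1 + b + d = c) :
    IsLinExt (two c).cells (rowCells 0 (a + 1) ++ (1, 0) ::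
      (rowCells (a + 1) b ++ (1, 1) :: rowCells (a + 1 + b) d)) := by
  constructor
  · rintro ⟨x, y⟩
    simp only [List.mem_append, List.mem_cons, mem_rowCells, Prod.mk.injEq, mem_cells, rows, cols,
      Mem]
    omega
  · simp only [List.pairwise_append, List.pairwise_cons, pairwise_rowCells, true_and, and_true,
      List.mem_append, List.mem_cons]
    refine ⟨⟨?_, ?_, ?_⟩, ?_⟩ <;>
    · simp only [Prod.forall, Prod.mk_le_mk, mem_rowCells, Prod.mk.injEq]
      intros
      omega

theorem card_two {c : ℕ} (hc : 2 ≤ c) : (two c).cells.card = c + 2 := by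
  have := (isLinExt_two (a := c - 1) (b := 0) (d := 0) (c := c) (by omega) (by omega)).length_eq
  simp only [List.length_append, length_rowCells, List.length_cons] at this
  omega

/-- A linear extension is given by the places where `(1, 0)` and `(1, 1)` interrupt row `0`. With `b
≥ 1` cells of row `0` between them there are two descents; if they are adjacent there is only one.
The bound `1 ≤ a` in the second form says that `(0, 1)` comes before `(1, 1)`. -/
theorem words_two {c : ℕ} (hc : 2 ≤ c) {w : List Bool} : w ∈ words (two c).cells ↔
    (∃ a b d, 1 ≤ b ∧ a + 1 + b + d = c ∧ w = List.replicate a false ++ true ::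
      (List.replicate b false ++ true :: List.replicate d false)) ∨
    (∃ a d, 1 ≤ a ∧ 1 ≤ d ∧ a + d = c ∧
      w = List.replicate a false ++ true :: List.replicate d false) := by
  have hmem : ∀ x y, (x, y) ∈ (two c).cells ↔ (x = 0 ∧ y < c) ∨ (x = 1 ∧ y < 2) := by
    intro x y
    simp only [mem_cells, rows, cols, Mem]
    omega
  constructor
  · rintro ⟨l, hl, rfl⟩
    have hlen := hl.length_eq
    rw [card_two hc] at hlen
    obtain ⟨l₁, m, rfl⟩ := List.append_of_mem ((hl.1 (1, 0)).2 ((hmem _ _).2 (by omega)))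
    have h11 : (1, 1) ∈ m := by
      have := (hl.1 (1, 1)).2 ((hmem _ _).2 (by omega))
      simp only [List.mem_append, List.mem_cons, Prod.mk.injEq] at this
      rcases this with h | h | h
      · exact absurd (Prod.mk_le_mk.2 ⟨le_rfl, Nat.zero_le _⟩)
          (hl.not_le h (b := (1, 0)) (by simp))
      · omega
      · exact h
    obtain ⟨l₂, l₃, rfl⟩ := List.append_of_mem h11
    have hnd := hl.nodup
    have hrow : ∀ z, z ∈ l₁ ∨ z ∈ l₂ ∨ z ∈ l₃ → z.1 = 0 := by
      rintro ⟨x, y⟩ hz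
      have h1 := (hmem x y).1 ((hl.1 _).1 (by simp; tauto))
      by_contra hne
      simp only at hne
      rcases (by omega : (x = 1 ∧ y = 0) ∨ (x = 1 ∧ y = 1)) with ⟨rfl, rfl⟩ | ⟨rfl, rfl⟩
      · simp only [List.nodup_append, List.nodup_cons, List.mem_append, List.mem_cons] at hnd
        grind
      · simp only [List.nodup_append, List.nodup_cons, List.mem_append, List.mem_cons] at hnd
        grind
    have h00 : (0, 0) ∈ l₁ := by
      by_contra hne
      have h := (hl.1 (0, 0)).2 ((hmem _ _).2 (by omega))
      have h2 : (0, 0) ∈ l₂ ++ (1, 1) :: l₃ := by simpa [hne] using h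
      have := (List.pairwise_cons.1 (List.pairwise_append.1 hl.2).2.1).1 _ h2
      exact this (Prod.mk_le_mk.2 ⟨Nat.zero_le _, Nat.zero_le _⟩)
    have h01 : (0, 1) ∈ l₁ ∨ (0, 1) ∈ l₂ := by
      by_contra! hne
      have h := (hl.1 (0, 1)).2 ((hmem _ _).2 (by omega))
      have h2 : (0, 1) ∈ l₃ := by simpa [hne] using h
      have := (List.pairwise_cons.1 (List.pairwise_append.1
        (List.pairwise_cons.1 (List.pairwise_append.1 hl.2).2.1).2).2.1).1 _ h2
      exact this (Prod.mk_le_mk.2 ⟨Nat.zero_le _, le_rfl⟩)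
    rcases l₁ with _ | ⟨x, l₁⟩
    · simp at h00
    simp only [List.length_append, List.length_cons] at hlen
    rw [List.cons_append, desWord_cons_row_zero_append (hrow x (by simp))
      (fun z hz => hrow z (by simp [hz]))]
    rcases l₂ with _ | ⟨y, l₂⟩
    · right
      refine ⟨l₁.length, l₃.length + 1, ?_, by omega, by simp at hlen; omega, ?_⟩
      · rcases l₁ with _ | ⟨z, l₁⟩
        · simp only [List.mem_cons, List.not_mem_nil, or_false] at h00 h01
          rw [← h00] at h01
          simp at h01
        · simp
      · rw [List.nil_append, desWord_cons_cons,
          desWord_cons_row_zero (fun z hz => hrow z (by simp [hz]))]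
        simp [List.replicate_succ]
    · left
      refine ⟨l₁.length, l₂.length + 1, l₃.length, by omega, by simp at hlen; omega, ?_⟩
      have hy := hrow y (by simp)
      rw [List.cons_append, desWord_cons_cons, desWord_cons_row_zero_append hy
        (fun z hz => hrow z (by simp [hz])),
        desWord_cons_row_zero (fun z hz => hrow z (by simp [hz]))]
      simp [List.replicate_succ, hy]
  · rintro (⟨a, b, d, hb, hc, rfl⟩ | ⟨a, d, ha, hd, hc, rfl⟩)
    · refine ⟨_, isLinExt_two (a := a) (b := b) (d := d) (by omega) hc, ?_⟩
      obtain ⟨b, rfl⟩ : ∃ b', b = b' + 1 := ⟨b - 1, by omega⟩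
      rw [rowCells_succ, List.cons_append, desWord_cons_row_zero_append rfl row_of_mem_rowCells,
        rowCells_succ, List.cons_append, desWord_cons_cons,
        desWord_cons_row_zero_append rfl row_of_mem_rowCells,
        desWord_cons_row_zero row_of_mem_rowCells]
      simp [List.replicate_succ]
    · refine ⟨_, isLinExt_two (a := a) (b := 0) (d := d - 1) (by omega) (by omega), ?_⟩
      rw [rowCells_succ, List.cons_append, desWord_cons_row_zero_append rfl row_of_mem_rowCells]
      simp only [rowCells, List.range'_zero, List.map_nil, List.nil_append]
      rw [desWord_cons_cons]
      rw [show (List.map (fun j => ((0, j) : ℕ × ℕ)) (List.range' (a + 1 + 0) (d - 1))) =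
        rowCells (a + 1 + 0) (d - 1) from rfl, desWord_cons_row_zero row_of_mem_rowCells]
      obtain ⟨d, rfl⟩ : ∃ d', d = d' + 1 := ⟨d - 1, by omega⟩
      simp [List.replicate_succ]

end Kind

/-! ### Comparison of the sets of descent words -/

theorem not_mem_words_of_two_rows {C : Finset (ℕ × ℕ)} {c : ℕ} (hC : InBox 2 c C) (w : List Bool) :
    true :: true :: w ∉ words C := by
  rintro ⟨l, hl, hw⟩
  rcases l with _ | ⟨x, _ | ⟨y, _ | ⟨z, l⟩⟩⟩
  · simp at hw
  · simp at hw
  · simp at hw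
  · simp only [desWord_cons_cons, List.cons.injEq, decide_eq_true_eq] at hw
    have := hC z ((hl.1 z).1 (by simp))
    omega

theorem pairwise_row_of_desWord_false : ∀ {m : List (ℕ × ℕ)}, (∀ b ∈ desWord m, b = false) →
    m.Pairwise fun a b => b.1 ≤ a.1
  | [], _ => List.Pairwise.nil
  | [_], _ => List.pairwise_singleton _ _
  | a :: b :: m, h => by
    simp only [desWord_cons_cons, List.forall_mem_cons, decide_eq_false_iff_not, not_lt] at h
    have ih := pairwise_row_of_desWord_false h.2
    refine List.Pairwise.cons ?_ ih
    intro c hc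
    rcases List.mem_cons.1 hc with rfl | hc
    · exact h.1
    · exact ((List.pairwise_cons.1 ih).1 c hc).trans h.1

/-- Along a stretch without descents the row index weakly decreases, and `x ≤ y` puts `x` first.
Comparable cells of the stretch thus lie in one row, which excludes certain words below. -/
theorem IsLinExt.row_le {C l m} (h : IsLinExt C (l ++ m)) (hw : ∀ b ∈ desWord m, b = false)
    {x y : ℕ × ℕ} (hx : x ∈ m) (hy : y ∈ m) (hxy : x ≤ y) : y.1 ≤ x.1 := by
  by_cases hne : x = y
  · rw [hne]
  have h1 := (List.pairwise_append.1 h.2).2.1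
  have h2 := pairwise_row_of_desWord_false hw
  have h3 : m.Pairwise fun a b => (¬ b ≤ a ∧ b.1 ≤ a.1) ∨ (¬ a ≤ b ∧ a.1 ≤ b.1) :=
    (h1.and h2).imp fun h => Or.inl h
  have : Std.Symm fun a b : ℕ × ℕ => (¬ b ≤ a ∧ b.1 ≤ a.1) ∨ (¬ a ≤ b ∧ a.1 ≤ b.1) :=
    ⟨fun _ _ => Or.symm⟩
  rcases h3.forall hx hy hne with h | h
  · exact h.2
  · exact absurd hxy h.1

theorem IsLinExt.mem_left {C l m} (h : IsLinExt C (l ++ m)) {x y : ℕ × ℕ} (hx : x ∈ C)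
    (hy : y ∈ l) (hxy : x ≤ y) : x ∈ l := by
  rcases List.mem_append.1 ((h.1 x).2 hx) with h1 | h1
  · exact h1
  · exact absurd hxy (h.not_le hy h1)

theorem replicate_false_not_mem_words {C : Finset (ℕ × ℕ)} (h0 : (0, 0) ∈ C) (h1 : (1, 0) ∈ C)
    (n : ℕ) : List.replicate n false ∉ words C := by
  rintro ⟨l, hl, hw⟩
  have := IsLinExt.row_le (l := []) (m := l) hl (by rw [hw]; simp)
    ((hl.1 _).2 h0) ((hl.1 _).2 h1) (by simp)
  simp at this

/-- Neither `(0, 1)` nor `(1, 1)` can come first, as `(0, 0)` precedes them; so both lie in the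
stretch without descents after the first cell. -/
theorem true_replicate_false_not_mem_words {C : Finset (ℕ × ℕ)} (h00 : (0, 0) ∈ C)
    (h01 : (0, 1) ∈ C) (h11 : (1, 1) ∈ C) (n : ℕ) :
    true :: List.replicate n false ∉ words C := by
  rintro ⟨l, hl, hw⟩
  rcases l with _ | ⟨x, l⟩
  · simp at hw
  have hw' : ∀ b ∈ desWord l, b = false := by
    rcases l with _ | ⟨y, l⟩
    · simp
    · rw [desWord_cons_cons, List.cons.injEq] at hw
      rw [hw.2]
      simp
  have hl' : IsLinExt C ([x] ++ l) := hl
  have key : ∀ y ∈ C, ((0, 0) : ℕ × ℕ) ≤ y → y ≠ (0, 0) → y ∈ l := by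
    intro y hy hle hne
    rcases List.mem_append.1 ((hl'.1 y).2 hy) with h | h
    · have h2 := hl'.mem_left h00 h hle
      simp only [List.mem_singleton] at h h2
      exact absurd (h.trans h2.symm) hne
    · exact h
  have := hl'.row_le hw' (key _ h01 (by simp) (by simp)) (key _ h11 (by simp) (by simp)) (by simp)
  simp at this

/-- Both `(0, 2)` and `(1, 2)` come after `(0, 0)` and `(0, 1)`, hence in the stretch without
descents after the first two cells. This word separates `two` from `rect`. -/
theorem false_true_replicate_false_not_mem_words {C : Finset (ℕ × ℕ)} (h00 : (0, 0) ∈ C)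
    (h01 : (0, 1) ∈ C) (h02 : (0, 2) ∈ C) (h12 : (1, 2) ∈ C) (n : ℕ) :
    false :: true :: List.replicate n false ∉ words C := by
  rintro ⟨l, hl, hw⟩
  rcases l with _ | ⟨x, _ | ⟨x', l⟩⟩
  · simp at hw
  · simp at hw
  have hw' : ∀ b ∈ desWord l, b = false := by
    rcases l with _ | ⟨y, l⟩
    · simp
    · rw [desWord_cons_cons, desWord_cons_cons, List.cons.injEq, List.cons.injEq] at hw
      rw [hw.2.2]
      simp
  have hl' : IsLinExt C ([x, x'] ++ l) := hl
  have key : ∀ y ∈ C, ((0, 1) : ℕ × ℕ) ≤ y → y ≠ (0, 1) → y ∈ l := by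
    intro y hy hle hne
    rcases List.mem_append.1 ((hl'.1 y).2 hy) with h | h
    · have h1 := hl'.mem_left h01 h hle
      have h2 := hl'.mem_left h00 h (le_trans (by simp) hle)
      have hne' : y ≠ (0, 0) := by rintro rfl; simp at hle
      have h3 : ((0, 1) : ℕ × ℕ) ≠ (0, 0) := by simp
      simp only [List.mem_cons, List.not_mem_nil, or_false] at h h1 h2
      grind
    · exact h
  have := hl'.row_le hw' (key _ h02 (by simp) (by simp)) (key _ h12 (by simp) (by simp)) (by simp)
  simp at this

theorem count_not (w : List Bool) (b : Bool) : (w.map not).count b = w.count (!b) := by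
  induction w with
  | nil => rfl
  | cons a w ih => cases a <;> cases b <;> simp_all

namespace Kind

/-- The transposed diagram. -/
def tr : Kind → Kind
  | hook r c => hook c r
  | disc r c => disc c r
  | two c => twoT c
  | twoT r => two r
  | rect c => rectT c
  | rectT r => rect r

theorem Valid.tr {k : Kind} (h : k.Valid) : k.tr.Valid := by
  cases k <;> simp only [Valid, Kind.tr] at h ⊢ <;> omega

theorem cells_tr (k : Kind) : k.tr.cells = k.cells.image Prod.swap := by
  ext ⟨i, j⟩
  simp only [Finset.mem_image, Prod.exists, Prod.swap_prod_mk, Prod.mk.injEq]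
  have : (∃ a b, (a, b) ∈ k.cells ∧ b = i ∧ a = j) ↔ (j, i) ∈ k.cells :=
    ⟨by rintro ⟨_, _, h, rfl, rfl⟩; exact h, fun h => ⟨_, _, h, rfl, rfl⟩⟩
  rw [this, mem_cells, mem_cells]
  cases k <;> simp only [tr, rows, cols, Mem, and_true] <;> omega

theorem convex (k : Kind) : CellConvex k.cells := by
  intro i j i' j' h h' a b h1 h2 h3 h4
  rw [mem_cells] at h h' ⊢
  cases k <;> simp only [rows, cols, Mem, and_true] at h h' ⊢ <;> omega

theorem words_tr (k : Kind) : words k.tr.cells = List.map not '' words k.cells := by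
  rw [cells_tr, words_swap k.convex]

theorem map_not_mem_words_tr {k : Kind} {w : List Bool} (h : w ∈ words k.cells) :
    w.map not ∈ words k.tr.cells := by
  rw [words_tr]; exact ⟨w, h, rfl⟩

theorem card_tr (k : Kind) : k.tr.cells.card = k.cells.card := by
  rw [cells_tr, Finset.card_image_of_injective _ Prod.swap_injective]

theorem card_twoT {r : ℕ} (hr : 2 ≤ r) : (twoT r).cells.card = r + 2 := by
  rw [← card_two hr, ← card_tr (two r)]; rfl

theorem card_rect (c : ℕ) : (rect c).cells.card = 2 * c := by
  have : (rect c).cells = Finset.range 2 ×ˢ Finset.range c := by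
    ext ⟨i, j⟩
    simp [mem_cells, rows, cols, Mem]
  rw [this]
  simp

/-- Reading by rows gives a single descent, reading by columns one descent in each column. -/
theorem mem_words_rect {c : ℕ} (hc : c = 3 ∨ c = 4) :
    (List.replicate (c - 1) false ++ true :: List.replicate (c - 1) false) ∈ words (rect c).cells ∧
    ∃ w ∈ words (rect c).cells, 3 ≤ w.count true := by
  have hmem : ∀ x y, (x, y) ∈ (rect c).cells ↔ x < 2 ∧ y < c := by
    intro x y
    simp [mem_cells, rows, cols, Mem]
  rcases hc with rfl | rfl
  · refine ⟨⟨[(0, 0), (0, 1), (0, 2), (1, 0), (1, 1), (1, 2)], ⟨?_, by decide⟩, by decide⟩,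
      _, ⟨[(0, 0), (1, 0), (0, 1), (1, 1), (0, 2), (1, 2)], ⟨?_, by decide⟩, rfl⟩, by decide⟩ <;>
    · rintro ⟨x, y⟩
      simp only [hmem, List.mem_cons, Prod.mk.injEq, List.not_mem_nil, or_false]
      omega
  · refine ⟨⟨[(0, 0), (0, 1), (0, 2), (0, 3), (1, 0), (1, 1), (1, 2), (1, 3)],
      ⟨?_, by decide⟩, by decide⟩,
      _, ⟨[(0, 0), (1, 0), (0, 1), (1, 1), (0, 2), (1, 2), (0, 3), (1, 3)],
        ⟨?_, by decide⟩, rfl⟩, by decide⟩ <;>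
    · rintro ⟨x, y⟩
      simp only [hmem, List.mem_cons, Prod.mk.injEq, List.not_mem_nil, or_false]
      omega

theorem mem_words_two {c : ℕ} (hc : 2 ≤ c) :
    false :: true :: List.replicate (c - 1) false ∈ words (two c).cells ∧
    true :: false :: true :: List.replicate (c - 2) false ∈ words (two c).cells ∧
    (3 ≤ c → false :: false :: true :: List.replicate (c - 2) false ∈ words (two c).cells) := by
  refine ⟨(words_two hc).2 (Or.inr ⟨1, c - 1, le_rfl, by omega, by omega, rfl⟩),
    (words_two hc).2 (Or.inl ⟨0, 1, c - 2, le_rfl, by omega, rfl⟩),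
    fun h => (words_two hc).2 (Or.inr ⟨2, c - 2, by omega, by omega, by omega, rfl⟩)⟩

theorem count_of_mem_words_two {c : ℕ} (hc : 2 ≤ c) {w : List Bool} (h : w ∈ words (two c).cells) :
    (w.count true = 1 ∧ w.count false = c) ∨ (w.count true = 2 ∧ w.count false + 1 = c) := by
  rw [words_two hc] at h
  rcases h with ⟨a, b, d, hb, hc, rfl⟩ | ⟨a, d, ha, hd, hc, rfl⟩
  · right; simp [List.count_replicate]; omega
  · left; simp [List.count_replicate]; omega

/-- The pairs of diagrams for which the set of descent words of the first contains that of the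
second in a nontrivial way. -/
def Listed (k k' : Kind) : Prop :=
  ∃ r c, k = disc r c ∧ (k' = hook r (c - 1) ∨ k' = hook (r - 1) c ∨
    (r = 3 ∧ 3 ≤ c ∧ k' = two (c - 1)) ∨ (c = 3 ∧ 3 ≤ r ∧ k' = twoT (r - 1)))

theorem Listed.words_subset {k k' : Kind} (h : Listed k k') (hk : k.Valid) :
    words k'.cells ⊆ words k.cells := by
  obtain ⟨r, c, rfl, h⟩ := h
  obtain ⟨hr, hc⟩ : 2 ≤ r ∧ 2 ≤ c := hk
  intro w hw
  rw [words_disc hr hc]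
  rcases h with rfl | rfl | ⟨rfl, h3, rfl⟩ | ⟨rfl, h3, rfl⟩
  · rw [words_hook (by omega) (by omega)] at hw
    omega
  · rw [words_hook (by omega) (by omega)] at hw
    omega
  · have := count_of_mem_words_two (by omega) hw
    omega
  · have := count_of_mem_words_two (c := r - 1) (by omega)
      (map_not_mem_words_tr (k := twoT (r - 1)) hw)
    simp only [count_not, Bool.not_true, Bool.not_false] at this
    omega

/-- Words of this form distinguish hooks and `disc` from `two` and `rect`, by
`replicate_append_not_mem_words`. -/
theorem exists_word_hook_or_disc {k : Kind} (hk : k.Valid)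
    (h : (∃ r c, k = hook r c) ∨ (∃ r c, k = disc r c)) :
    ∃ m n, List.replicate m true ++ List.replicate n false ∈ words k.cells := by
  rcases h with ⟨r, c, rfl⟩ | ⟨r, c, rfl⟩
  · obtain ⟨hr, hc⟩ : 1 ≤ r ∧ 1 ≤ c := hk
    exact ⟨r - 1, c - 1, (words_hook hr hc).2
      (by simp [List.count_replicate]; omega)⟩
  · obtain ⟨hr, hc⟩ : 2 ≤ r ∧ 2 ≤ c := hk
    exact ⟨r - 1, c - 2, (words_disc hr hc).2
      (by simp [List.count_replicate]; omega)⟩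

theorem replicate_append_not_mem_words {k : Kind} (hk : k.Valid)
    (h : (∃ c, k = two c) ∨ (∃ c, k = rect c)) (m n : ℕ) :
    List.replicate m true ++ List.replicate n false ∉ words k.cells := by
  have hmem : (0, 0) ∈ k.cells ∧ (1, 0) ∈ k.cells ∧ (0, 1) ∈ k.cells ∧ (1, 1) ∈ k.cells := by
    rcases h with ⟨c, rfl⟩ | ⟨c, rfl⟩ <;> simp only [Valid] at hk <;>
      simp [mem_cells, rows, cols, Mem] <;> omega
  rcases m with _ | _ | m
  · simpa using replicate_false_not_mem_words hmem.1 hmem.2.1 n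
  · simpa using true_replicate_false_not_mem_words hmem.1 hmem.2.2.1 hmem.2.2.2 n
  · simp only [List.replicate_succ, List.cons_append]
    rcases h with ⟨c, rfl⟩ | ⟨c, rfl⟩
    · exact not_mem_words_of_two_rows (c := c) (inBox (two c)) _
    · exact not_mem_words_of_two_rows (c := c) (inBox (rect c)) _

theorem exists_word_twoT {r : ℕ} (hr : 3 ≤ r) : ∃ w, true :: true :: w ∈ words (twoT r).cells :=
  ⟨_, map_not_mem_words_tr (k := two r) ((mem_words_two (c := r) (by omega)).2.2 hr)⟩

theorem exists_word_rectT {r : ℕ} (hr : r = 3 ∨ r = 4) :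
    ∃ w, true :: true :: w ∈ words (rectT r).cells := by
  have := map_not_mem_words_tr (k := rect r) (mem_words_rect hr).1
  rcases hr with rfl | rfl <;> exact ⟨_, this⟩

/-- Two initial descents need three rows, which excludes the tall diagrams. Hooks and `disc` have a
word consisting of descents followed by non-descents, which `k` lacks. Between `two` and `rect`, one
direction fails by a special word and the other by the number of descents. -/
theorem words_subset_two_rows {k k' : Kind} (hk : k.Valid) (hk' : k'.Valid)
    (h : (∃ c, k = two c) ∨ (∃ c, k = rect c)) (hcard : k'.cells.card = k.cells.card)
    (hsub : words k'.cells ⊆ words k.cells) : k'.cells = k.cells := by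
  have htt : ∀ w, true :: true :: w ∉ words k.cells := by
    intro w
    rcases h with ⟨c, rfl⟩ | ⟨c, rfl⟩
    · exact not_mem_words_of_two_rows (c := c) (inBox (two c)) _
    · exact not_mem_words_of_two_rows (c := c) (inBox (rect c)) _
  have hnot : ¬ ((∃ r c, k' = hook r c) ∨ (∃ r c, k' = disc r c)) := fun h' => by
    obtain ⟨m, n, hw⟩ := exists_word_hook_or_disc hk' h'
    exact replicate_append_not_mem_words hk h m n (hsub hw)
  cases k' with
  | hook r c => exact absurd (Or.inl ⟨r, c, rfl⟩) hnot
  | disc r c => exact absurd (Or.inr ⟨r, c, rfl⟩) hnot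
  | two c' =>
    have hc' : 2 ≤ c' := hk'
    rcases h with ⟨c, rfl⟩ | ⟨c, rfl⟩
    · rw [card_two hc', card_two hk] at hcard
      rw [show c' = c by omega]
    · have hc : c = 3 ∨ c = 4 := hk
      refine absurd (hsub (mem_words_two hc').1)
        (false_true_replicate_false_not_mem_words ?_ ?_ ?_ ?_ _) <;>
      · simp [mem_cells, rows, cols, Mem]; omega
  | twoT r =>
    have hr : 2 ≤ r := hk'
    by_cases hr3 : 3 ≤ r
    · obtain ⟨w, hw⟩ := exists_word_twoT hr3
      exact absurd (hsub hw) (htt w)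
    · rw [card_twoT hr] at hcard
      -- The 2 × 2 square is both `twoT 2` and `two 2`; the rectangles have six or eight cells.
      obtain rfl : r = 2 := by omega
      rcases h with ⟨c, rfl⟩ | ⟨c, rfl⟩
      · rw [card_two hk] at hcard
        obtain rfl : c = 2 := by omega
        ext ⟨i, j⟩
        simp only [mem_cells, rows, cols, Mem]
        omega
      · have hc : c = 3 ∨ c = 4 := hk
        rw [card_rect] at hcard
        omega
  | rect c' =>
    rcases h with ⟨c, rfl⟩ | ⟨c, rfl⟩
    · obtain ⟨w, hw, hw3⟩ := (mem_words_rect hk').2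
      have := count_of_mem_words_two hk (hsub hw)
      omega
    · rw [card_rect, card_rect] at hcard
      rw [show c' = c by omega]
  | rectT r =>
    obtain ⟨w, hw⟩ := exists_word_rectT hk'
    exact absurd (hsub hw) (htt w)

/-- Numbers of descents of some descent words of a diagram that is neither a hook nor
disconnected. -/
theorem exists_words_count {k : Kind} (hk : k.Valid) :
    (∃ r c, k = hook r c) ∨ (∃ r c, k = disc r c) ∨
    ((∃ c, k = two c) ∧ ∃ w ∈ words k.cells, ∃ w' ∈ words k.cells,
      w.count true = 1 ∧ w'.count true = 2) ∨
    ((∃ c, k = twoT c) ∧ ∃ w ∈ words k.cells, ∃ w' ∈ words k.cells,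
      w.count false = 1 ∧ w'.count false = 2) ∨
    (∃ w ∈ words k.cells, ∃ w' ∈ words k.cells, w.count true + 2 ≤ w'.count true) := by
  cases k with
  | hook r c => exact Or.inl ⟨r, c, rfl⟩
  | disc r c => exact Or.inr (Or.inl ⟨r, c, rfl⟩)
  | two c =>
    obtain ⟨h1, h2, _⟩ := mem_words_two hk
    exact Or.inr (Or.inr (Or.inl ⟨⟨c, rfl⟩, _, h1, _, h2, by simp [List.count_replicate],
      by simp [List.count_replicate]⟩))
  | twoT r =>
    obtain ⟨h1, h2, _⟩ := mem_words_two (c := r) hk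
    exact Or.inr (Or.inr (Or.inr (Or.inl ⟨⟨r, rfl⟩, _, map_not_mem_words_tr (k := two r) h1, _,
      map_not_mem_words_tr (k := two r) h2, by rw [count_not]; simp [List.count_replicate],
      by rw [count_not]; simp [List.count_replicate]⟩)))
  | rect c =>
    obtain ⟨h1, w, h2, h3⟩ := mem_words_rect hk
    exact Or.inr (Or.inr (Or.inr (Or.inr ⟨_, h1, w, h2, by
      simp [List.count_replicate]; omega⟩)))
  | rectT r =>
    obtain ⟨h1, w, h2, h3⟩ := mem_words_rect (c := r) hk
    refine Or.inr (Or.inr (Or.inr (Or.inr ⟨_, map_not_mem_words_tr (k := rect r) h2, _,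
      map_not_mem_words_tr (k := rect r) h1, ?_⟩)))
    have e1 := words_length h1
    have e2 := words_length h2
    rw [length_eq_count] at e1 e2
    simp only [count_not, Bool.not_true]
    have : (List.replicate (r - 1) false ++ true :: List.replicate (r - 1) false).count true = 1 := by
      simp [List.count_replicate]
    omega

theorem words_subset {k k' : Kind} (hk : k.Valid) (hk' : k'.Valid)
    (hcard : k'.cells.card = k.cells.card) (hsub : words k'.cells ⊆ words k.cells) :
    k'.cells = k.cells ∨ Listed k k' := by
  have htr : (∃ c, k.tr = two c) ∨ (∃ c, k.tr = rect c) → k'.cells = k.cells := by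
    intro h
    have := words_subset_two_rows hk.tr hk'.tr h (by rw [card_tr, card_tr, hcard])
      (by rw [words_tr, words_tr]; exact Set.image_mono hsub)
    rw [cells_tr, cells_tr] at this
    exact Finset.image_injective Prod.swap_injective this
  cases k with
  | two c => exact Or.inl (words_subset_two_rows hk hk' (Or.inl ⟨c, rfl⟩) hcard hsub)
  | rect c => exact Or.inl (words_subset_two_rows hk hk' (Or.inr ⟨c, rfl⟩) hcard hsub)
  | twoT r => exact Or.inl (htr (Or.inl ⟨r, rfl⟩))
  | rectT r => exact Or.inl (htr (Or.inr ⟨r, rfl⟩))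
  | hook r c =>
    obtain ⟨hr, hc⟩ : 1 ≤ r ∧ 1 ≤ c := hk
    have hcd := card_hook hr hc
    have hw : ∀ w ∈ words k'.cells, w.count true + 1 = r ∧ w.count false + 1 = c :=
      fun w h => (words_hook hr hc).1 (hsub h)
    rcases exists_words_count hk' with ⟨r', c', rfl⟩ | ⟨r', c', rfl⟩ | ⟨_, w, h1, w', h2, h3⟩ |
      ⟨_, w, h1, w', h2, h3⟩ | ⟨w, h1, w', h2, h3⟩
    · obtain ⟨m, n, h⟩ := exists_word_hook_or_disc hk' (Or.inl ⟨_, _, rfl⟩)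
      obtain ⟨hr', hc'⟩ : 1 ≤ r' ∧ 1 ≤ c' := hk'
      have h1 := hw _ h
      have h2 := (words_hook hr' hc').1 h
      left
      rw [show r' = r by omega, show c' = c by omega]
    · exfalso
      obtain ⟨hr', hc'⟩ : 2 ≤ r' ∧ 2 ≤ c' := hk'
      -- A `disc` realises two different numbers of descents, a hook only one.
      have h1 := hw (List.replicate (r' - 1) true ++ List.replicate (c' - 2) false)
        ((words_disc hr' hc').2 (by simp [List.count_replicate]; omega))
      have h2 := hw (List.replicate (r' - 2) true ++ List.replicate (c' - 1) false)
        ((words_disc hr' hc').2 (by simp [List.count_replicate]; omega))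
      simp [List.count_replicate] at h1 h2
      omega
    all_goals
      have := hw w h1
      have := hw w' h2
      omega
  | disc r c =>
    obtain ⟨hr, hc⟩ : 2 ≤ r ∧ 2 ≤ c := hk
    have hcd := card_disc hr hc
    have hw : ∀ w ∈ words k'.cells, (w.count true + 1 = r ∧ w.count false + 2 = c) ∨
        (w.count true + 2 = r ∧ w.count false + 1 = c) :=
      fun w h => (words_disc hr hc).1 (hsub h)
    rcases exists_words_count hk' with ⟨r', c', rfl⟩ | ⟨r', c', rfl⟩ |
      ⟨⟨c', rfl⟩, w, h1, w', h2, h3⟩ | ⟨⟨r', rfl⟩, w, h1, w', h2, h3⟩ | ⟨w, h1, w', h2, h3⟩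
    · obtain ⟨m, n, h⟩ := exists_word_hook_or_disc hk' (Or.inl ⟨_, _, rfl⟩)
      obtain ⟨hr', hc'⟩ : 1 ≤ r' ∧ 1 ≤ c' := hk'
      have h1 := hw _ h
      have h2 := (words_hook hr' hc').1 h
      right
      refine ⟨r, c, rfl, ?_⟩
      rcases h1 with h1 | h1
      · left
        rw [show r' = r by omega, show c' = c - 1 by omega]
      · right; left
        rw [show r' = r - 1 by omega, show c' = c by omega]
    · obtain ⟨hr', hc'⟩ : 2 ≤ r' ∧ 2 ≤ c' := hk'
      have h1 := hw (List.replicate (r' - 1) true ++ List.replicate (c' - 2) false)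
        ((words_disc hr' hc').2 (by simp [List.count_replicate]; omega))
      have h2 := hw (List.replicate (r' - 2) true ++ List.replicate (c' - 1) false)
        ((words_disc hr' hc').2 (by simp [List.count_replicate]; omega))
      simp [List.count_replicate] at h1 h2
      left
      rw [show r' = r by omega, show c' = c by omega]
    · have := hw w h1
      have := hw w' h2
      have hc2 : 2 ≤ c' := hk'
      rw [card_two hk'] at hcard
      exact Or.inr ⟨r, c, rfl, Or.inr (Or.inr (Or.inl ⟨by omega, by omega,
        by rw [show c' = c - 1 by omega]⟩))⟩
    · have := hw w h1
      have := hw w' h2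
      have hr2 : 2 ≤ r' := hk'
      rw [card_twoT hk'] at hcard
      exact Or.inr ⟨r, c, rfl, Or.inr (Or.inr (Or.inr ⟨by omega, by omega,
        by rw [show r' = r - 1 by omega]⟩))⟩
    · have := hw w h1
      have := hw w' h2
      omega

/-- As rotation reverses words, this makes a diagram and its rotation have the same words. -/
theorem reverse_mem_words {k : Kind} (hk : k.Valid) {w : List Bool} (hw : w ∈ words k.cells) :
    w.reverse ∈ words k.cells := by
  have htwo : ∀ {c : ℕ}, 2 ≤ c → ∀ {w}, w ∈ words (two c).cells →
      w.reverse ∈ words (two c).cells := by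
    intro c hc w hw
    rw [words_two hc] at hw ⊢
    rcases hw with ⟨a, b, d, hb, hc, rfl⟩ | ⟨a, d, ha, hd, hc, rfl⟩
    · exact Or.inl ⟨d, b, a, hb, by omega, by simp⟩
    · exact Or.inr ⟨d, a, hd, ha, by omega, by simp⟩
  have hrect : ∀ {c : ℕ} {w}, w ∈ words (rect c).cells → w.reverse ∈ words (rect c).cells := by
    intro c w hw
    have e : rotCells 2 c (rect c).cells = (rect c).cells := by
      ext ⟨i, j⟩
      rw [mem_rotCells (r := 2) (c := c) (inBox (rect c)), mem_cells, mem_cells]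
      simp only [rows, cols, Mem, and_true]
      omega
    have := words_rotCells (r := 2) (c := c) (inBox (rect c))
    rw [e] at this
    rw [this]
    exact ⟨w, hw, rfl⟩
  have htr : ∀ {k : Kind}, (∀ {w}, w ∈ words k.cells → w.reverse ∈ words k.cells) →
      ∀ {w}, w ∈ words k.tr.cells → w.reverse ∈ words k.tr.cells := by
    intro k h w hw
    rw [words_tr] at hw ⊢
    obtain ⟨v, hv, rfl⟩ := hw
    exact ⟨v.reverse, h hv, List.map_reverse⟩
  cases k with
  | hook r c =>
    rw [words_hook hk.1 hk.2] at hw ⊢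
    simpa using hw
  | disc r c =>
    rw [words_disc hk.1 hk.2] at hw ⊢
    simpa using hw
  | two c => exact htwo hk hw
  | twoT r => exact htr (k := two r) (htwo hk) hw
  | rect c => exact hrect hw
  | rectT r => exact htr (k := rect r) hrect hw

end Kind

/-! ### The fundamental quasisymmetric functions are linearly independent -/

namespace QSym

/-- The exponent of the monomial `x_0^{γ_1} x_1^{γ_2} ⋯`. -/
noncomputable def leadingExp {n : ℕ} (γ : Composition n) : ℕ →₀ ℕ :=
  ∑ k : Fin γ.length, Finsupp.single (k : ℕ) (γ.blocksFun k)

theorem sum_single_apply {m : ℕ} {i : Fin m → ℕ} (hi : Function.Injective i) (b : Fin m → ℕ)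
    (k : Fin m) : (∑ k, Finsupp.single (i k) (b k)) (i k) = b k := by
  rw [Finsupp.finsetSum_apply, Finset.sum_eq_single k]
  · simp
  · intro k' _ hne
    exact Finsupp.single_eq_of_ne fun h => hne (hi h.symm)
  · simp

theorem sum_single_apply_ne_zero {m : ℕ} {i : Fin m → ℕ} {b : Fin m → ℕ} {x : ℕ}
    (h : (∑ k, Finsupp.single (i k) (b k)) x ≠ 0) : ∃ k, i k = x := by
  rw [Finsupp.finsetSum_apply] at h
  obtain ⟨k, _, hk⟩ := Finset.exists_ne_zero_of_sum_ne_zero h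
  refine ⟨k, ?_⟩
  by_contra hne
  exact hk (Finsupp.single_eq_of_ne fun h => hne h.symm)

theorem range_eq_of_sum_single_eq {m : ℕ} {i : Fin m → ℕ} (hi : Function.Injective i)
    {b : Fin m → ℕ} (hb : ∀ k, 0 < b k) :
    Set.range i = {x | (∑ k, Finsupp.single (i k) (b k)) x ≠ 0} := by
  ext x
  constructor
  · rintro ⟨k, rfl⟩
    rw [Set.mem_ofPred_eq, sum_single_apply hi]
    exact (hb k).ne'
  · exact sum_single_apply_ne_zero

/-- The support of the exponent is an initial segment of ℕ, so the increasing indices are `0, 1, …`;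
the exponents are then the parts. -/
theorem monomialQ_leadingExp {n : ℕ} (β γ : Composition n) :
    monomialQ β (leadingExp γ) = if β = γ then 1 else 0 := by
  have key : (∃ i : Fin β.length → ℕ, StrictMono i ∧
      leadingExp γ = ∑ k, Finsupp.single (i k) (β.blocksFun k)) ↔ β = γ := ?_
  · by_cases h : β = γ
    · rw [if_pos h]; exact if_pos (key.2 h)
    · rw [if_neg h]; exact if_neg (mt key.1 h)
  constructor
  · rintro ⟨i, hi, h⟩
    have hpos : ∀ (δ : Composition n) (k : Fin δ.length), 0 < δ.blocksFun k :=
      fun δ k => δ.one_le_blocksFun k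
    have h1 := range_eq_of_sum_single_eq hi.injective (hpos β)
    have h2 := range_eq_of_sum_single_eq (Fin.val_injective (n := γ.length)) (hpos γ)
    rw [← h, leadingExp, ← h2] at h1
    have hlen : β.length = γ.length := by
      have e := congrArg Set.ncard h1
      rw [← Set.image_univ, ← Set.image_univ, Set.ncard_image_of_injective _ hi.injective,
        Set.ncard_image_of_injective _ Fin.val_injective, Set.ncard_univ, Set.ncard_univ] at e
      simpa using e
    have h3 : Set.range i = Set.range (fun k : Fin β.length => (k : ℕ)) := by
      rw [h1]
      ext x
      simp only [Set.mem_range]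
      constructor
      · rintro ⟨k, rfl⟩; exact ⟨⟨k, by omega⟩, rfl⟩
      · rintro ⟨k, rfl⟩; exact ⟨⟨k, by omega⟩, rfl⟩
    have h4 : i = fun k : Fin β.length => (k : ℕ) :=
      (StrictMono.range_inj hi Fin.val_strictMono).1 h3
    apply Composition.ext
    refine List.ext_getElem hlen fun k hk hk' => ?_
    have e1 := sum_single_apply hi.injective β.blocksFun ⟨k, hk⟩
    have e2 := sum_single_apply (Fin.val_injective (n := γ.length)) γ.blocksFun ⟨k, hk'⟩
    rw [← h, h4] at e1
    exact e1.symm.trans e2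
  · rintro rfl
    exact ⟨fun k => k, Fin.val_strictMono, rfl⟩

theorem sum_fundamental_leadingExp {n : ℕ} (c : Composition n → ℚ) (γ : Composition n) :
    (∑ α, c α • fundamental α : MvPowerSeries ℕ ℚ) (leadingExp γ) =
      ∑ α ∈ Finset.univ.filter (fun α => setOfComp n α ⊆ setOfComp n γ), c α := by
  have hsum : ∀ {ι : Type} (s : Finset ι) (f : ι → MvPowerSeries ℕ ℚ) (d : ℕ →₀ ℕ),
      (∑ x ∈ s, f x) d = ∑ x ∈ s, f x d := fun s f d => by
    have := map_sum (MvPowerSeries.coeff (R := ℚ) d) f s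
    exact this
  rw [hsum, Finset.sum_filter]
  refine Finset.sum_congr rfl fun α _ => ?_
  change c α * fundamental α (leadingExp γ) = _
  rw [fundamental, hsum]
  simp_rw [monomialQ_leadingExp]
  rw [Finset.sum_ite_eq']
  simp

/-- By the preceding lemma `f` determines the sum of `c α` over S(α) ⊆ S(γ), for every γ; induction
on the set S(γ) isolates `c γ`. -/
theorem IsFExpansion.unique {n : ℕ} {f : MvPowerSeries ℕ ℚ} {c c' : Composition n → ℚ}
    (h : IsFExpansion f c) (h' : IsFExpansion f c') : c = c' := by
  have key : ∀ s : Finset (Fin (n - 1)), c ((setOfComp n).symm s) = c' ((setOfComp n).symm s) := by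
    intro s
    induction s using Finset.strongInduction with
    | H s ih =>
      set γ := (setOfComp n).symm s with hγ
      have e := sum_fundamental_leadingExp c γ
      rw [← h, h', sum_fundamental_leadingExp c' γ] at e
      have hmem : γ ∈ Finset.univ.filter (fun α => setOfComp n α ⊆ setOfComp n γ) := by simp
      rw [← Finset.add_sum_erase _ _ hmem, ← Finset.add_sum_erase _ _ hmem] at e
      rw [Finset.sum_congr rfl (g := c)] at e
      · linarith
      · intro α hα
        simp only [Finset.mem_erase, Finset.mem_filter, Finset.mem_univ, true_and] at hα
        have hs : setOfComp n γ = s := by simp [hγ]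
        have := ih (setOfComp n α) (by
          refine Finset.ssubset_iff_subset_ne.2 ⟨hs ▸ hα.2, fun h => hα.1 ?_⟩
          rw [hγ, ← h, Equiv.symm_apply_apply])
        rw [Equiv.symm_apply_apply] at this
        exact this.symm
  funext α
  have := key (setOfComp n α)
  rwa [Equiv.symm_apply_apply] at this

section Sums

variable {n : ℕ} {ι κ : Type} [Fintype ι] [Fintype κ] {g : ι → Composition n}
  {g' : κ → Composition n}

open Classical in
theorem isFExpansion_sum (g : ι → Composition n) : IsFExpansion (∑ i, fundamental (g i))
    fun α => ((Finset.univ.filter fun i => g i = α).card : ℚ) := by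
  rw [IsFExpansion, ← Finset.sum_fiberwise (s := Finset.univ) (g := g)]
  refine Finset.sum_congr rfl fun α _ => ?_
  rw [Finset.sum_congr rfl (g := fun _ => fundamental α)
    (fun i hi => by rw [(Finset.mem_filter.1 hi).2])]
  rw [Finset.sum_const, Nat.cast_smul_eq_nsmul]

theorem injective_of_multiplicityFree (h : FMultiplicityFree n (∑ i, fundamental (g i))) :
    Function.Injective g := by
  classical
  obtain ⟨c, hc, h01⟩ := h
  have := hc.unique (isFExpansion_sum g)
  intro i j hij
  by_contra hne
  have h2 : 2 ≤ (Finset.univ.filter fun k => g k = g i).card := by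
    rw [← Finset.card_pair hne]
    refine Finset.card_le_card fun x hx => ?_
    simp only [Finset.mem_insert, Finset.mem_singleton] at hx
    rcases hx with rfl | rfl <;> simp [hij]
  have h3 := congrFun this (g i)
  have h4 : (2 : ℚ) ≤ c (g i) := by rw [h3]; exact_mod_cast h2
  rcases h01 (g i) with h | h <;> rw [h] at h4 <;> norm_num at h4

open Classical in
theorem isFExpansion_of_injective (hg : Function.Injective g) :
    IsFExpansion (∑ i, fundamental (g i)) fun α => if α ∈ Set.range g then 1 else 0 := by
  convert isFExpansion_sum g using 2 with α
  split_ifs with h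
  · obtain ⟨i, rfl⟩ := h
    have : (Finset.univ.filter fun k => g k = g i) = {i} := by
      ext k; simp [hg.eq_iff]
    rw [this]; simp
  · rw [Finset.filter_false_of_mem]
    · simp
    · intro i _ hi
      exact h ⟨i, hi⟩

theorem fSupport_of_injective (hg : Function.Injective g) :
    fSupport n (∑ i, fundamental (g i)) = Set.range g := by
  classical
  ext α
  constructor
  · rintro ⟨c, hc, hpos⟩
    rw [hc.unique (isFExpansion_of_injective hg)] at hpos
    by_contra h
    simp [h] at hpos
  · intro h
    exact ⟨_, isFExpansion_of_injective hg, by simp [h]⟩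

theorem fPositive_sub_iff (hg : Function.Injective g) (hg' : Function.Injective g') :
    FPositive n ((∑ i, fundamental (g i)) - ∑ i, fundamental (g' i)) ↔
      Set.range g' ⊆ Set.range g := by
  classical
  have h1 := isFExpansion_of_injective hg
  have h2 := isFExpansion_of_injective hg'
  have h3 : IsFExpansion ((∑ i, fundamental (g i)) - ∑ i, fundamental (g' i))
      fun α => (if α ∈ Set.range g then (1 : ℚ) else 0) - if α ∈ Set.range g' then 1 else 0 := by
    rw [IsFExpansion] at h1 h2 ⊢
    rw [h1, h2, ← Finset.sum_sub_distrib]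
    exact Finset.sum_congr rfl fun α _ => (sub_smul _ _ _).symm
  constructor
  · rintro ⟨c, hc, hpos⟩ α hα
    have := hpos α
    rw [hc.unique h3] at this
    by_contra hn
    simp only [hn, hα, if_true, if_false] at this
    norm_num at this
  · intro h
    refine ⟨_, h3, fun α => ?_⟩
    by_cases hα : α ∈ Set.range g'
    · simp [hα, h hα]
    · simp only [hα, if_false, sub_zero]
      split_ifs <;> norm_num

theorem sum_eq_sum_iff (hg : Function.Injective g) (hg' : Function.Injective g') :
    (∑ i, fundamental (g i) = ∑ i, fundamental (g' i)) ↔ Set.range g = Set.range g' := by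
  classical
  constructor
  · intro h
    rw [← fSupport_of_injective hg, ← fSupport_of_injective hg', h]
  · intro h
    have h1 := isFExpansion_of_injective hg
    have h2 := isFExpansion_of_injective hg'
    rw [IsFExpansion] at h1 h2
    rw [h1, h2]
    simp_rw [h]

end Sums

/-- The subset of `[n - 1]` described by a word. -/
def wordSet (n : ℕ) (w : List Bool) : Finset (Fin (n - 1)) :=
  Finset.univ.filter fun i => w[(i : ℕ)]? = some true

/-- The composition of `n` described by a word. -/
def compOfWord (n : ℕ) (w : List Bool) : Composition n :=
  (setOfComp n).symm (wordSet n w)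

/-- The length must be fixed, since `wordSet` treats a missing letter like `false` and ignores
surplus letters. -/
theorem compOfWord_injOn (n : ℕ) : Set.InjOn (compOfWord n) {w | w.length = n - 1} := by
  intro w hw w' hw' h
  have h := (setOfComp n).symm.injective h
  rw [Set.mem_ofPred_eq] at hw hw'
  refine List.ext_getElem (by omega) fun i hi hi' => ?_
  have := Finset.ext_iff.1 h ⟨i, by omega⟩
  simp only [wordSet, Finset.mem_filter, Finset.mem_univ, true_and, List.getElem?_eq_getElem hi,
    List.getElem?_eq_getElem hi', Option.some.injEq] at this
  exact Bool.eq_iff_iff.2 this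

end QSym

/-! ### Tableaux as linear extensions -/

theorem desWord_getElem? : ∀ {l : List (ℕ × ℕ)} {i : ℕ} (h : i + 1 < l.length),
    (desWord l)[i]? = some (decide (l[i].1 < l[i + 1].1))
  | [], i, h => by simp at h
  | [_], i, h => by simp at h
  | a :: b :: l, 0, h => by simp
  | a :: b :: l, i + 1, h => by
    rw [desWord_cons_cons, List.getElem?_cons_succ,
      desWord_getElem? (l := b :: l) (i := i) (by simpa using h)]
    rfl

namespace SkewShape

theorem mem_cells {A : SkewShape} {x : ℕ × ℕ} : x ∈ A.cells ↔ x ∈ A.outer ∧ x ∉ A.inner := by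
  simp [cells]

theorem convex (A : SkewShape) : CellConvex A.cells := by
  intro i j i' j' h h' a b h1 h2 h3 h4
  rw [mem_cells] at *
  exact ⟨A.outer.up_left_mem h2 h4 h'.1, fun h5 => h.2 (A.inner.up_left_mem h1 h3 h5)⟩

/-- Monotonicity along rows and columns extends to the product order because the corner `(i, j')`
lies in the diagram. -/
theorem SYT.lt_of_le {A : SkewShape} (T : SYT A) {c d : A.cells} (h : c.1 ≤ d.1) (hne : c ≠ d) :
    T.1 c < T.1 d := by
  obtain ⟨⟨i, j⟩, hc⟩ := c
  obtain ⟨⟨i', j'⟩, hd⟩ := d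
  obtain ⟨h1, h2⟩ := Prod.mk_le_mk.1 h
  have he : (i, j') ∈ A.cells := A.convex _ _ _ _ hc hd _ _ le_rfl h1 h2 le_rfl
  rcases h1.eq_or_lt with rfl | h1
  · refine T.2.1 _ _ rfl (lt_of_le_of_ne h2 ?_)
    rintro rfl
    exact hne rfl
  · refine lt_of_le_of_lt ?_ (T.2.2 ⟨(i, j'), he⟩ ⟨(i', j'), hd⟩ rfl h1)
    rcases h2.eq_or_lt with rfl | h2
    · exact le_rfl
    · exact (T.2.1 ⟨(i, j), hc⟩ ⟨(i, j'), he⟩ rfl h2).le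

/-- The cells of a tableau in the order of their entries. -/
def SYT.toList {A : SkewShape} (T : SYT A) : List (ℕ × ℕ) :=
  List.ofFn fun k => (T.1.symm k).1

theorem SYT.isLinExt {A : SkewShape} (T : SYT A) : IsLinExt A.cells T.toList := by
  constructor
  · intro x
    simp only [toList, List.mem_ofFn]
    constructor
    · rintro ⟨k, rfl⟩; exact (T.1.symm k).2
    · intro hx; exact ⟨T.1 ⟨x, hx⟩, by simp⟩
  · rw [toList, List.pairwise_ofFn]
    intro i j hij hle
    have := T.lt_of_le (c := T.1.symm j) (d := T.1.symm i) hle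
      (fun h => hij.ne' (T.1.symm.injective h))
    rw [Equiv.apply_symm_apply, Equiv.apply_symm_apply] at this
    exact lt_asymm hij this

theorem SYT.exists_toList_eq {A : SkewShape} {l : List (ℕ × ℕ)} (hl : IsLinExt A.cells l) :
    ∃ T : SYT A, T.toList = l := by
  have hlen : l.length = A.size := hl.length_eq
  let f : Fin A.size → A.cells := fun k =>
    ⟨l[(k : ℕ)]'(by omega), (hl.1 _).1 (List.getElem_mem _)⟩
  have hf : Function.Bijective f := by
    rw [Fintype.bijective_iff_injective_and_card]
    refine ⟨fun i j hij => ?_, by rw [Fintype.card_fin, Fintype.card_coe]; rfl⟩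
    have := congrArg Subtype.val hij
    exact Fin.ext ((hl.nodup.getElem_inj_iff).1 this)
  have key : ∀ c d : A.cells, c.1 ≤ d.1 → c ≠ d →
      (Equiv.ofBijective f hf).symm c < (Equiv.ofBijective f hf).symm d := by
    intro c d hle hne
    obtain ⟨i, rfl⟩ := hf.2 c
    obtain ⟨j, rfl⟩ := hf.2 d
    have e : ∀ k, (Equiv.ofBijective f hf).symm (f k) = k := fun k =>
      (Equiv.ofBijective f hf).symm_apply_apply k
    rw [e, e]
    by_contra hn
    have hji : j < i := lt_of_le_of_ne (not_lt.1 hn) fun h => hne (h ▸ rfl)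
    exact (List.pairwise_iff_getElem.1 hl.2) j i (by omega) (by omega) hji hle
  refine ⟨⟨(Equiv.ofBijective f hf).symm, fun c d h1 h2 => ?_, fun c d h1 h2 => ?_⟩, ?_⟩
  · exact key c d (Prod.le_def.2 ⟨h1.le, h2.le⟩) (by rintro rfl; exact lt_irrefl _ h2)
  · exact key c d (Prod.le_def.2 ⟨h2.le, h1.le⟩) (by rintro rfl; exact lt_irrefl _ h2)
  · refine List.ext_getElem (by simp [toList, hlen]) fun i h1 h2 => ?_
    simp [toList, f]

theorem SYT.descentSet_eq {A : SkewShape} (T : SYT A) :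
    T.descentSet = QSym.wordSet A.size (desWord T.toList) := by
  ext i
  have hi := i.2
  have hlen : T.toList.length = A.size := T.isLinExt.length_eq
  simp only [descentSet, QSym.wordSet, Finset.mem_filter, Finset.mem_univ, true_and]
  rw [desWord_getElem? (by omega)]
  simp [toList]

/-- The composition attached to a tableau. -/
def SYT.comp {A : SkewShape} (n : ℕ) (T : SYT A) : Composition n :=
  QSym.compOfWord n (desWord T.toList)

theorem schur_eq {A : SkewShape} {n : ℕ} (h : A.size = n) :
    A.schur = ∑ T : A.SYT, QSym.fundamental (T.comp n) := by
  subst h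
  exact Finset.sum_congr rfl fun T _ => by rw [SYT.descentSet_eq]; rfl

theorem length_of_mem_words {A : SkewShape} {n : ℕ} (h : A.size = n) :
    words A.cells ⊆ {w | w.length = n - 1} := by
  intro w hw
  subst h
  exact words_length hw

theorem range_comp (A : SkewShape) (n : ℕ) :
    Set.range (SYT.comp (A := A) n) = QSym.compOfWord n '' words A.cells := by
  ext α
  constructor
  · rintro ⟨T, rfl⟩
    exact ⟨_, ⟨T.toList, T.isLinExt, rfl⟩, rfl⟩
  · rintro ⟨_, ⟨l, hl, rfl⟩, rfl⟩
    obtain ⟨T, rfl⟩ := SYT.exists_toList_eq hl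
    exact ⟨T, rfl⟩

theorem comp_injective {A : SkewShape} {n : ℕ} (h : A.size = n)
    (hA : QSym.FMultiplicityFree n A.schur) : Function.Injective (SYT.comp (A := A) n) := by
  rw [schur_eq h] at hA
  exact QSym.injective_of_multiplicityFree hA

theorem multFree_cells {A : SkewShape} {n : ℕ} (h : A.size = n)
    (hA : QSym.FMultiplicityFree n A.schur) : MultFree A.cells := by
  intro l l' hl hl' hw
  obtain ⟨T, rfl⟩ := SYT.exists_toList_eq hl
  obtain ⟨T', rfl⟩ := SYT.exists_toList_eq hl'
  have : T = T' := comp_injective h hA (by rw [SYT.comp, SYT.comp, hw])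
  rw [this]

theorem range_comp_subset_iff {A B : SkewShape} {n : ℕ} (hA : A.size = n) (hB : B.size = n) :
    Set.range (SYT.comp (A := B) n) ⊆ Set.range (SYT.comp (A := A) n) ↔
      words B.cells ⊆ words A.cells := by
  rw [range_comp, range_comp]
  exact (QSym.compOfWord_injOn n).image_subset_image_iff (length_of_mem_words hB)
    (length_of_mem_words hA)

end SkewShape

/-! ### Deleting empty rows and columns -/

/-- The number of elements of `S` below `a`. -/
def rankIn (S : Finset ℕ) (a : ℕ) : ℕ := (S.filter (· < a)).card

theorem rankIn_mono (S : Finset ℕ) {a b : ℕ} (h : a ≤ b) : rankIn S a ≤ rankIn S b :=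
  Finset.card_le_card fun x hx => by
    simp only [Finset.mem_filter] at hx ⊢
    exact ⟨hx.1, by omega⟩

theorem rankIn_lt {S : Finset ℕ} {a b : ℕ} (ha : a ∈ S) : rankIn S a < rankIn S b ↔ a < b := by
  constructor
  · intro h
    by_contra hn
    exact absurd (rankIn_mono S (not_lt.1 hn)) (not_le.2 h)
  · intro h
    refine Finset.card_lt_card ⟨fun x hx => ?_, fun hs => ?_⟩
    · simp only [Finset.mem_filter] at hx ⊢
      exact ⟨hx.1, by omega⟩
    · have := hs (Finset.mem_filter.2 ⟨ha, h⟩)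
      simp at this

theorem rankIn_le {S : Finset ℕ} {a b : ℕ} (hb : b ∈ S) : rankIn S a ≤ rankIn S b ↔ a ≤ b := by
  rw [← not_lt, rankIn_lt hb, not_lt]

theorem rankIn_lt_card {S : Finset ℕ} {a : ℕ} (ha : a ∈ S) : rankIn S a < S.card :=
  Finset.card_lt_card ⟨Finset.filter_subset _ _, fun hs => by simpa using hs ha⟩

theorem exists_rankIn_eq {S : Finset ℕ} {k : ℕ} (hk : k < S.card) : ∃ a ∈ S, rankIn S a = k := by
  have hinj : Set.InjOn (rankIn S) S := fun a ha b hb h =>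
    le_antisymm ((rankIn_le hb).1 h.le) ((rankIn_le ha).1 h.ge)
  have hsub : S.image (rankIn S) ⊆ Finset.range S.card := fun x hx => by
    obtain ⟨a, ha, rfl⟩ := Finset.mem_image.1 hx
    exact Finset.mem_range.2 (rankIn_lt_card ha)
  have := Finset.eq_of_subset_of_card_le hsub (by
    rw [Finset.card_range, Finset.card_image_of_injOn hinj])
  have hk' := Finset.mem_range.2 hk
  rw [← this] at hk'
  simpa using hk'

theorem rankIn_range {r a : ℕ} (ha : a ≤ r) : rankIn (Finset.range r) a = a := by
  have : (Finset.range r).filter (· < a) = Finset.range a := by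
    ext x; simp only [Finset.mem_filter, Finset.mem_range]; omega
  rw [rankIn, this, Finset.card_range]

/-- Reflection exchanges the elements below `a` with those above it. -/
theorem rankIn_image_sub {S : Finset ℕ} {h a : ℕ} (hS : ∀ x ∈ S, x < h) (ha : a ∈ S) :
    rankIn (S.image fun x => h - 1 - x) (h - 1 - a) = S.card - 1 - rankIn S a := by
  have e : (S.image fun x => h - 1 - x).filter (· < h - 1 - a) =
      (S.filter (a < ·)).image fun x => h - 1 - x := by
    ext y
    simp only [Finset.mem_filter, Finset.mem_image]
    constructor
    · rintro ⟨⟨x, hx, rfl⟩, hlt⟩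
      exact ⟨x, ⟨hx, by omega⟩, rfl⟩
    · rintro ⟨x, ⟨hx, hax⟩, rfl⟩
      have := hS x hx
      exact ⟨⟨x, hx, rfl⟩, by omega⟩
  have hinj : Set.InjOn (fun x => h - 1 - x) (S.filter (a < ·) : Finset ℕ) := by
    intro x hx y hy hxy
    simp only [Finset.coe_filter, Set.mem_ofPred_eq] at hx hy hxy
    have := hS x hx.1
    have := hS y hy.1
    omega
  rw [rankIn, e, Finset.card_image_of_injOn hinj, rankIn]
  have h1 := Finset.card_filter_add_card_filter_not (s := S) (p := (· < a))
  have h2 : S.filter (fun x => ¬ x < a) = insert a (S.filter (a < ·)) := by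
    ext x
    simp only [Finset.mem_filter, Finset.mem_insert]
    constructor
    · rintro ⟨hx, hxa⟩
      by_cases hxe : x = a
      · exact Or.inl hxe
      · exact Or.inr ⟨hx, by omega⟩
    · rintro (rfl | ⟨hx, hxa⟩)
      · exact ⟨ha, by omega⟩
      · exact ⟨hx, by omega⟩
  rw [h2, Finset.card_insert_of_notMem (by simp)] at h1
  omega

/-- Deletion of the empty rows and columns. -/
def reduceCells (C : Finset (ℕ × ℕ)) : Finset (ℕ × ℕ) :=
  C.image fun x => (rankIn (C.image Prod.fst) x.1, rankIn (C.image Prod.snd) x.2)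

theorem SkewShape.reducedCells_eq (A : SkewShape) : A.reducedCells = reduceCells A.cells := rfl

section Reduce

variable {C : Finset (ℕ × ℕ)}

theorem fst_mem {x : ℕ × ℕ} (hx : x ∈ C) : x.1 ∈ C.image Prod.fst := Finset.mem_image_of_mem _ hx

theorem snd_mem {x : ℕ × ℕ} (hx : x ∈ C) : x.2 ∈ C.image Prod.snd := Finset.mem_image_of_mem _ hx

theorem words_reduceCells (C : Finset (ℕ × ℕ)) : words (reduceCells C) = words C :=
  words_image
    (fun a _ b hb => by
      rw [Prod.mk_le_mk, rankIn_le (fst_mem hb), rankIn_le (snd_mem hb), Prod.le_def])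
    (fun a ha b _ => rankIn_lt (fst_mem ha))

theorem multFree_reduceCells : MultFree (reduceCells C) ↔ MultFree C :=
  multFree_image
    (fun a _ b hb => by
      rw [Prod.mk_le_mk, rankIn_le (fst_mem hb), rankIn_le (snd_mem hb), Prod.le_def])
    (fun a ha b _ => rankIn_lt (fst_mem ha))

theorem inBox_reduceCells (C : Finset (ℕ × ℕ)) :
    InBox (C.image Prod.fst).card (C.image Prod.snd).card (reduceCells C) := by
  intro x hx
  obtain ⟨y, hy, rfl⟩ := Finset.mem_image.1 hx
  exact ⟨rankIn_lt_card (fst_mem hy), rankIn_lt_card (snd_mem hy)⟩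

theorem exists_mem_row {i : ℕ} (hi : i < (C.image Prod.fst).card) :
    ∃ j, (i, j) ∈ reduceCells C := by
  obtain ⟨a, ha, rfl⟩ := exists_rankIn_eq hi
  obtain ⟨x, hx, rfl⟩ := Finset.mem_image.1 ha
  exact ⟨_, Finset.mem_image_of_mem _ hx⟩

theorem exists_mem_col {j : ℕ} (hj : j < (C.image Prod.snd).card) :
    ∃ i, (i, j) ∈ reduceCells C := by
  obtain ⟨a, ha, rfl⟩ := exists_rankIn_eq hj
  obtain ⟨x, hx, rfl⟩ := Finset.mem_image.1 ha
  exact ⟨_, Finset.mem_image_of_mem _ hx⟩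

theorem CellConvex.reduceCells (hC : CellConvex C) : CellConvex (reduceCells C) := by
  intro i j i' j' h h' a b h1 h2 h3 h4
  have hb := inBox_reduceCells C _ h'
  obtain ⟨x, hx, rfl⟩ := exists_rankIn_eq (k := a) (lt_of_le_of_lt h2 hb.1)
  obtain ⟨y, hy, rfl⟩ := exists_rankIn_eq (k := b) (lt_of_le_of_lt h4 hb.2)
  obtain ⟨u, hu, hu'⟩ := Finset.mem_image.1 h
  obtain ⟨v, hv, hv'⟩ := Finset.mem_image.1 h'
  simp only [Prod.mk.injEq] at hu' hv'
  obtain ⟨rfl, rfl⟩ := hu'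
  obtain ⟨rfl, rfl⟩ := hv'
  rw [rankIn_le hx] at h1
  rw [rankIn_le (fst_mem hv)] at h2
  rw [rankIn_le hy] at h3
  rw [rankIn_le (snd_mem hv)] at h4
  exact Finset.mem_image_of_mem (fun x : ℕ × ℕ => (rankIn (C.image Prod.fst) x.1,
    rankIn (C.image Prod.snd) x.2)) (hC _ _ _ _ hu hv x y h1 h2 h3 h4)

theorem reduceCells_of_full {r c : ℕ} (hr : C.image Prod.fst = Finset.range r)
    (hc : C.image Prod.snd = Finset.range c) : reduceCells C = C := by
  rw [reduceCells, hr, hc]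
  conv_rhs => rw [← Finset.image_id (s := C)]
  refine Finset.image_congr fun x hx => ?_
  have h1 := fst_mem hx
  have h2 := snd_mem hx
  rw [hr, Finset.mem_range] at h1
  rw [hc, Finset.mem_range] at h2
  simp only [rankIn_range h1.le, rankIn_range h2.le, id]

theorem reduceCells_rotCells {h w : ℕ} (hC : InBox h w C) :
    reduceCells (rotCells h w C) =
      rotCells (C.image Prod.fst).card (C.image Prod.snd).card (reduceCells C) := by
  have e1 : (rotCells h w C).image Prod.fst = (C.image Prod.fst).image fun x => h - 1 - x := by
    simp only [rotCells, Finset.image_image]; rfl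
  have e2 : (rotCells h w C).image Prod.snd = (C.image Prod.snd).image fun x => w - 1 - x := by
    simp only [rotCells, Finset.image_image]; rfl
  rw [reduceCells, e1, e2, rotCells, rotCells, reduceCells]
  refine Finset.image_image.trans ((Finset.image_congr fun x hx => ?_).trans
    Finset.image_image.symm)
  simp only [Function.comp]
  rw [rankIn_image_sub _ (fst_mem hx), rankIn_image_sub _ (snd_mem hx)]
  · intro y hy
    obtain ⟨z, hz, rfl⟩ := Finset.mem_image.1 hy
    exact (hC z hz).2
  · intro y hy
    obtain ⟨z, hz, rfl⟩ := Finset.mem_image.1 hy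
    exact (hC z hz).1

end Reduce

/-- Convexity makes every column an interval and orders tops and bottoms; the nonempty rows yield
the remaining fields. -/
theorem exists_colRep {D : Finset (ℕ × ℕ)} {r c : ℕ} (hD : CellConvex D) (hbox : InBox r c D)
    (hrow : ∀ i < r, ∃ j, (i, j) ∈ D) (hcol : ∀ j < c, ∃ i, (i, j) ∈ D) (hc : 0 < c) :
    ∃ p q, ColRep D r c p q := by
  have hint : ∀ j, ∃ p q, j < c → p < q ∧ ∀ i, (i, j) ∈ D ↔ p ≤ i ∧ i < q := by
    intro j
    by_cases hj : j < c
    · obtain ⟨i₀, hi₀⟩ := hcol j hj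
      let S := (D.filter fun x => x.2 = j).image Prod.fst
      have hS : ∀ i, i ∈ S ↔ (i, j) ∈ D := by
        intro i
        simp only [S, Finset.mem_image, Finset.mem_filter, Prod.exists]
        constructor
        · rintro ⟨a, b, ⟨h, rfl⟩, rfl⟩; exact h
        · intro h; exact ⟨i, j, ⟨h, rfl⟩, rfl⟩
      have hne : S.Nonempty := ⟨i₀, (hS _).2 hi₀⟩
      refine ⟨S.min' hne, S.max' hne + 1, fun _ => ⟨?_, fun i => ⟨fun hi => ?_, fun hi => ?_⟩⟩⟩
      · have := S.min'_le_max' hne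
        omega
      · have := S.min'_le i ((hS i).2 hi)
        have := S.le_max' i ((hS i).2 hi)
        omega
      · exact hD _ _ _ _ ((hS _).1 (S.min'_mem hne)) ((hS _).1 (S.max'_mem hne)) _ _ hi.1
          (by omega) le_rfl le_rfl
    · exact ⟨0, 0, fun h => absurd h hj⟩
  choose p q hpq using hint
  have hlt : ∀ j < c, p j < q j := fun j hj => (hpq j hj).1
  have hm : ∀ j < c, ∀ i, (i, j) ∈ D ↔ p j ≤ i ∧ i < q j := fun j hj => (hpq j hj).2
  have htop : ∀ j < c, (p j, j) ∈ D := fun j hj => (hm j hj _).2 ⟨le_rfl, hlt j hj⟩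
  have hbot : ∀ j < c, (q j - 1, j) ∈ D := fun j hj =>
    (hm j hj _).2 (by have := hlt j hj; omega)
  refine ⟨p, q, ?_, hlt, ?_, ?_, ?_, hc, ?_, ?_⟩
  · intro i j
    constructor
    · intro h
      have hj := (hbox _ h).2
      exact ⟨hj, (hm j hj i).1 h⟩
    · rintro ⟨hj, h⟩
      exact (hm j hj i).2 h
  · intro j hj
    by_contra hn
    have := hD _ _ _ _ (htop j (by omega)) (htop (j + 1) hj) (p j) (j + 1) le_rfl (by omega)
      (by omega) le_rfl
    have := (hm _ hj _).1 this
    omega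
  · intro j hj
    by_contra hn
    have := hD _ _ _ _ (hbot j (by omega)) (hbot (j + 1) hj) (q (j + 1) - 1) j (by omega) le_rfl
      le_rfl (by omega)
    have := (hm j (by omega) _).1 this
    omega
  · intro j hj
    by_contra hn
    have hpr := (hbox _ (htop j (by omega))).1
    -- This row lies below column `j + 1` and above column `j`. Wherever its cell is, convexity
    -- forces a cell of this row into one of these columns.
    obtain ⟨k, hk⟩ := hrow (q (j + 1)) (by simp only at hpr; omega)
    rcases Nat.lt_or_ge j k with hjk | hjk
    · have := hD _ _ _ _ (hbot (j + 1) hj) hk (q (j + 1)) (j + 1) (by omega) le_rfl le_rfl hjk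
      have := (hm _ hj _).1 this
      omega
    · have := hD _ _ _ _ hk (htop j (by omega)) (q (j + 1)) j le_rfl (by omega) hjk le_rfl
      have := (hm j (by omega) _).1 this
      omega
  · have h1 := (hbox _ (hbot 0 hc)).1
    simp only at h1
    have h2 := hlt 0 hc
    obtain ⟨k, hk⟩ := hrow (r - 1) (by omega)
    have := hD _ _ _ _ (hbot 0 hc) hk (r - 1) 0 (by omega) le_rfl le_rfl (Nat.zero_le _)
    have := (hm 0 hc _).1 this
    omega
  · have h1 := (hbox _ (htop 0 hc)).1
    simp only at h1
    obtain ⟨k, hk⟩ := hrow 0 (by omega)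
    have hkc := (hbox _ hk).2
    simp only at hkc
    have := hD _ _ _ _ hk (htop (c - 1) (by omega)) 0 (c - 1) le_rfl (Nat.zero_le _) (by omega)
      le_rfl
    have := (hm (c - 1) (by omega) _).1 this
    omega

namespace Kind

theorem image_fst {k : Kind} (hk : k.Valid) : k.cells.image Prod.fst = Finset.range k.rows := by
  ext i
  simp only [Finset.mem_image, Prod.exists, exists_and_right, exists_eq_right, Finset.mem_range,
    mem_cells]
  constructor
  · rintro ⟨j, h, _⟩; exact h
  · intro hi
    cases k <;> simp only [Valid, rows, cols, Mem] at *
    · exact ⟨0, hi, by omega, by omega⟩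
    · rcases Nat.eq_zero_or_pos i with rfl | h
      · exact ⟨1, hi, by omega, by omega⟩
      · exact ⟨0, hi, by omega, by omega⟩
    · exact ⟨0, hi, by omega, by omega⟩
    · exact ⟨0, hi, by omega, by omega⟩
    · exact ⟨0, hi, by omega, trivial⟩
    · exact ⟨0, hi, by omega, trivial⟩

theorem image_snd {k : Kind} (hk : k.Valid) : k.cells.image Prod.snd = Finset.range k.cols := by
  have h := image_fst hk.tr
  rw [cells_tr, Finset.image_image] at h
  have e : k.tr.rows = k.cols := by cases k <;> rfl
  rw [e] at h
  exact h

theorem reduceCells_cells {k : Kind} (hk : k.Valid) : reduceCells k.cells = k.cells :=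
  reduceCells_of_full (image_fst hk) (image_snd hk)

/-- The diagram rotated by 180 degrees. -/
noncomputable def rot (k : Kind) : Finset (ℕ × ℕ) := rotCells k.rows k.cols k.cells

/-- Different kinds may have the same cells, such as `two 2` and `twoT 2`, so the bounding box is
recovered from the cells. -/
theorem rot_congr {k k' : Kind} (hk : k.Valid) (hk' : k'.Valid) (h : k.cells = k'.cells) :
    k.rot = k'.rot := by
  have h1 : k.rows = k'.rows := by
    have e := image_fst hk
    rw [h, image_fst hk'] at e
    simpa using (congrArg Finset.card e).symm
  have h2 : k.cols = k'.cols := by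
    have e := image_snd hk
    rw [h, image_snd hk'] at e
    simpa using (congrArg Finset.card e).symm
  rw [rot, rot, h1, h2, h]

theorem words_rot {k : Kind} (hk : k.Valid) : words k.rot = words k.cells := by
  rw [rot, words_rotCells k.inBox]
  ext w
  constructor
  · rintro ⟨v, hv, rfl⟩; exact reverse_mem_words hk hv
  · intro hw
    exact ⟨w.reverse, reverse_mem_words hk hw, List.reverse_reverse w⟩

end Kind

namespace SkewShape

theorem cells_rotate (A : SkewShape) :
    A.rotate.cells = rotCells (A.outer.colLen 0) (A.outer.rowLen 0) A.cells ∧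
      InBox (A.outer.colLen 0) (A.outer.rowLen 0) A.cells := by
  have hbox : InBox (A.outer.colLen 0) (A.outer.rowLen 0) A.cells := by
    rintro ⟨i, j⟩ h
    have h1 := (mem_cells.1 h).1
    exact ⟨YoungDiagram.mem_iff_lt_colLen.1 (A.outer.up_left_mem le_rfl (Nat.zero_le _) h1),
      YoungDiagram.mem_iff_lt_rowLen.1 (A.outer.up_left_mem (Nat.zero_le _) le_rfl h1)⟩
  refine ⟨?_, hbox⟩
  ext ⟨i, j⟩
  rw [mem_rotCells hbox, mem_cells, cells, Finset.mem_sdiff]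
  change (i, j) ∈ (rotCompl A.outer A.inner).cells ∧
    (i, j) ∉ (rotCompl A.outer A.outer).cells ↔ _
  simp only [rotCompl, Finset.mem_filter, Finset.mem_product, Finset.mem_range]
  tauto

theorem reducedCells_rotate (A : SkewShape) : A.rotate.reducedCells =
    rotCells (A.cells.image Prod.fst).card (A.cells.image Prod.snd).card A.reducedCells := by
  obtain ⟨h1, h2⟩ := A.cells_rotate
  rw [reducedCells_eq, h1, reduceCells_rotCells h2, reducedCells_eq]

theorem words_reducedCells (A : SkewShape) : words A.reducedCells = words A.cells :=
  words_reduceCells _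

theorem exists_kind {A : SkewShape} (hne : A.cells.Nonempty) (hA : MultFree A.cells) :
    ∃ k : Kind, k.Valid ∧ ((A.reducedCells = k.cells ∧ A.rotate.reducedCells = k.rot) ∨
      (A.reducedCells = k.rot ∧ A.rotate.reducedCells = k.cells)) := by
  obtain ⟨p, q, h⟩ := exists_colRep A.convex.reduceCells (inBox_reduceCells A.cells)
    (fun i hi => exists_mem_row hi) (fun j hj => exists_mem_col hj)
    (Finset.card_pos.2 (hne.image _))
  obtain ⟨k, hk, hr, hc, hor⟩ := h.classify (multFree_reduceCells.2 hA)
  refine ⟨k, hk, ?_⟩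
  rw [reducedCells_rotate, ← hr, ← hc, reducedCells_eq]
  rw [← hr, ← hc] at hor
  rcases hor with e | e
  · exact Or.inl ⟨e, by rw [e]; rfl⟩
  · refine Or.inr ⟨e, ?_⟩
    rw [e, rotCells_rotCells k.inBox]

end SkewShape

/-! ### The shapes of the theorem -/

theorem Multiset.sort_ge_replicate (l a : ℕ) :
    (Multiset.replicate l a).sort (· ≥ ·) = List.replicate l a := by
  rw [List.eq_replicate_iff]
  refine ⟨by simp, fun b hb => ?_⟩
  rw [Multiset.mem_sort] at hb
  exact Multiset.eq_of_mem_replicate hb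

theorem card_rotCells {r c : ℕ} {C : Finset (ℕ × ℕ)} (h : InBox r c C) :
    (rotCells r c C).card = C.card := by
  refine le_antisymm Finset.card_image_le ?_
  conv_lhs => rw [← rotCells_rotCells h]
  exact Finset.card_image_le

theorem card_reduceCells (C : Finset (ℕ × ℕ)) : (reduceCells C).card = C.card := by
  refine Finset.card_image_of_injOn fun x hx y hy h => ?_
  obtain ⟨h1, h2⟩ := Prod.mk.inj h
  exact Prod.ext
    (le_antisymm ((rankIn_le (fst_mem hy)).1 h1.le) ((rankIn_le (fst_mem hx)).1 h1.ge))
    (le_antisymm ((rankIn_le (snd_mem hy)).1 h2.le) ((rankIn_le (snd_mem hx)).1 h2.ge))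

namespace SkewShape

theorem mem_cells_straight {s : Multiset ℕ} {i j : ℕ} : (i, j) ∈ (straight s).cells ↔
    ∃ h : i < (s.sort (· ≥ ·)).length, j < (s.sort (· ≥ ·))[i] := by
  rw [mem_cells]
  simp only [straight, YoungDiagram.mem_ofRowLens, YoungDiagram.notMem_bot, not_false_eq_true,
    and_true]

theorem reducedCells_of_cells_eq {A : SkewShape} {k : Kind} (hk : k.Valid) (h : A.cells = k.cells) :
    A.reducedCells = k.cells := by
  rw [reducedCells_eq, h, Kind.reduceCells_cells hk]

theorem reducedCells_straight_hook {m : ℕ} (hm : 1 ≤ m) (l : ℕ) :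
    (straight (m ::ₘ Multiset.replicate l 1)).reducedCells = (Kind.hook (l + 1) m).cells := by
  refine reducedCells_of_cells_eq ⟨by omega, hm⟩ ?_
  ext ⟨i, j⟩
  rw [mem_cells_straight, Kind.mem_cells]
  have e : (m ::ₘ Multiset.replicate l 1).sort (· ≥ ·) = m :: List.replicate l 1 := by
    rw [Multiset.sort_cons, Multiset.sort_ge_replicate]
    intro b hb
    rw [Multiset.eq_of_mem_replicate hb]
    exact hm
  simp only [e, Kind.rows, Kind.cols, Kind.Mem]
  rcases i with _ | i <;> simp
  omega

theorem reducedCells_straight_two {m : ℕ} (hm : 2 ≤ m) :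
    (straight {m, 2}).reducedCells = (Kind.two m).cells := by
  refine reducedCells_of_cells_eq hm ?_
  ext ⟨i, j⟩
  rw [mem_cells_straight, Kind.mem_cells]
  have e : ({m, 2} : Multiset ℕ).sort (· ≥ ·) = [m, 2] := by
    rw [Multiset.insert_eq_cons, Multiset.sort_cons, Multiset.sort_singleton]
    intro b hb
    rw [Multiset.mem_singleton.1 hb]
    exact hm
  simp only [e, Kind.rows, Kind.cols, Kind.Mem]
  rcases i with _ | _ | i <;> simp
  omega

theorem reducedCells_straight_twoT (l : ℕ) :
    (straight (2 ::ₘ 2 ::ₘ Multiset.replicate l 1)).reducedCells =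
      (Kind.twoT (l + 2)).cells := by
  refine reducedCells_of_cells_eq (k := Kind.twoT (l + 2)) (Nat.le_add_left 2 l) ?_
  ext ⟨i, j⟩
  rw [mem_cells_straight, Kind.mem_cells]
  have e : (2 ::ₘ 2 ::ₘ Multiset.replicate l 1).sort (· ≥ ·) = 2 :: 2 :: List.replicate l 1 := by
    have h : ∀ b ∈ Multiset.replicate l 1, 2 ≥ b := fun b hb => by
      rw [Multiset.eq_of_mem_replicate hb]; omega
    rw [Multiset.sort_cons, Multiset.sort_cons _ _ _ h, Multiset.sort_ge_replicate]
    intro b hb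
    rcases Multiset.mem_cons.1 hb with rfl | hb
    · exact le_rfl
    · exact h b hb
  simp only [e, Kind.rows, Kind.cols, Kind.Mem]
  rcases i with _ | _ | i <;> simp
  omega

theorem mem_outer_column {l i j : ℕ} :
    (i, j) ∈ (straight (Multiset.replicate l 1)).outer ↔ i < l ∧ j = 0 := by
  simp [straight, YoungDiagram.mem_ofRowLens, Multiset.sort_ge_replicate]

theorem mem_outer_row {m i j : ℕ} : (i, j) ∈ (straight {m}).outer ↔ i = 0 ∧ j < m := by
  simp only [straight, YoungDiagram.mem_ofRowLens, Multiset.sort_singleton]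
  rcases i with _ | i <;> simp

theorem reducedCells_oplus {l m : ℕ} (hl : 1 ≤ l) (hm : 1 ≤ m) :
    ((straight (Multiset.replicate l 1)).oplus (straight {m})).reducedCells =
      (Kind.disc (l + 1) (m + 1)).cells := by
  refine reducedCells_of_cells_eq (k := Kind.disc (l + 1) (m + 1)) ⟨by omega, by omega⟩ ?_
  have h1 : (straight (Multiset.replicate l 1)).outer.rowLen 0 = 1 := by
    have h0 : ∀ j, j < (straight (Multiset.replicate l 1)).outer.rowLen 0 ↔ j = 0 := fun j => by
      rw [← YoungDiagram.mem_iff_lt_rowLen, mem_outer_column]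
      omega
    have := h0 0
    have := h0 1
    omega
  have h2 : (straight {m}).outer.colLen 0 = 1 := by
    have h0 : ∀ i, i < (straight {m}).outer.colLen 0 ↔ i = 0 := fun i => by
      rw [← YoungDiagram.mem_iff_lt_colLen, mem_outer_row]
      omega
    have := h0 0
    have := h0 1
    omega
  ext ⟨i, j⟩
  have ho : (i, j) ∈ ((straight (Multiset.replicate l 1)).oplus (straight {m})).outer.cells ↔
      (i = 0 ∧ j = 0) ∨ (i = 0 ∧ 1 ≤ j ∧ j < m + 1) ∨ (1 ≤ i ∧ i < l + 1 ∧ j = 0) := by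
    simp only [oplus, glue, h1, h2, Finset.mem_union, Finset.mem_product, Finset.mem_range,
      Finset.mem_image, YoungDiagram.mem_cells, Prod.exists, Prod.mk.injEq, mem_outer_row,
      mem_outer_column]
    constructor
    · rintro ((h | ⟨a, b, h, rfl, rfl⟩) | ⟨a, b, h, rfl, rfl⟩) <;> omega
    · rintro (h | h | h)
      · exact Or.inl (Or.inl (by omega))
      · exact Or.inl (Or.inr ⟨0, j - 1, by omega, by omega, by omega⟩)
      · exact Or.inr ⟨i - 1, 0, by omega, by omega, by omega⟩
  -- With empty inner shapes, `glue` reduces to the filled corner block, which is a single cell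
  -- here.
  have hi : (i, j) ∈ ((straight (Multiset.replicate l 1)).oplus (straight {m})).inner.cells ↔
      i = 0 ∧ j = 0 := by
    have hb : ∀ s, (straight s).inner = ⊥ := fun _ => rfl
    simp only [oplus, glue, h1, h2, hb, YoungDiagram.cells_bot, Finset.image_empty,
      Finset.union_empty, Finset.mem_product, Finset.mem_range]
    omega
  rw [cells, Finset.mem_sdiff, ho, hi, Kind.mem_cells]
  simp only [Kind.rows, Kind.cols, Kind.Mem]
  omega

/-! ### Skew shapes up to rotation -/

/-- Up to rotation, `A` is the diagram `k`. -/
def HasKind (A : SkewShape) (k : Kind) : Prop :=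
  (A.reducedCells = k.cells ∧ A.rotate.reducedCells = k.rot) ∨
    (A.reducedCells = k.rot ∧ A.rotate.reducedCells = k.cells)

namespace HasKind

variable {A B : SkewShape} {k k' : Kind}

theorem words_eq (h : A.HasKind k) (hk : k.Valid) : words A.cells = words k.cells := by
  rcases h with ⟨h, _⟩ | ⟨h, _⟩ <;> rw [← words_reducedCells, h]
  rw [Kind.words_rot hk]

theorem words_rotate_eq (h : A.HasKind k) (hk : k.Valid) :
    words A.rotate.cells = words k.cells := by
  rcases h with ⟨_, h⟩ | ⟨_, h⟩ <;> rw [← words_reducedCells, h]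
  rw [Kind.words_rot hk]

theorem words_eq_of_mem (h : A.HasKind k) (hk : k.Valid) {A' : SkewShape}
    (hA' : A' ∈ ({A, A.rotate} : Set SkewShape)) : words A'.cells = words A.cells := by
  rcases hA' with rfl | rfl
  · rfl
  · rw [h.words_rotate_eq hk, h.words_eq hk]

theorem card_eq (h : A.HasKind k) : k.cells.card = A.size := by
  rw [size, ← card_reduceCells A.cells, ← reducedCells_eq]
  rcases h with ⟨h, _⟩ | ⟨h, _⟩ <;> rw [h]
  rw [Kind.rot, card_rotCells k.inBox]

theorem exists_reducedCells_eq (h : A.HasKind k) :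
    ∃ A' ∈ ({A, A.rotate} : Set SkewShape), A'.reducedCells = k.cells := by
  rcases h with ⟨h, _⟩ | ⟨_, h⟩
  · exact ⟨A, Or.inl rfl, h⟩
  · exact ⟨A.rotate, Or.inr rfl, h⟩

theorem equiv_of_cells_eq (h : A.HasKind k) (h' : B.HasKind k') (hk : k.Valid) (hk' : k'.Valid)
    (e : k'.cells = k.cells) : B ≈ A ∨ B ≈ A.rotate := by
  have er := Kind.rot_congr hk' hk e
  change B.reducedCells = A.reducedCells ∨ B.reducedCells = A.rotate.reducedCells
  rcases h with ⟨h1, h2⟩ | ⟨h1, h2⟩ <;> rcases h' with ⟨h3, _⟩ | ⟨h3, _⟩ <;>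
    simp [h1, h2, h3, e, er]

end HasKind

theorem words_eq_of_equiv {A B : SkewShape} (h : B ≈ A) : words B.cells = words A.cells := by
  rw [← words_reducedCells, ← words_reducedCells A]
  exact congrArg words h

theorem equiv_of_size_eq_zero {A B : SkewShape} (hA : A.size = 0) (hB : B.size = 0) : B ≈ A := by
  change B.reducedCells = A.reducedCells
  rw [reducedCells_eq, reducedCells_eq, Finset.card_eq_zero.1 hA, Finset.card_eq_zero.1 hB]

end SkewShape

/-- The larger diagram is a `disc` and the smaller one never is. This turns equality of words into
equality of diagrams. -/
theorem Kind.Listed.not_symm {k k' : Kind} (h : Kind.Listed k k') : ¬ Kind.Listed k' k := by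
  rintro ⟨r, c, rfl, _⟩
  obtain ⟨_, _, _, h | h | ⟨_, _, h⟩ | ⟨_, _, h⟩⟩ := h <;> cases h

/-- The pairs `(A, B)` for which, up to rotation, the difference of the skew Schur functions is
`F`-positive although `A` and `B` differ. -/
def SkewShape.ListedPair (n : ℕ) (A' B' : SkewShape) : Prop :=
  (∃ l : ℕ, 1 ≤ l ∧ l ≤ n - 1 ∧
    A' ≈ (SkewShape.straight (Multiset.replicate l 1)).oplus (SkewShape.straight {n - l}) ∧
    (B' ≈ SkewShape.straight ((n - l) ::ₘ Multiset.replicate l 1) ∨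
      B' ≈ SkewShape.straight ((n - l + 1) ::ₘ Multiset.replicate (l - 1) 1))) ∨
  (4 ≤ n ∧
    A' ≈ (SkewShape.straight (Multiset.replicate 2 1)).oplus (SkewShape.straight {n - 2}) ∧
    B' ≈ SkewShape.straight {n - 2, 2}) ∨
  (4 ≤ n ∧
    A' ≈ (SkewShape.straight (Multiset.replicate (n - 2) 1)).oplus (SkewShape.straight {2}) ∧
    B' ≈ SkewShape.straight (2 ::ₘ 2 ::ₘ Multiset.replicate (n - 4) 1))

namespace SkewShape

/-- The parameters correspond by r = l + 1 and c = n - l + 1. -/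
theorem listedPair_of_listed {n : ℕ} {A' B' : SkewShape} {k k' : Kind} (hk : k.Valid)
    (hn : k.cells.card = n) (hA : A'.reducedCells = k.cells) (hB : B'.reducedCells = k'.cells)
    (h : Kind.Listed k k') : ListedPair n A' B' := by
  obtain ⟨r, c, rfl, h⟩ := h
  obtain ⟨hr, hc⟩ : 2 ≤ r ∧ 2 ≤ c := hk
  have hcard := Kind.card_disc hr hc
  obtain ⟨l, rfl⟩ : ∃ l, r = l + 1 := ⟨r - 1, by omega⟩
  obtain ⟨m, rfl⟩ : ∃ m, c = m + 1 := ⟨c - 1, by omega⟩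
  obtain rfl : n = l + m := by omega
  have hA' : A' ≈ (straight (Multiset.replicate l 1)).oplus (straight {m}) :=
    hA.trans (reducedCells_oplus (by omega) (by omega)).symm
  have e : l + m - l = m := by omega
  rcases h with rfl | rfl | ⟨h1, h2, rfl⟩ | ⟨h1, h2, rfl⟩
  · refine Or.inl ⟨l, by omega, by omega, by rwa [e], Or.inl ?_⟩
    rw [e]
    exact hB.trans (reducedCells_straight_hook (by omega) l).symm
  · refine Or.inl ⟨l, by omega, by omega, by rwa [e], Or.inr ?_⟩
    rw [e]
    obtain ⟨l, rfl⟩ : ∃ i, l = i + 1 := ⟨l - 1, by omega⟩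
    exact hB.trans (reducedCells_straight_hook (by omega) l).symm
  · obtain rfl : l = 2 := by omega
    refine Or.inr (Or.inl ⟨by omega, by rwa [e], ?_⟩)
    rw [e]
    exact hB.trans (reducedCells_straight_two (by omega)).symm
  · obtain rfl : m = 2 := by omega
    have e' : l + 2 - 2 = l := by omega
    refine Or.inr (Or.inr ⟨by omega, by rwa [e'], ?_⟩)
    obtain ⟨l, rfl⟩ : ∃ i, l = i + 2 := ⟨l - 2, by omega⟩
    exact hB.trans (reducedCells_straight_twoT l).symm

theorem ListedPair.exists_listed {n : ℕ} {A' B' : SkewShape} (h : ListedPair n A' B') :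
    ∃ k k' : Kind, k.Valid ∧ A'.reducedCells = k.cells ∧ B'.reducedCells = k'.cells ∧
      Kind.Listed k k' := by
  rcases h with ⟨l, h1, h2, hA, hB⟩ | ⟨h4, hA, hB⟩ | ⟨h4, hA, hB⟩
  · refine ⟨Kind.disc (l + 1) (n - l + 1), ?_⟩
    rcases hB with hB | hB
    · exact ⟨Kind.hook (l + 1) (n - l), ⟨by omega, by omega⟩,
        hA.trans (reducedCells_oplus (by omega) (by omega)),
        hB.trans (reducedCells_straight_hook (by omega) l), _, _, rfl, Or.inl rfl⟩
    · refine ⟨Kind.hook l (n - l + 1), ⟨by omega, by omega⟩,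
        hA.trans (reducedCells_oplus (by omega) (by omega)), ?_, _, _, rfl, Or.inr (Or.inl rfl)⟩
      have := reducedCells_straight_hook (m := n - l + 1) (by omega) (l - 1)
      rw [Nat.sub_add_cancel h1] at this
      exact hB.trans this
  · exact ⟨Kind.disc 3 (n - 2 + 1), Kind.two (n - 2), ⟨by omega, by omega⟩,
      hA.trans (reducedCells_oplus (by omega) (by omega)),
      hB.trans (reducedCells_straight_two (by omega)), _, _, rfl,
      Or.inr (Or.inr (Or.inl ⟨rfl, by omega, rfl⟩))⟩
  · obtain ⟨n, rfl⟩ : ∃ i, n = i + 4 := ⟨n - 4, by omega⟩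
    exact ⟨Kind.disc (n + 3) 3, Kind.twoT (n + 2), ⟨by omega, by omega⟩,
      hA.trans (reducedCells_oplus (by omega) (by omega)),
      hB.trans (reducedCells_straight_twoT n), _, _, rfl,
      Or.inr (Or.inr (Or.inr ⟨rfl, by omega, rfl⟩))⟩

theorem ListedPair.words_subset {n : ℕ} {A' B' : SkewShape} (h : ListedPair n A' B') :
    words B'.cells ⊆ words A'.cells := by
  obtain ⟨k, k', hk, hA, hB, hl⟩ := h.exists_listed
  rw [← words_reducedCells, ← words_reducedCells A', hA, hB]
  exact hl.words_subset hk

end SkewShape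

/-! ### Proof of the theorem -/

theorem theorem6p2 (n : ℕ) (A B : SkewShape) (hAn : A.size = n) (hBn : B.size = n)
    (hA : QSym.FMultiplicityFree n A.schur) (hB : QSym.FMultiplicityFree n B.schur) :
    (A.schur = B.schur ↔ B ≈ A ∨ B ≈ A.rotate) ∧
    (QSym.FPositive n (A.schur - B.schur) ↔
      QSym.fSupport n B.schur ⊆ QSym.fSupport n A.schur) ∧
    (¬ (B ≈ A ∨ B ≈ A.rotate) →
      (QSym.FPositive n (A.schur - B.schur) ↔
        ∃ A' ∈ ({A, A.rotate} : Set SkewShape), ∃ B' ∈ ({B, B.rotate} : Set SkewShape),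
          (∃ l : ℕ, 1 ≤ l ∧ l ≤ n - 1 ∧
            A' ≈ (SkewShape.straight (Multiset.replicate l 1)).oplus
              (SkewShape.straight {n - l}) ∧
            (B' ≈ SkewShape.straight ((n - l) ::ₘ Multiset.replicate l 1) ∨
              B' ≈ SkewShape.straight ((n - l + 1) ::ₘ Multiset.replicate (l - 1) 1))) ∨
          (4 ≤ n ∧
            A' ≈ (SkewShape.straight (Multiset.replicate 2 1)).oplus
              (SkewShape.straight {n - 2}) ∧
            B' ≈ SkewShape.straight {n - 2, 2}) ∨
          (4 ≤ n ∧
            A' ≈ (SkewShape.straight (Multiset.replicate (n - 2) 1)).oplus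
              (SkewShape.straight {2}) ∧
            B' ≈ SkewShape.straight (2 ::ₘ 2 ::ₘ Multiset.replicate (n - 4) 1)))) := by
  have iA := SkewShape.comp_injective hAn hA
  have iB := SkewShape.comp_injective hBn hB
  have hpos : QSym.FPositive n (A.schur - B.schur) ↔ words B.cells ⊆ words A.cells := by
    rw [SkewShape.schur_eq hAn, SkewShape.schur_eq hBn, QSym.fPositive_sub_iff iA iB,
      SkewShape.range_comp_subset_iff hAn hBn]
  have heq : A.schur = B.schur ↔ words A.cells = words B.cells := by
    rw [SkewShape.schur_eq hAn, SkewShape.schur_eq hBn, QSym.sum_eq_sum_iff iA iB,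
      Set.Subset.antisymm_iff, SkewShape.range_comp_subset_iff hAn hBn,
      SkewShape.range_comp_subset_iff hBn hAn, Set.Subset.antisymm_iff]
  have hsupp : QSym.FPositive n (A.schur - B.schur) ↔
      QSym.fSupport n B.schur ⊆ QSym.fSupport n A.schur := by
    rw [SkewShape.schur_eq hAn, SkewShape.schur_eq hBn, QSym.fPositive_sub_iff iA iB,
      QSym.fSupport_of_injective iA, QSym.fSupport_of_injective iB]
  -- The empty diagram has no kind; any two empty shapes are equivalent.
  rcases Nat.eq_zero_or_pos n with rfl | hn
  · have h : B ≈ A := SkewShape.equiv_of_size_eq_zero hAn hBn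
    exact ⟨⟨fun _ => Or.inl h, fun _ => heq.2 (SkewShape.words_eq_of_equiv h).symm⟩, hsupp,
      fun hne => absurd (Or.inl h) hne⟩
  obtain ⟨k, hk, hAk⟩ := SkewShape.exists_kind (Finset.card_pos.1 (hAn.trans_gt hn))
    (SkewShape.multFree_cells hAn hA)
  obtain ⟨k', hk', hBk⟩ := SkewShape.exists_kind (Finset.card_pos.1 (hBn.trans_gt hn))
    (SkewShape.multFree_cells hBn hB)
  replace hAk : A.HasKind k := hAk
  replace hBk : B.HasKind k' := hBk
  have cA : k.cells.card = n := hAk.card_eq.trans hAn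
  have cB : k'.cells.card = n := hBk.card_eq.trans hBn
  refine ⟨⟨fun h => ?_, fun h => ?_⟩, hsupp, fun hne => hpos.trans ⟨fun h => ?_, ?_⟩⟩
  -- Equal sets of words are contained in each other, and the nontrivial containment cannot hold in
  -- both directions.
  · have hw := heq.1 h
    rw [hAk.words_eq hk, hBk.words_eq hk'] at hw
    rcases Kind.words_subset hk hk' (cB.trans cA.symm) hw.ge with e | hl
    · exact hAk.equiv_of_cells_eq hBk hk hk' e
    rcases Kind.words_subset hk' hk (cA.trans cB.symm) hw.le with e | hl'
    · exact hAk.equiv_of_cells_eq hBk hk hk' e.symm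
    · exact absurd hl' hl.not_symm
  · rw [heq]
    rcases h with h | h
    · exact (SkewShape.words_eq_of_equiv h).symm
    · rw [SkewShape.words_eq_of_equiv h, hAk.words_eq_of_mem hk (Or.inr rfl)]
  · rw [hAk.words_eq hk, hBk.words_eq hk'] at h
    rcases Kind.words_subset hk hk' (cB.trans cA.symm) h with e | hl
    · exact absurd (hAk.equiv_of_cells_eq hBk hk hk' e) hne
    obtain ⟨A', hA', eA⟩ := hAk.exists_reducedCells_eq
    obtain ⟨B', hB', eB⟩ := hBk.exists_reducedCells_eq
    exact ⟨A', hA', B', hB', SkewShape.listedPair_of_listed hk cA eA eB hl⟩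
  · rintro ⟨A', hA', B', hB', h⟩
    rw [← hAk.words_eq_of_mem hk hA', ← hBk.words_eq_of_mem hk' hB']
    exact SkewShape.ListedPair.words_subset (n := n) h
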